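/- **Setting.** On $\mathbb R^7$ with dual basis $e^1,\dots,e^7$ put $\varphi_0=e^{123}+e^1\wedge(e^{45}+e^{67})+e^2\wedge(e^{46}-e^{57})+e^3\wedge(-e^{47}-e^{56})$. Let $M$ be a smooth $7$-manifold with an $\mathrm{SO}(4)$-structure $(\varphi,\mathsf A)$: $\varphi\in\Omega^3(M)$ is a $\mathrm G_2$-structure (each $T_xM$ has a coframe $e$ with $e^*\varphi_0=\varphi_x$), with induced metric $g$ and volume form determined by $g(u,v)\,\mathrm{vol}=\tfrac16(\iota_u\varphi)\wedge(\iota_v\varphi)\wedge\varphi$, and $\mathsf A\subset TM$ is a smooth rank-$3$ distribution of associative planes ($\varphi|_{\mathsf A}=\mathrm{vol}_{\mathsf A}$ for a suitable orientation of $\mathsf A$). Extend $\mathrm{vol}_{\mathsf A}$ by zero on $\mathsf A^\perp$. Assume that $(\varphi,\mathsf A)$ is *quaternion-Sasakian*: on the cone $\mathrm C(M)=\mathbb R^+\times M$ the $4$-form $\Theta=r^3dr\wedge(4\,\mathrm{vol}_{\mathsf A}-\varphi)+r^4\ast(4\,\mathrm{vol}_{\mathsf A}-\varphi)$ (with $\ast$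 the Hodge star of $M$) is parallel for the Levi-Civita connection of $dr^2+r^2g$. Let $\pi\colon\mathcal B\to M$ be the $\mathrm{SO}(4)$-bundle of coframes $e\colon T_xM\to\mathbb R^7$ with $e^*\varphi_0=\varphi_x$ and $\mathsf A_x=\ker(e^4,e^5,e^6,e^7)$, let $(\alpha,\beta)=(\alpha_1,\alpha_2,\alpha_3,\beta_1,\dots,\beta_4)$ be the tautological $\mathbb R^7$-valued $1$-form on $\mathcal B$, and let $\psi$ be the restriction to $\mathcal B$ of the $\mathfrak{so}(7)$-valued Levi-Civita connection form of $g$ (with the sign convention $\nabla e^i=-\sum_j\psi_{ij}\otimes e^j$ along local coframes). The *natural connection* $(\zeta,\nu)=(\zeta_1,\zeta_2,\zeta_3,\nu_1,\nu_2,\nu_3)$ consists of the $1$-forms on $\mathcal B$ for which the lower right $4\times4$ block of $\psi$ is $$[\zeta]^++[\nu]^-=\begin{bmatrix}0&-\zeta_1-\nu_1&-\zeta_2+\nu_2&\zeta_3+\nu_3\\ \zeta_1+\nu_1&0&\zeta_3-\nu_3&\zeta_2+\nu_2\\ \zeta_2-\nu_2&-\zeta_3+\nu_3&0&-\zeta_1+\nu_1\\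 -\zeta_3-\nu_3&-\zeta_2-\nu_2&\zeta_1-\nu_1&0\end{bmatrix}.$$ **Proposition.** The following *first structure equations* hold on $\mathcal B$: $$d\begin{bmatrix}\alpha_1\\ \alpha_2\\ \alpha_3\end{bmatrix}=-\begin{bmatrix}0&2\zeta_3&-2\zeta_2\\-2\zeta_3&0&2\zeta_1\\2\zeta_2&-2\zeta_1&0\end{bmatrix}\wedge\begin{bmatrix}\alpha_1\\ \alpha_2\\ \alpha_3\end{bmatrix}+2\begin{bmatrix}\alpha_2\wedge\alpha_3-\beta_1\wedge\beta_2-\beta_3\wedge\beta_4\\ \alpha_3\wedge\alpha_1-\beta_1\wedge\beta_3+\beta_2\wedge\beta_4\\ \alpha_1\wedge\alpha_2+\beta_1\wedge\beta_4+\beta_2\wedge\beta_3\end{bmatrix},$$ $$d\begin{bmatrix}\beta_1\\ \beta_2\\ \beta_3\\ \beta_4\end{bmatrix}=-\big([\zeta]^++[\nu]^-\big)\wedge\begin{bmatrix}\beta_1\\ \beta_2\\ \beta_3\\ \beta_4\end{bmatrix}+\begin{bmatrix}\alpha_1\wedge\beta_2+\alpha_2\wedge\beta_3-\alpha_3\wedge\beta_4\\-\alpha_1\wedge\beta_1-\alpha_3\wedge\beta_3-\alpha_2\wedge\beta_4\\-\alpha_2\wedge\beta_1+\alpha_3\wedge\beta_2+\alpha_1\wedge\beta_4\\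 \alpha_3\wedge\beta_1+\alpha_2\wedge\beta_2-\alpha_1\wedge\beta_3\end{bmatrix}.$$ Further, there exist smooth functions $W_{ij}=W_{ji}\colon\mathcal B\to\mathbb R$ ($1\le i,j\le3$) with $W_{11}+W_{22}+W_{33}=0$ such that the *second structure equations* hold on $\mathcal B$: $$d\begin{bmatrix}\zeta_1\\ \zeta_2\\ \zeta_3\end{bmatrix}=2\begin{bmatrix}\zeta_2\wedge\zeta_3\\ \zeta_3\wedge\zeta_1\\ \zeta_1\wedge\zeta_2\end{bmatrix},$$ $$d\begin{bmatrix}\nu_1\\ \nu_2\\ \nu_3\end{bmatrix}=2\begin{bmatrix}\nu_2\wedge\nu_3\\ \nu_3\wedge\nu_1\\ \nu_1\wedge\nu_2\end{bmatrix}+\begin{bmatrix}2+W_{11}&W_{12}&W_{13}\\W_{12}&2+W_{22}&W_{23}\\W_{13}&W_{23}&2+W_{33}\end{bmatrix}\begin{bmatrix}-\beta_1\wedge\beta_2+\beta_3\wedge\beta_4\\ \beta_1\wedge\beta_3+\beta_2\wedge\beta_4\\ \beta_1\wedge\beta_4-\beta_2\wedge\beta_3\end{bmatrix}.$$ -/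

import Mathlib

set_option maxSynthPendingDepth 3

open scoped Manifold ContDiff Topology
open Set Bundle

noncomputable section

namespace QuatSasakian

/-! ### Linear algebra on `ℝ⁷` -/

/-- The model space `ℝ⁷`. Coordinates are numbered `0, …, 6`. -/
abbrev V7 : Type := EuclideanSpace ℝ (Fin 7)

/-- The standard basis vector `∂ᵢ` of `ℝ⁷`. -/
abbrev bas (i : Fin 7) : V7 := EuclideanSpace.single i (1 : ℝ)

/-- The elementary `3`-form `eⁱ ∧ eʲ ∧ eᵏ` on `ℝ⁷`. -/
def mono3 (i j k : Fin 7) (u v w : V7) : ℝ :=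
  Matrix.det !![u i, u j, u k; v i, v j, v k; w i, w j, w k]

/-- The standard `G₂` three-form
`e¹²³ + e¹ ∧ (e⁴⁵ + e⁶⁷) + e² ∧ (e⁴⁶ - e⁵⁷) + e³ ∧ (- e⁴⁷ - e⁵⁶)`
(the indices `1, …, 7` are shifted to `0, …, 6`). -/
def phi0 (u v w : V7) : ℝ :=
  mono3 0 1 2 u v w + mono3 0 3 4 u v w + mono3 0 5 6 u v w + mono3 1 3 5 u v w
    - mono3 1 4 6 u v w - mono3 2 3 6 u v w - mono3 2 4 5 u v w

/-- The `1`-form `u ↦ φ(u, a, b)`. -/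
def contract (φ : V7 [⋀^Fin 3]→L[ℝ] ℝ) (a b : V7) : V7 →L[ℝ] ℝ :=
  φ.toContinuousMultilinearMap.toContinuousLinearMap ![0, a, b] 0

/-- The symmetric bilinear form `b(u, v)` with
`(1/6) (ι_u φ) ∧ (ι_v φ) ∧ φ = b(u, v) dx¹ ∧ ⋯ ∧ dx⁷`. The value of the wedge product of a `2`-form,
a `2`-form and a `3`-form on `(∂₀, …, ∂₆)` is the signed sum over all permutations divided by
`2! 2! 3! = 24`. -/
def bryantForm (φ : V7 [⋀^Fin 3]→L[ℝ] ℝ) : V7 →L[ℝ] V7 →L[ℝ] ℝ :=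
  ∑ σ : Equiv.Perm (Fin 7),
    ((1 / 6 : ℝ) * (1 / 24) * ((Equiv.Perm.sign σ : ℤ) : ℝ) *
        φ ![bas (σ 4), bas (σ 5), bas (σ 6)]) •
      (contract φ (bas (σ 0)) (bas (σ 1))).smulRight (contract φ (bas (σ 2)) (bas (σ 3)))

/-- The real number `δ` with `vol_φ = δ dx¹ ∧ ⋯ ∧ dx⁷`. Taking the determinant of
`g_φ(u, v) δ = b(u, v)`, and using that `det g_φ = δ²`, gives `δ⁹ = det b`, so `δ` is the real
ninth root of `det b`. -/
def volDensity (φ : V7 [⋀^Fin 3]→L[ℝ] ℝ) : ℝ :=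
  let d : ℝ := Matrix.det (Matrix.of fun i j : Fin 7 => bryantForm φ (bas i) (bas j))
  Real.sign d * |d| ^ ((1 : ℝ) / 9)

/-- The metric `g_φ`, determined by `g_φ(u, v) vol_φ = (1/6) (ι_u φ) ∧ (ι_v φ) ∧ φ`. -/
def metricOf (φ : V7 [⋀^Fin 3]→L[ℝ] ℝ) : V7 →L[ℝ] V7 →L[ℝ] ℝ :=
  (volDensity φ)⁻¹ • bryantForm φ

/-- The volume form `vol_φ`. -/
def volOf (φ : V7 [⋀^Fin 3]→L[ℝ] ℝ) (v : Fin 7 → V7) : ℝ :=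
  volDensity φ * Matrix.det (Matrix.of fun i j : Fin 7 => v i j)

/-- The Hodge star `⋆ η ∈ Λ⁴` of a `3`-form `η`, for the metric and the orientation induced by `φ`:
`(⋆ η)(w) = (1/3!) ∑ g^{p₀q₀} g^{p₁q₁} g^{p₂q₂} η(∂_{q₀}, ∂_{q₁}, ∂_{q₂}) `
`vol(∂_{p₀}, ∂_{p₁}, ∂_{p₂}, w₀, w₁, w₂, w₃)`. -/
def hodge3 (φ η : V7 [⋀^Fin 3]→L[ℝ] ℝ) (w : Fin 4 → V7) : ℝ :=
  let G : Matrix (Fin 7) (Fin 7) ℝ := Matrix.of fun i j => metricOf φ (bas i) (bas j)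
  (1 / 6 : ℝ) * ∑ p : Fin 3 → Fin 7, ∑ q : Fin 3 → Fin 7,
    (∏ s, G⁻¹ (p s) (q s)) * η (fun s => bas (q s)) *
      volOf φ (Fin.append (fun s => bas (p s)) w : Fin (3 + 4) → V7)

/-- The `g`-orthogonal projection onto a subspace `A`. -/
def orthProj (g : V7 →L[ℝ] V7 →L[ℝ] ℝ) (A : Submodule ℝ V7) : V7 →L[ℝ] V7 :=
  Classical.epsilon fun P => ∀ u, P u ∈ A ∧ ∀ a ∈ A, g (u - P u) a = 0

/-- The `3`-plane `A` is associative, i.e. `φ` restricts to a volume form `± vol` of `A`: the square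
of its value on three vectors of `A` is the Gram determinant of these vectors. -/
def IsAssociative (φ : V7 [⋀^Fin 3]→L[ℝ] ℝ) (A : Submodule ℝ V7) : Prop :=
  Module.finrank ℝ A = 3 ∧ ∀ a : Fin 3 → V7, (∀ i, a i ∈ A) →
    (φ a) ^ 2 = Matrix.det (Matrix.of fun i j => metricOf φ (a i) (a j))

/-- The volume form of an associative `3`-plane `A`, extended by zero on the orthogonal complement.
`A` carries the orientation for which `φ|_A` is the volume form. -/
def volA (φ : V7 [⋀^Fin 3]→L[ℝ] ℝ) (A : Submodule ℝ V7) : V7 [⋀^Fin 3]→L[ℝ] ℝ :=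
  φ.compContinuousLinearMap (orthProj (metricOf φ) A)

/-! ### Tensor fields and the Levi-Civita connection on a manifold, in charts

Mathlib identifies `TangentSpace I x` with the model vector space through the preferred chart
`extChartAt I x`. All manifolds below have no boundary. -/

section Manifold

variable {E : Type*} [NormedAddCommGroup E] [NormedSpace ℝ E]
  {H : Type*} [TopologicalSpace H] (I : ModelWithCorners ℝ E H)
  {X : Type*} [TopologicalSpace X] [ChartedSpace H X]

/-- The differential at `y` of the inverse of the preferred chart at `x₀`. -/
def chartFrame (x₀ : X) (y : E) : E →L[ℝ] TangentSpace I ((extChartAt I x₀).symm y) :=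
  mfderiv 𝓘(ℝ, E) I (extChartAt I x₀).symm y

/-- A field of alternating `n`-forms, read in the preferred chart at `x₀`. -/
def formInChart {n : ℕ} (κ : Π x : X, TangentSpace I x [⋀^Fin n]→L[ℝ] ℝ) (x₀ : X) (y : E) :
    E [⋀^Fin n]→L[ℝ] ℝ :=
  (κ ((extChartAt I x₀).symm y)).compContinuousLinearMap (chartFrame I x₀ y)

/-- Smoothness of a differential `n`-form, tested in all preferred charts. -/
def IsSmoothForm {n : ℕ} (κ : Π x : X, TangentSpace I x [⋀^Fin n]→L[ℝ] ℝ) : Prop :=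
  ∀ x₀ : X, ContDiffOn ℝ ∞ (formInChart I κ x₀) (extChartAt I x₀).target

/-- A metric tensor, read in the preferred chart at `x₀`. -/
def metricInChart (g : Π x : X, TangentSpace I x →L[ℝ] TangentSpace I x →L[ℝ] ℝ) (x₀ : X) (y : E) :
    E →L[ℝ] E →L[ℝ] ℝ :=
  let gy : E →L[ℝ] E →L[ℝ] ℝ := g ((extChartAt I x₀).symm y)
  let L : E →L[ℝ] E := chartFrame I x₀ y
  gy.bilinearComp L L

set_option synthInstance.maxHeartbeats 200000 in
/-- The Christoffel symbol `Γ(v, w)` at `x` of the metric `g` in the preferred chart at `x`: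
the solution of `2 g(Γ(v, w), u) = (∂_v g)(w, u) + (∂_w g)(v, u) - (∂_u g)(v, w)` for all `u`.
So the Levi-Civita connection at `x` is `∇_v w = ∂_v w + Γ(v, w)` in this chart. -/
def christoffel (g : Π x : X, TangentSpace I x →L[ℝ] TangentSpace I x →L[ℝ] ℝ) (x : X) :
    E →L[ℝ] E →L[ℝ] E :=
  let G : E → E →L[ℝ] E →L[ℝ] ℝ := metricInChart I g x
  let y : E := extChartAt I x x
  let D : E →L[ℝ] E →L[ℝ] E →L[ℝ] ℝ := fderiv ℝ G y
  let D₂ : E →L[ℝ] E →L[ℝ] E →L[ℝ] ℝ := D.flip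
  let D₃ : E →L[ℝ] E →L[ℝ] E →L[ℝ] ℝ :=
    (ContinuousLinearMap.flipₗᵢ ℝ E E ℝ : (E →L[ℝ] E →L[ℝ] ℝ) →L[ℝ] E →L[ℝ] E →L[ℝ] ℝ).comp D₂
  let K : E →L[ℝ] E →L[ℝ] E →L[ℝ] ℝ := (1 / 2 : ℝ) • (D + D₂ - D₃)
  ((ContinuousLinearMap.compL ℝ E (E →L[ℝ] ℝ) E) (G y).inverse).comp K

/-- A covariant `n`-tensor field `T` is parallel on the set `s` for the Levi-Civita connection of
`g`: at each point `x` of `s`, in the preferred chart at `x`, its components are differentiable and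
`(∇_v T)(w) = ∂_v (T(w)) - ∑ᵢ T(w₁, …, Γ(v, wᵢ), …, wₙ)` vanishes. -/
def IsParallelOn (g : Π x : X, TangentSpace I x →L[ℝ] TangentSpace I x →L[ℝ] ℝ) {n : ℕ}
    (T : Π x : X, (Fin n → TangentSpace I x) → ℝ) (s : Set X) : Prop :=
  ∀ x ∈ s, ∀ w : Fin n → E,
    let Tc : E → (Fin n → E) → ℝ :=
      fun y w' => T ((extChartAt I x).symm y) (fun i => chartFrame I x y (w' i))
    DifferentiableAt ℝ (fun y => Tc y w) (extChartAt I x x) ∧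
      ∀ v : E, fderiv ℝ (fun y => Tc y w) (extChartAt I x x) v =
        ∑ i, Tc (extChartAt I x x) (Function.update w i (christoffel I g x v (w i)))

/-! ### Differential forms on a submanifold and their exterior derivatives -/

/-- `1`-forms on a manifold. -/
abbrev OneForm (X : Type*) [TopologicalSpace X] [ChartedSpace H X] : Type _ :=
  Π x : X, TangentSpace I x →L[ℝ] ℝ

/-- `2`-forms on a manifold, as bilinear forms on the tangent spaces. -/
abbrev TwoForm (X : Type*) [TopologicalSpace X] [ChartedSpace H X] : Type _ :=
  Π x : X, TangentSpace I x →L[ℝ] TangentSpace I x →L[ℝ] ℝ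

variable {I}

/-- `(θ ∧ η)(v, w) = θ(v) η(w) - θ(w) η(v)`. -/
def wedge (θ η : OneForm I X) : TwoForm I X :=
  fun x => (θ x).smulRight (η x) - (η x).smulRight (θ x)

/-- The product `A ∧ θ` of a matrix of `1`-forms with a column of `1`-forms. -/
def matWedge {n : ℕ} (A : Matrix (Fin n) (Fin n) (OneForm I X)) (θ : Fin n → OneForm I X) :
    Fin n → TwoForm I X :=
  fun i => ∑ j, wedge (A i j) (θ j)

/-- The pullback of a `1`-form along a map `u : ℝᵏ → X`, at the point `z`. -/
def pullback {k : ℕ} (u : EuclideanSpace ℝ (Fin k) → X) (θ : OneForm I X)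
    (z : EuclideanSpace ℝ (Fin k)) : EuclideanSpace ℝ (Fin k) →L[ℝ] ℝ :=
  (θ (u z)).comp (mfderiv 𝓘(ℝ, EuclideanSpace ℝ (Fin k)) I u z)

variable (I) in
/-- `u` is a smooth map from the open set `U ⊆ ℝᵏ` into the subset `S` of `X`. If `S` is an
embedded submanifold, these are the smooth maps from `U` to the manifold `S`; in particular all
local parametrizations of `S` are among them. -/
def IsSmoothMapInto (S : Set X) {k : ℕ} (U : Set (EuclideanSpace ℝ (Fin k)))
    (u : EuclideanSpace ℝ (Fin k) → X) : Prop :=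
  IsOpen U ∧ ContMDiffOn 𝓘(ℝ, EuclideanSpace ℝ (Fin k)) I ∞ u U ∧ MapsTo u U S

variable (I) in
/-- The restriction of `f` to the submanifold `S` of `X` is smooth (only the values of `f` on `S`
matter). -/
def IsSmoothFunOn (S : Set X) (f : X → ℝ) : Prop :=
  ∀ (k : ℕ) (U : Set (EuclideanSpace ℝ (Fin k))) (u : EuclideanSpace ℝ (Fin k) → X),
    IsSmoothMapInto I S U u → ContDiffOn ℝ ∞ (fun z => f (u z)) U

/-- On the submanifold `S` of `X`, the restriction of `θ` is a smooth `1`-form whose exterior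
derivative is the restriction of `Ω`: for every smooth map `u` from an open set of some `ℝᵏ` into
`S` (in particular for every local parametrization of `S`), `u^* θ` is smooth and
`d(u^* θ) = u^* Ω`. -/
def IsExtDerivOn (S : Set X) (θ : OneForm I X) (Ω : TwoForm I X) : Prop :=
  ∀ (k : ℕ) (U : Set (EuclideanSpace ℝ (Fin k))) (u : EuclideanSpace ℝ (Fin k) → X),
    IsSmoothMapInto I S U u →
      ContDiffOn ℝ ∞ (pullback u θ) U ∧
      ∀ z ∈ U, ∀ v w : EuclideanSpace ℝ (Fin k),
        extDeriv (fun z' => ContinuousAlternatingMap.ofSubsingleton ℝ (EuclideanSpace ℝ (Fin k)) ℝ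
            (0 : Fin 1) (pullback u θ z')) z ![v, w] =
          Ω (u z) (mfderiv 𝓘(ℝ, EuclideanSpace ℝ (Fin k)) I u z v)
            (mfderiv 𝓘(ℝ, EuclideanSpace ℝ (Fin k)) I u z w)

end Manifold

/-! ### `SO(4)`-structures and quaternion-Sasakian structures -/

section Structures

variable (M : Type*) [TopologicalSpace M] [ChartedSpace V7 M] [IsManifold (𝓡 7) ∞ M]

/-- An `SO(4)`-structure on a `7`-manifold: a `G₂`-structure `φ` together with a smooth
distribution `A` of associative `3`-planes. -/
structure SO4Structure where
  /-- the three-form -/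
  φ : Π x : M, TangentSpace (𝓡 7) x [⋀^Fin 3]→L[ℝ] ℝ
  smooth_φ : IsSmoothForm (𝓡 7) φ
  /-- at each point there is a coframe in which `φ` is the standard `G₂` form -/
  isG2 : ∀ x : M, ∃ e : TangentSpace (𝓡 7) x ≃L[ℝ] V7,
    ∀ u v w : TangentSpace (𝓡 7) x, φ x ![u, v, w] = phi0 (e u) (e v) (e w)
  /-- the distribution -/
  A : Π x : M, Submodule ℝ (TangentSpace (𝓡 7) x)
  /-- `A` has rank `3` and is locally spanned by smooth vector fields -/
  smooth_A : ∀ x₀ : M, ∃ U ∈ 𝓝 x₀, ∃ Y : Fin 3 → Π x : M, TangentSpace (𝓡 7) x,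
    (∀ i, ContMDiffOn (𝓡 7) (𝓡 7).tangent ∞ (fun x => (⟨x, Y i x⟩ : TangentBundle (𝓡 7) M)) U) ∧
    ∀ x ∈ U, LinearIndependent ℝ (fun i => Y i x) ∧ A x = Submodule.span ℝ (range fun i => Y i x)
  assoc : ∀ x : M, IsAssociative (φ x) (A x)

variable {M}

namespace SO4Structure

variable (S : SO4Structure M)

/-- The Riemannian metric `g = g_φ`. -/
def metric (x : M) : TangentSpace (𝓡 7) x →L[ℝ] TangentSpace (𝓡 7) x →L[ℝ] ℝ :=
  metricOf (S.φ x)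

/-- The three-form `4 vol_A - φ`. -/
def eta (x : M) : V7 [⋀^Fin 3]→L[ℝ] ℝ :=
  let φx : V7 [⋀^Fin 3]→L[ℝ] ℝ := S.φ x
  (4 : ℝ) • volA φx (S.A x) - φx

end SO4Structure

/-- The model with corners of `ℝ × M`. The cone `C(M) = ℝ⁺ × M` is the open
subset `{(r, x) | 0 < r}` of `ℝ × M`. -/
abbrev coneModel : ModelWithCorners ℝ (ℝ × V7) (ModelProd ℝ V7) := 𝓘(ℝ, ℝ).prod (𝓡 7)

/-- The form `dr` on `ℝ × M`. -/
def dr (q : ℝ × M) : TangentSpace coneModel q →L[ℝ] ℝ :=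
  mfderiv coneModel 𝓘(ℝ, ℝ) (Prod.fst : ℝ × M → ℝ) q

/-- The differential of the projection `ℝ × M → M`. -/
def dproj (q : ℝ × M) : TangentSpace coneModel q →L[ℝ] TangentSpace (𝓡 7) q.2 :=
  mfderiv coneModel (𝓡 7) (Prod.snd : ℝ × M → M) q

namespace SO4Structure

variable (S : SO4Structure M)

/-- The cone metric `dr² + r² g`. -/
def coneMetric (q : ℝ × M) : TangentSpace coneModel q →L[ℝ] TangentSpace coneModel q →L[ℝ] ℝ :=
  let g : V7 →L[ℝ] V7 →L[ℝ] ℝ := S.metric q.2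
  let ρ : (ℝ × V7) →L[ℝ] ℝ := dr q
  let P : (ℝ × V7) →L[ℝ] V7 := dproj q
  let gC : (ℝ × V7) →L[ℝ] (ℝ × V7) →L[ℝ] ℝ := ρ.smulRight ρ + (q.1 ^ 2) • g.bilinearComp P P
  gC

/-- The four-form `Θ = r³ dr ∧ (4 vol_A - φ) + r⁴ ⋆ (4 vol_A - φ)` on the cone. -/
def Theta (q : ℝ × M) (w : Fin 4 → TangentSpace coneModel q) : ℝ :=
  q.1 ^ 3 * ∑ i : Fin 4, (-1 : ℝ) ^ (i : ℕ) * dr q (w i) *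
      S.eta q.2 (fun j : Fin 3 => dproj q (w (i.succAbove j))) +
    q.1 ^ 4 * hodge3 (S.φ q.2) (S.eta q.2) (fun i => dproj q (w i))

/-- The structure is quaternion-Sasakian if the `Sp(2)Sp(1)`-structure `Θ` on the cone is
quaternion-Kähler, i.e. parallel for the Levi-Civita connection of the cone metric. -/
def IsQuaternionSasakian : Prop :=
  IsParallelOn coneModel S.coneMetric S.Theta {q : ℝ × M | 0 < q.1}

end SO4Structure

/-! ### The coframe bundle -/

variable (M)

/-- The total space of the bundle `Hom(TM, ℝ⁷)` over `M`; its points are pairs `(x, e)` with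
`e : T_x M → ℝ⁷` linear. It is a smooth manifold, and the coframe bundle of `M` is its open subset
of all `(x, e)` with `e` invertible. -/
abbrev HomTotal : Type _ :=
  TotalSpace (V7 →L[ℝ] V7) (fun x : M => TangentSpace (𝓡 7) x →L[ℝ] Bundle.Trivial M V7 x)

variable {M}

/-- The model with corners of the manifold `HomTotal M`. -/
abbrev homModel : ModelWithCorners ℝ (V7 × (V7 →L[ℝ] V7)) (ModelProd V7 (V7 →L[ℝ] V7)) :=
  (𝓡 7).prod 𝓘(ℝ, V7 →L[ℝ] V7)

/-- The linear map `e : T_x M → ℝ⁷` of the point `b = (x, e)`, as an endomorphism of `ℝ⁷`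
(the tangent space at `x` is `ℝ⁷`, by the preferred chart at `x`). -/
def coframe (b : HomTotal M) : V7 →L[ℝ] V7 := b.2

/-- The tautological `ℝ⁷`-valued `1`-form: `ω_{(x, e)}(v) = e (dπ(v))`. These are its components. -/
def tautForm (i : Fin 7) : OneForm homModel (HomTotal M) := fun b =>
  (EuclideanSpace.proj i : V7 →L[ℝ] ℝ).comp ((coframe b).comp
    (mfderiv homModel (𝓡 7) (fun b' : HomTotal M => b'.1) b))

variable (M) in
/-- The tautological forms `(α₁, α₂, α₃)`. -/
def alpha : Fin 3 → OneForm homModel (HomTotal M) := ![tautForm 0, tautForm 1, tautForm 2]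

variable (M) in
/-- The tautological forms `(β₁, β₂, β₃, β₄)`. -/
def beta : Fin 4 → OneForm homModel (HomTotal M) :=
  ![tautForm 3, tautForm 4, tautForm 5, tautForm 6]

/-- The matrix `[γ]₃` in `so(3)`. -/
def so3Mat (γ : Fin 3 → OneForm homModel (HomTotal M)) :
    Matrix (Fin 3) (Fin 3) (OneForm homModel (HomTotal M)) :=
  !![0, γ 2, -γ 1;
    -γ 2, 0, γ 0;
    γ 1, -γ 0, 0]

/-- The matrix `[ζ]⁺ + [ν]⁻` in `so(4) = sp(1) ⊕ sp(1)`. -/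
def so4Mat (ζ ν : Fin 3 → OneForm homModel (HomTotal M)) :
    Matrix (Fin 4) (Fin 4) (OneForm homModel (HomTotal M)) :=
  !![0, -ζ 0 - ν 0, -ζ 1 + ν 1, ζ 2 + ν 2;
    ζ 0 + ν 0, 0, ζ 2 - ν 2, ζ 1 + ν 1;
    ζ 1 - ν 1, -ζ 2 + ν 2, 0, -ζ 0 + ν 0;
    -ζ 2 - ν 2, -ζ 1 - ν 1, ζ 0 - ν 0, 0]

variable (M) in
/-- The two-forms `(-β₁ ∧ β₂ + β₃ ∧ β₄, β₁ ∧ β₃ + β₂ ∧ β₄, β₁ ∧ β₄ - β₂ ∧ β₃)`. -/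
def betaMinus : Fin 3 → TwoForm homModel (HomTotal M) :=
  ![-wedge (beta M 0) (beta M 1) + wedge (beta M 2) (beta M 3),
    wedge (beta M 0) (beta M 2) + wedge (beta M 1) (beta M 3),
    wedge (beta M 0) (beta M 3) - wedge (beta M 1) (beta M 2)]

/-- The components `ψᵢⱼ` of the connection form on the coframe bundle of the Levi-Civita
connection of `g`, characterized by `∇ eⁱ = - ∑ⱼ ψᵢⱼ eʲ` for every local coframe.
A tangent vector at `b = (x, e)` is a pair `(ẋ, ė)` by means of the preferred chart at `b`
(which comes from the preferred chart of `M` at `x` and the induced trivialization), and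
`ψ(ẋ, ė) = - (ė - e ∘ Γ(ẋ, ·)) ∘ e⁻¹`. -/
def connForm (g : Π x : M, TangentSpace (𝓡 7) x →L[ℝ] TangentSpace (𝓡 7) x →L[ℝ] ℝ)
    (i j : Fin 7) : OneForm homModel (HomTotal M) := fun b =>
  let e : V7 →L[ℝ] V7 := coframe b
  let f : V7 := e.inverse (bas j)
  let ψ : (V7 × (V7 →L[ℝ] V7)) →L[ℝ] ℝ :=
    -((EuclideanSpace.proj i : V7 →L[ℝ] ℝ).comp
      ((ContinuousLinearMap.apply ℝ V7 f).comp (ContinuousLinearMap.snd ℝ V7 (V7 →L[ℝ] V7)) -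
        e.comp (((christoffel (𝓡 7) g b.1).flip f).comp
          (ContinuousLinearMap.fst ℝ V7 (V7 →L[ℝ] V7)))))
  ψ

namespace SO4Structure

variable (S : SO4Structure M)

/-- The bundle `ℬ` of `SO(4)`-coframes: the coframes `e` of `M` in which `φ` is the standard `G₂`
form and `A = span(e₁, e₂, e₃)`, i.e. `A` is the common kernel of `e⁴, e⁵, e⁶, e⁷`. -/
def coframeBundle : Set (HomTotal M) :=
  {b | Function.Bijective (coframe b) ∧
    (∀ u v w : V7, S.φ b.1 ![u, v, w] = phi0 (coframe b u) (coframe b v) (coframe b w)) ∧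
    ∀ u : V7, u ∈ S.A b.1 ↔ ∀ i : Fin 4, coframe b u (Fin.natAdd 3 i) = 0}

/-- The components `ψᵢⱼ` of the Levi-Civita form of `g`. -/
def psi (i j : Fin 7) : OneForm homModel (HomTotal M) := connForm S.metric i j

/-- The first component `ζ` of the natural connection. The lower right `4 × 4` block of the
restriction of `ψ` to `ℬ` is `[ζ]⁺ + [ν]⁻`; solving for `ζ` gives these formulas. -/
def zeta : Fin 3 → OneForm homModel (HomTotal M) :=
  ![(1 / 2 : ℝ) • (-S.psi 3 4 - S.psi 5 6),
    (1 / 2 : ℝ) • (-S.psi 3 5 + S.psi 4 6),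
    (1 / 2 : ℝ) • (S.psi 3 6 + S.psi 4 5)]

/-- The second component `ν` of the natural connection. -/
def nu : Fin 3 → OneForm homModel (HomTotal M) :=
  ![(1 / 2 : ℝ) • (-S.psi 3 4 + S.psi 5 6),
    (1 / 2 : ℝ) • (S.psi 3 5 + S.psi 4 6),
    (1 / 2 : ℝ) • (S.psi 3 6 - S.psi 4 5)]

end SO4Structure

end Structures

end QuatSasakian

end

open QuatSasakian

/-!
The argument has two halves, one for each pair of structure equations.

An `SO(4)`-coframe `e` pulls the Euclidean metric, the form `η₀ = 4 e¹²³ - φ₀` and `⋆ η₀` back to the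
metric `g`, to `η = 4 vol_A - φ` and to `⋆ η`. For the metric and the volume form this is the identity
`(u ⌟ φ₀) ∧ (v ⌟ φ₀) ∧ φ₀ = 6 ⟨u, v⟩ vol`, transported by `e` (`bryantForm_pullback`,
`metricOf_pullback`, `hodge3_pullback`). The Christoffel symbols of the cone at `r = 1`
(`localChr_cone`) turn the parallelism of `r³ dr ∧ η + r⁴ ⋆ η` into the two equations
`∇ᵥ η = v ⌟ ⋆ η` and `∇ᵥ ⋆ η = - v♭ ∧ η` on `M` (`hasCovDeriv_of_isParallelOn`).

As `η` has constant components in `SO(4)`-coframes, the first of these is a linear equation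
`- ψ · η₀ = ω ⌟ ⋆ η₀` between the connection form `ψ` and the tautological form `ω = (α, β)`. It
expresses all of `ψ` by `ζ`, `ν`, `ω` (`connForm_frameRelations`, `FrameRelations.eq_adaptedConn`), and
then `dω = - ψ ∧ ω` becomes the first structure equations.

Differentiating once more, the Ricci identity shows that the curvature of `g` minus that of the unit
sphere annihilates `η` (`curv_annihilates`). Its values thus lie in the stabilizer `so(4)` of `η₀`, and
together with the Bianchi identity and the pair symmetry this forces it to have values in the
`ν`-summand `sp(1)` and to be given by a symmetric traceless `3 × 3` matrix `W`
(`CurvatureRelations.selfdual`, `CurvatureRelations.trace_eq_zero`, `weylMatrix`). Inserting this in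
`dψ = - ψ ∧ ψ + R` gives the second structure equations (`connRhs_zeta`, `connRhs_nu`).

The equations for `dω` and `dψ` are proved for the pullbacks along maps `u` from open subsets of `ℝᵏ` to
`Hom(TM, ℝ⁷)`, in one chart of `M` at a time (`dOne_pullback_tautForm`, `dOne_pullback_connForm`); the
coordinate invariance of Christoffel symbols, curvature and covariant derivatives connects this to
definitions that refer to the chart centered at each point. Contractions with the Levi-Civita symbol on
`ℝ⁷` are integer computations, the symbol being a multiple of a Vandermonde product (`vdm7`).
-/

noncomputable section

namespace QuatSasakian

/-! ### The symmetric form of a `3`-form, and signs of permutations -/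

/-- The contraction of `eᵢ ⌟ φ₀` with an array `f`: with `f a b = v a * w b` the sum
`∑ i, u i * phiCoord i f` is `φ₀(u, v, w)`. Each of the seven two-forms `eᵢ ⌟ φ₀` has three terms.
It is defined over any ring, so that it can be evaluated in `ℤ` by the kernel. -/
def phiCoord {R : Type*} [Add R] [Sub R] (i : Fin 7) (f : Fin 7 → Fin 7 → R) : R :=
  match i with
  | 0 => (f 1 2 - f 2 1) + (f 3 4 - f 4 3) + (f 5 6 - f 6 5)
  | 1 => (f 2 0 - f 0 2) + (f 3 5 - f 5 3) + (f 6 4 - f 4 6)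
  | 2 => (f 0 1 - f 1 0) + (f 6 3 - f 3 6) + (f 5 4 - f 4 5)
  | 3 => (f 4 0 - f 0 4) + (f 5 1 - f 1 5) + (f 2 6 - f 6 2)
  | 4 => (f 0 3 - f 3 0) + (f 1 6 - f 6 1) + (f 2 5 - f 5 2)
  | 5 => (f 6 0 - f 0 6) + (f 1 3 - f 3 1) + (f 4 2 - f 2 4)
  | 6 => (f 0 5 - f 5 0) + (f 4 1 - f 1 4) + (f 3 2 - f 2 3)

/-- A sum over `Fin 7` written out, which reduces well in the kernel. -/
def sum7 {R : Type*} [Add R] (f : Fin 7 → R) : R := f 0 + f 1 + f 2 + f 3 + f 4 + f 5 + f 6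

/-- The Vandermonde product of seven numbers. On an arrangement `c` of the indices `0, …, 6` it is
`24883200 = 1! 2! 3! 4! 5! 6!` times the sign of `c`, and `0` if an index is repeated. It thus
encodes the Levi-Civita symbol by a polynomial, which makes contractions with this symbol an integer
computation. -/
def vdm7 {R : Type*} [Mul R] [Sub R] (a b c d e f g : R) : R :=
  (b - a) * ((c - a) * ((d - a) * ((e - a) * ((f - a) * (g - a))))) *
    ((c - b) * ((d - b) * ((e - b) * ((f - b) * (g - b)))) *
      ((d - c) * ((e - c) * ((f - c) * (g - c))) *
        ((e - d) * ((f - d) * (g - d)) * ((f - e) * (g - e) * (g - f)))))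

/-- The contraction of the two-forms `eᵢ ⌟ φ₀`, `eⱼ ⌟ φ₀` and of `φ₀` with an array in seven
indices. -/
def bryantSum {R : Type*} [Add R] [Sub R]
    (f : Fin 7 → Fin 7 → Fin 7 → Fin 7 → Fin 7 → Fin 7 → Fin 7 → R) (i j : Fin 7) : R :=
  sum7 fun a => phiCoord a fun b c => phiCoord i fun d e => phiCoord j fun k l => f d e k l a b c

/-- The identity `(eᵢ ⌟ φ₀) ∧ (eⱼ ⌟ φ₀) ∧ φ₀ = 6 δᵢⱼ e¹²³⁴⁵⁶⁷`; as the three forms are contracted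
with the Levi-Civita symbol on all index pairs and triples, the factor is `6 · 2! · 2! · 3! = 144`.
-/
theorem bryantSum_vdm7_int : ∀ i j : Fin 7,
    bryantSum (fun d e k l a b c : Fin 7 =>
      vdm7 (d.1 : ℤ) (e.1 : ℤ) (k.1 : ℤ) (l.1 : ℤ) (a.1 : ℤ) (b.1 : ℤ) (c.1 : ℤ)) i j =
      if i = j then 144 * 24883200 else 0 := by
  decide +kernel

theorem phiCoord_cast (i : Fin 7) (f : Fin 7 → Fin 7 → ℤ) :
    ((phiCoord i f : ℤ) : ℝ) = phiCoord i fun a b => (f a b : ℝ) := by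
  fin_cases i <;> simp [phiCoord]

theorem bryantSum_vdm7 (i j : Fin 7) :
    bryantSum (fun d e k l a b c : Fin 7 =>
      vdm7 (d.1 : ℝ) (e.1 : ℝ) (k.1 : ℝ) (l.1 : ℝ) (a.1 : ℝ) (b.1 : ℝ) (c.1 : ℝ)) i j =
      if i = j then 144 * 24883200 else 0 := by
  have h := congrArg (Int.cast : ℤ → ℝ) (bryantSum_vdm7_int i j)
  rw [show ((if i = j then (144 * 24883200 : ℤ) else 0 : ℤ) : ℝ) =
    if i = j then 144 * 24883200 else 0 by split_ifs <;> norm_num] at h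
  rw [← h]
  simp [bryantSum, sum7, phiCoord_cast, vdm7]

theorem phiCoord_sum {ι : Type*} (s : Finset ι) (r : ι → ℝ) (i : Fin 7)
    (f : ι → Fin 7 → Fin 7 → ℝ) :
    phiCoord i (fun a b => ∑ t ∈ s, r t * f t a b) = ∑ t ∈ s, r t * phiCoord i (f t) := by
  fin_cases i <;>
    simp only [phiCoord, mul_add, mul_sub, Finset.sum_add_distrib, Finset.sum_sub_distrib]

theorem phiCoord_mul (r : ℝ) (i : Fin 7) (f : Fin 7 → Fin 7 → ℝ) :
    phiCoord i (fun a b => r * f a b) = r * phiCoord i f := by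
  fin_cases i <;> simp only [phiCoord, mul_add, mul_sub]

theorem bryantSum_sum {ι : Type*} (s : Finset ι) (r : ι → ℝ) (i j : Fin 7)
    (f : ι → Fin 7 → Fin 7 → Fin 7 → Fin 7 → Fin 7 → Fin 7 → Fin 7 → ℝ) :
    bryantSum (fun d e k l a b c => ∑ t ∈ s, r t * f t d e k l a b c) i j =
      ∑ t ∈ s, r t * bryantSum (f t) i j := by
  simp only [bryantSum, phiCoord_sum, sum7, mul_add, Finset.sum_add_distrib]

theorem bryantSum_mul (r : ℝ) (i j : Fin 7)
    (f : Fin 7 → Fin 7 → Fin 7 → Fin 7 → Fin 7 → Fin 7 → Fin 7 → ℝ) :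
    bryantSum (fun d e k l a b c => r * f d e k l a b c) i j = r * bryantSum f i j := by
  simp only [bryantSum, phiCoord_mul, sum7, mul_add]

theorem phi0_eq_sum (u v w : V7) :
    phi0 u v w = ∑ i, u i * phiCoord i fun a b => v a * w b := by
  simp only [phi0, mono3, Matrix.det_fin_three, Fin.sum_univ_seven, phiCoord, Matrix.of_apply,
    Matrix.cons_val]
  ring

theorem phi0_eq_sum7 (u v w : V7) :
    phi0 u v w = sum7 fun i => phiCoord i fun a b => u i * v a * w b := by
  simp only [phi0, mono3, Matrix.det_fin_three, sum7, phiCoord, Matrix.of_apply,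
    Matrix.cons_val]
  ring

/-- Picking the rows `c 0, …, c 6` of a matrix multiplies its determinant by the Levi-Civita symbol
of `c`. Both sides are scaled by the Vandermonde determinant of `0, …, 6`. -/
theorem det_submatrix_eq (M : Matrix (Fin 7) (Fin 7) ℝ) (c : Fin 7 → Fin 7) :
    24883200 * (M.submatrix c id).det =
      M.det * vdm7 ((c 0).1 : ℝ) ((c 1).1 : ℝ) ((c 2).1 : ℝ) ((c 3).1 : ℝ) ((c 4).1 : ℝ)
        ((c 5).1 : ℝ) ((c 6).1 : ℝ) := by
  have h1 : M.submatrix c id = (1 : Matrix (Fin 7) (Fin 7) ℝ).submatrix c id * M := by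
    ext i j
    simp [Matrix.mul_apply, Matrix.one_apply]
  have key : ∀ c : Fin 7 → Fin 7, (Matrix.vandermonde fun i => ((c i).1 : ℝ)).det =
      vdm7 ((c 0).1 : ℝ) ((c 1).1 : ℝ) ((c 2).1 : ℝ) ((c 3).1 : ℝ) ((c 4).1 : ℝ)
        ((c 5).1 : ℝ) ((c 6).1 : ℝ) := by
    intro c
    rw [Matrix.det_vandermonde]
    simp only [Fin.prod_univ_succ, vdm7, Fin.prod_Ioi_succ, Fin.prod_Ioi_zero]
    simp
  have h2 : (Matrix.vandermonde fun i => ((c i).1 : ℝ)) =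
      (1 : Matrix (Fin 7) (Fin 7) ℝ).submatrix c id * Matrix.vandermonde fun i : Fin 7 => ((i.1 : ℕ) : ℝ) := by
    ext i j
    simp [Matrix.mul_apply, Matrix.vandermonde, Matrix.one_apply]
  have h3 := congrArg Matrix.det h2
  rw [key c, Matrix.det_mul, key fun i => i] at h3
  have h4 : vdm7 ((0 : Fin 7).1 : ℝ) ((1 : Fin 7).1 : ℝ) ((2 : Fin 7).1 : ℝ)
      ((3 : Fin 7).1 : ℝ) ((4 : Fin 7).1 : ℝ) ((5 : Fin 7).1 : ℝ) ((6 : Fin 7).1 : ℝ) =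
      24883200 := by
    norm_num [vdm7]
  rw [h4] at h3
  rw [h1, Matrix.det_mul, h3]
  ring

theorem contract_apply (φ : V7 [⋀^Fin 3]→L[ℝ] ℝ) (a b w : V7) :
    contract φ a b w = φ ![w, a, b] := by
  simp only [contract, ContinuousMultilinearMap.toContinuousLinearMap_apply]
  exact congrArg φ (by ext i; fin_cases i <;> rfl)

theorem sum_smulRight_apply {ι : Type*} (s : Finset ι) (c : ι → ℝ) (f g : ι → V7 →L[ℝ] ℝ)
    (u v : V7) :
    (∑ σ ∈ s, c σ • (f σ).smulRight (g σ)) u v = ∑ σ ∈ s, c σ * (f σ u * g σ v) := by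
  simp [sum_apply]

/-- The sum defining `bryantForm`, over an arbitrary set of permutations. With the set a variable,
definitional unfolding cannot expand the `5040` terms of the full sum. -/
def bryantPartial (s : Finset (Equiv.Perm (Fin 7))) (φ : V7 [⋀^Fin 3]→L[ℝ] ℝ) : V7 →L[ℝ] V7 →L[ℝ] ℝ :=
  ∑ σ ∈ s,
    ((1 / 6 : ℝ) * (1 / 24) * ((Equiv.Perm.sign σ : ℤ) : ℝ) *
        φ ![bas (σ 4), bas (σ 5), bas (σ 6)]) •
      (contract φ (bas (σ 0)) (bas (σ 1))).smulRight (contract φ (bas (σ 2)) (bas (σ 3)))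

theorem bryantPartial_apply (s : Finset (Equiv.Perm (Fin 7))) (φ : V7 [⋀^Fin 3]→L[ℝ] ℝ) (u v : V7) :
    bryantPartial s φ u v = ∑ σ ∈ s, ((1 / 144 : ℝ) * ((Equiv.Perm.sign σ : ℤ) : ℝ)) *
      (φ ![bas (σ 4), bas (σ 5), bas (σ 6)] *
        (φ ![u, bas (σ 0), bas (σ 1)] * φ ![v, bas (σ 2), bas (σ 3)])) := by
  rw [bryantPartial, sum_smulRight_apply]
  refine Finset.sum_congr rfl fun σ _ => ?_
  rw [contract_apply, contract_apply]
  ring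

theorem bryantForm_eq (φ : V7 [⋀^Fin 3]→L[ℝ] ℝ) : bryantForm φ = bryantPartial Finset.univ φ := by
  unfold bryantForm bryantPartial
  with_reducible rfl

theorem bryantForm_apply (φ : V7 [⋀^Fin 3]→L[ℝ] ℝ) (u v : V7) :
    bryantForm φ u v = ∑ σ : Equiv.Perm (Fin 7), ((1 / 144 : ℝ) * ((Equiv.Perm.sign σ : ℤ) : ℝ)) *
      (φ ![bas (σ 4), bas (σ 5), bas (σ 6)] *
        (φ ![u, bas (σ 0), bas (σ 1)] * φ ![v, bas (σ 2), bas (σ 3)])) := by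
  rw [bryantForm_eq, bryantPartial_apply]

/-! ### The metric of a `G₂`-structure in an adapted coframe -/

/-- The matrix of a linear map `e` in the standard basis. -/
def frameMat (e : V7 →L[ℝ] V7) : Matrix (Fin 7) (Fin 7) ℝ := Matrix.of fun i s => e (bas s) i

theorem sum_smul_bas (u : V7) : ∑ s, u s • bas s = u := by
  ext i
  simp [Finset.sum_apply, Pi.single_apply]

theorem frameMat_mulVec (e : V7 →L[ℝ] V7) (u : V7) (i : Fin 7) :
    e u i = ∑ s, frameMat e i s * u s := by
  conv_lhs => rw [← sum_smul_bas u]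
  simp [frameMat, mul_comm]

theorem frameMat_det_ne_zero {e : V7 →L[ℝ] V7} (he : Function.Bijective e) :
    (frameMat e).det ≠ 0 := by
  intro h
  obtain ⟨v, hv, h0⟩ := Matrix.exists_mulVec_eq_zero_iff.mpr h
  apply hv
  have h1 : e (WithLp.toLp 2 v) = 0 := by
    ext i
    rw [frameMat_mulVec]
    simpa [Matrix.mulVec, dotProduct] using congrFun h0 i
  have h2 : (WithLp.toLp 2 v : V7) = 0 := he.1 (by rw [h1, map_zero])
  ext i
  simpa using congrArg (fun w : V7 => w i) h2

theorem bryant_product (x y z : Fin 7 → ℝ) (g h : Fin 7 → Fin 7 → ℝ) (i j : Fin 7) :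
    (sum7 fun a => phiCoord a fun b c => x a * y b * z c) * (phiCoord i g * phiCoord j h) =
      bryantSum (fun d e k l a b c => x a * y b * z c * (g d e * h k l)) i j := by
  have h1 : ∀ a, phiCoord a (fun b c => x a * y b * z c) * (phiCoord i g * phiCoord j h) =
      phiCoord a fun b c => phiCoord i fun d e => phiCoord j fun k l =>
        x a * y b * z c * (g d e * h k l) := by
    intro a
    rw [mul_comm, ← phiCoord_mul]
    congr 1
    funext b c
    rw [mul_comm, ← mul_assoc, mul_comm _ (phiCoord j h), ← phiCoord_mul]
    simp only [mul_assoc, phiCoord_mul]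
    have : ∀ (r : ℝ), (phiCoord i fun d e => g d e * r) = r * phiCoord i g := by
      intro r
      rw [← phiCoord_mul]
      simp only [mul_comm]
    rw [this]
    ring
  simp only [bryantSum, ← h1, sum7]
  ring

theorem sum_sign_prod (M : Matrix (Fin 7) (Fin 7) ℝ) (c : Fin 7 → Fin 7) :
    ∑ σ : Equiv.Perm (Fin 7), ((Equiv.Perm.sign σ : ℤ) : ℝ) *
      (M (c 4) (σ 4) * M (c 5) (σ 5) * M (c 6) (σ 6) *
        (M (c 0) (σ 0) * M (c 1) (σ 1) * (M (c 2) (σ 2) * M (c 3) (σ 3)))) =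
      (M.submatrix c id).det := by
  rw [← Matrix.det_transpose, Matrix.det_apply']
  refine Finset.sum_congr rfl fun σ _ => ?_
  simp [Fin.prod_univ_seven]
  ring

/-- The form `b` of `e^* φ₀` is `det e` times the pullback of the Euclidean inner product: expanding
the three factors `φ₀` in coordinates, the signed sum over permutations becomes `det e` times a
Levi-Civita symbol. -/
theorem bryantForm_pullback {φ : V7 [⋀^Fin 3]→L[ℝ] ℝ} {e : V7 →L[ℝ] V7}
    (h : ∀ u v w : V7, φ ![u, v, w] = phi0 (e u) (e v) (e w)) (u v : V7) :
    bryantForm φ u v = (frameMat e).det * ∑ i, e u i * e v i := by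
  -- The coefficient of `(e u) i * (e v) j` in the signed sum.
  have hterm : ∀ i j : Fin 7, ∑ σ : Equiv.Perm (Fin 7), ((Equiv.Perm.sign σ : ℤ) : ℝ) *
      ((sum7 fun a => phiCoord a fun b c => e (bas (σ 4)) a * e (bas (σ 5)) b * e (bas (σ 6)) c) *
        (phiCoord i (fun a b => e (bas (σ 0)) a * e (bas (σ 1)) b) *
          phiCoord j (fun a b => e (bas (σ 2)) a * e (bas (σ 3)) b))) =
      if i = j then 144 * (frameMat e).det else 0 := by
    intro i j
    simp only [bryant_product]
    rw [← bryantSum_sum]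
    have h1 : ∀ d f k l a b c : Fin 7, ∑ σ : Equiv.Perm (Fin 7), ((Equiv.Perm.sign σ : ℤ) : ℝ) *
      (e (bas (σ 4)) a * e (bas (σ 5)) b * e (bas (σ 6)) c *
        (e (bas (σ 0)) d * e (bas (σ 1)) f * (e (bas (σ 2)) k * e (bas (σ 3)) l))) =
        (frameMat e).det / 24883200 * vdm7 (d.1 : ℝ) (f.1 : ℝ) (k.1 : ℝ) (l.1 : ℝ) (a.1 : ℝ)
          (b.1 : ℝ) (c.1 : ℝ) := by
      intro d f k l a b c
      have h2 := sum_sign_prod (frameMat e) ![d, f, k, l, a, b, c]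
      have h3 := det_submatrix_eq (frameMat e) ![d, f, k, l, a, b, c]
      refine Eq.trans h2 ?_
      simp only [Matrix.cons_val] at h3
      linear_combination h3 / 24883200
    simp only [h1]
    rw [bryantSum_mul, bryantSum_vdm7]
    split_ifs
    · ring
    · ring
  rw [bryantForm_apply]
  have h1 : ∀ σ : Equiv.Perm (Fin 7), ((1 / 144 : ℝ) * ((Equiv.Perm.sign σ : ℤ) : ℝ)) *
      (φ ![bas (σ 4), bas (σ 5), bas (σ 6)] *
        (φ ![u, bas (σ 0), bas (σ 1)] * φ ![v, bas (σ 2), bas (σ 3)])) =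
      ∑ i, ∑ j, (1 / 144 * e u i * e v j) * (((Equiv.Perm.sign σ : ℤ) : ℝ) *
      ((sum7 fun a => phiCoord a fun b c => e (bas (σ 4)) a * e (bas (σ 5)) b * e (bas (σ 6)) c) *
        (phiCoord i (fun a b => e (bas (σ 0)) a * e (bas (σ 1)) b) *
          phiCoord j (fun a b => e (bas (σ 2)) a * e (bas (σ 3)) b)))) := by
    intro σ
    rw [h, h, h, phi0_eq_sum7, phi0_eq_sum (e u), phi0_eq_sum (e v), Finset.sum_mul_sum,
      Finset.mul_sum, Finset.mul_sum]
    refine Finset.sum_congr rfl fun i _ => ?_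
    rw [Finset.mul_sum, Finset.mul_sum]
    refine Finset.sum_congr rfl fun j _ => ?_
    ring
  rw [Finset.sum_congr rfl fun σ _ => h1 σ, Finset.sum_comm, Finset.mul_sum]
  refine Finset.sum_congr rfl fun i _ => ?_
  rw [Finset.sum_comm]
  have h2 : ∀ j : Fin 7, ∑ σ : Equiv.Perm (Fin 7), (1 / 144 * e u i * e v j) *
      (((Equiv.Perm.sign σ : ℤ) : ℝ) *
      ((sum7 fun a => phiCoord a fun b c => e (bas (σ 4)) a * e (bas (σ 5)) b * e (bas (σ 6)) c) *
        (phiCoord i (fun a b => e (bas (σ 0)) a * e (bas (σ 1)) b) *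
          phiCoord j (fun a b => e (bas (σ 2)) a * e (bas (σ 3)) b)))) =
      (1 / 144 * e u i * e v j) * if i = j then 144 * (frameMat e).det else 0 := by
    intro j
    rw [← hterm i j, Finset.mul_sum]
  simp only [h2]
  simp
  ring

/-- The real ninth root, in the form used in `volDensity`, inverts the ninth power. -/
theorem sign_mul_rpow (t : ℝ) (ht : t ≠ 0) :
    Real.sign (t ^ 9) * |t ^ 9| ^ ((1 : ℝ) / 9) = t := by
  have h1 : |t ^ 9| ^ ((1 : ℝ) / 9) = |t| := by
    rw [abs_pow, ← Real.rpow_natCast, ← Real.rpow_mul (abs_nonneg _)]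
    norm_num
  rw [h1]
  rcases lt_or_gt_of_ne ht with h | h
  · rw [Real.sign_of_neg (Odd.pow_neg (by decide) h), abs_of_neg h]
    ring
  · rw [Real.sign_of_pos (by positivity), abs_of_pos h]
    ring

theorem bryantForm_det {φ : V7 [⋀^Fin 3]→L[ℝ] ℝ} {e : V7 →L[ℝ] V7}
    (h : ∀ u v w : V7, φ ![u, v, w] = phi0 (e u) (e v) (e w)) :
    Matrix.det (Matrix.of fun i j : Fin 7 => bryantForm φ (bas i) (bas j)) =
      (frameMat e).det ^ 9 := by
  have : (Matrix.of fun i j : Fin 7 => bryantForm φ (bas i) (bas j)) =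
      (frameMat e).det • ((frameMat e).transpose * frameMat e) := by
    ext i j
    rw [Matrix.of_apply, bryantForm_pullback h]
    simp [Matrix.mul_apply, frameMat]
  rw [this, Matrix.det_smul, Matrix.det_mul, Matrix.det_transpose, Fintype.card_fin]
  ring

theorem volDensity_pullback {φ : V7 [⋀^Fin 3]→L[ℝ] ℝ} {e : V7 →L[ℝ] V7}
    (h : ∀ u v w : V7, φ ![u, v, w] = phi0 (e u) (e v) (e w)) (he : Function.Bijective e) :
    volDensity φ = (frameMat e).det := by
  rw [volDensity, bryantForm_det h]
  exact sign_mul_rpow _ (frameMat_det_ne_zero he)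

theorem metricOf_pullback {φ : V7 [⋀^Fin 3]→L[ℝ] ℝ} {e : V7 →L[ℝ] V7}
    (h : ∀ u v w : V7, φ ![u, v, w] = phi0 (e u) (e v) (e w)) (he : Function.Bijective e)
    (u v : V7) : metricOf φ u v = ∑ i, e u i * e v i := by
  have h0 := frameMat_det_ne_zero he
  simp only [metricOf, smul_apply, smul_eq_mul]
  rw [bryantForm_pullback h, volDensity_pullback h he]
  field_simp

/-! ### The form `4 vol_A - φ` and its Hodge dual in an adapted coframe -/

/-- Projection of `ℝ⁷` onto `span(∂₀, ∂₁, ∂₂)`. -/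
def projA : V7 →L[ℝ] V7 :=
  LinearMap.toContinuousLinearMap
    { toFun := fun u => !₂[u 0, u 1, u 2, 0, 0, 0, 0]
      map_add' := fun u v => by ext i; fin_cases i <;> simp
      map_smul' := fun c u => by ext i; fin_cases i <;> simp }

theorem projA_apply (u : V7) : projA u = !₂[u 0, u 1, u 2, 0, 0, 0, 0] := rfl

/-- In a coframe for which `g` is Euclidean and `A = span(e₀, e₁, e₂)`, the orthogonal projection
onto `A` is the coordinate projection. In particular the choice in `orthProj` is between equal maps.
-/
theorem orthProj_pullback {g : V7 →L[ℝ] V7 →L[ℝ] ℝ} {e : V7 →L[ℝ] V7} {A : Submodule ℝ V7}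
    (he : Function.Bijective e) (hg : ∀ u v, g u v = ∑ i, e u i * e v i)
    (hA : ∀ u : V7, u ∈ A ↔ ∀ i : Fin 4, e u (Fin.natAdd 3 i) = 0) (u : V7) :
    e (orthProj g A u) = projA (e u) := by
  obtain ⟨E, hE⟩ : ∃ E : V7 ≃L[ℝ] V7, ∀ u, E u = e u :=
    ⟨ContinuousLinearEquiv.ofBijective e (LinearMap.ker_eq_bot.mpr he.1)
      (LinearMap.range_eq_top.mpr he.2), fun u => rfl⟩
  have hex : ∃ P : V7 →L[ℝ] V7, ∀ u, P u ∈ A ∧ ∀ a ∈ A, g (u - P u) a = 0 := by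
    refine ⟨(E.symm : V7 →L[ℝ] V7).comp (projA.comp e), fun u => ?_⟩
    have h1 : e (((E.symm : V7 →L[ℝ] V7).comp (projA.comp e)) u) = projA (e u) := by
      rw [← hE]
      simp
    refine ⟨(hA _).mpr fun i => ?_, fun a ha => ?_⟩
    · rw [h1, projA_apply]
      fin_cases i <;> rfl
    · have h2 := (hA a).mp ha
      have h3 := h2 0
      have h4 := h2 1
      have h5 := h2 2
      have h6 := h2 3
      rw [hg, map_sub, h1]
      simp only [Fin.sum_univ_seven, projA_apply]
      simp at h3 h4 h5 h6 ⊢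
      simp [h3, h4, h5, h6]
  have hspec := Classical.epsilon_spec hex
  change ∀ u, orthProj g A u ∈ A ∧ ∀ a ∈ A, g (u - orthProj g A u) a = 0 at hspec
  obtain ⟨h1, h2⟩ := hspec u
  have h3 := (hA _).mp h1
  have key : ∀ j : Fin 3, e (orthProj g A u) (Fin.castAdd 4 j) = e u (Fin.castAdd 4 j) := by
    intro j
    obtain ⟨a, ha⟩ := he.2 (bas (Fin.castAdd 4 j))
    have haA : a ∈ A := by
      rw [hA]
      intro i
      rw [ha]
      simp [Fin.ext_iff]
      omega
    have h4 := h2 a haA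
    rw [hg, ha, map_sub] at h4
    simp at h4
    linarith
  rw [projA_apply]
  ext i
  refine Fin.addCases (m := 3) (n := 4) (fun j => ?_) (fun j => ?_) i
  · rw [key j]
    fin_cases j <;> rfl
  · rw [h3 j]
    fin_cases j <;> rfl

/-- The model three-form `4 e¹²³ - φ₀` on `ℝ⁷`. -/
def eta0 (u v w : V7) : ℝ := 4 * mono3 0 1 2 u v w - phi0 u v w

theorem phi0_projA (u v w : V7) : phi0 (projA u) (projA v) (projA w) = mono3 0 1 2 u v w := by
  simp [phi0, mono3, Matrix.det_fin_three, projA_apply]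

theorem eta_pullback {φ : V7 [⋀^Fin 3]→L[ℝ] ℝ} {e : V7 →L[ℝ] V7} {A : Submodule ℝ V7}
    (h : ∀ u v w : V7, φ ![u, v, w] = phi0 (e u) (e v) (e w)) (he : Function.Bijective e)
    (hA : ∀ u : V7, u ∈ A ↔ ∀ i : Fin 4, e u (Fin.natAdd 3 i) = 0) (u v w : V7) :
    ((4 : ℝ) • volA φ A - φ) ![u, v, w] = eta0 (e u) (e v) (e w) := by
  have h1 : volA φ A ![u, v, w] = mono3 0 1 2 (e u) (e v) (e w) := by
    have h2 : volA φ A ![u, v, w] = φ ![orthProj (metricOf φ) A u, orthProj (metricOf φ) A v,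
        orthProj (metricOf φ) A w] := by
      rw [volA, ContinuousAlternatingMap.compContinuousLinearMap_apply]
      congr 1
      ext i
      fin_cases i <;> rfl
    have h3 := fun x => orthProj_pullback he (metricOf_pullback h he) hA x
    rw [h2, h, h3, h3, h3, phi0_projA]
  have h4 : ((4 : ℝ) • volA φ A - φ) ![u, v, w] =
    4 * volA φ A ![u, v, w] - φ ![u, v, w] := rfl
  rw [h4, h1, h, eta0]

/-- Concatenation of three and four vectors. -/
def appendVec (a : Fin 3 → V7) (w : Fin 4 → V7) : Fin 7 → V7 := (Fin.append a w : Fin (3 + 4) → V7)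

/-- The splitting of seven indices into three and four. -/
def splitEquiv : Fin 3 ⊕ Fin 4 ≃ Fin 7 := finSumFinEquiv (m := 3) (n := 4)

theorem elim_splitEquiv_symm (a : Fin 3 → V7) (w : Fin 4 → V7) (i : Fin 7) :
    Sum.elim a w (splitEquiv.symm i) = appendVec a w i := by
  have : ∀ s : Fin 3 ⊕ Fin 4, Sum.elim a w s = appendVec a w (splitEquiv s) := by
    rintro (s | s)
    · exact (Fin.append_left a w s).symm
    · exact (Fin.append_right a w s).symm
  rw [this, Equiv.apply_symm_apply]

theorem map_appendVec (e : V7 →L[ℝ] V7) (a : Fin 3 → V7) (w : Fin 4 → V7) (i : Fin 7) :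
    appendVec (fun s => e (a s)) (fun s => e (w s)) i = e (appendVec a w i) := by
  rw [← elim_splitEquiv_symm, ← elim_splitEquiv_symm]
  rcases splitEquiv.symm i with s | s <;> rfl

/-- The determinant of `n` vectors of `ℝⁿ`, as a multilinear map. -/
def detVec (n : Type*) [Fintype n] [DecidableEq n] :
    MultilinearMap ℝ (fun _ : n => EuclideanSpace ℝ n) ℝ :=
  (Matrix.detRowAlternating (R := ℝ) (n := n)).toMultilinearMap.compLinearMap
    fun _ => (WithLp.linearEquiv 2 ℝ (n → ℝ)).toLinearMap

theorem detVec_apply {n : Type*} [Fintype n] [DecidableEq n] (v : n → EuclideanSpace ℝ n) :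
    detVec n v = Matrix.det (Matrix.of fun i j : n => v i j) := rfl

/-- A multilinear map evaluated on the vectors `c k = ∑ₚ N p k • b p`, expanded in the vectors `b`.
-/
theorem sum_prod_mul_map {n κ V : Type*} [Fintype n] [Fintype κ] [DecidableEq n]
    [AddCommGroup V] [Module ℝ V]
    (F : (n → V) → ℝ) (f : MultilinearMap ℝ (fun _ : n => V) ℝ) (hF : ∀ v, F v = f v)
    (N : κ → κ → ℝ) (b c : κ → V)
    (hc : ∀ k, c k = ∑ p, N p k • b p) (k : n → κ) :
    ∑ p : n → κ, (∏ s, N (p s) (k s)) * F (fun s => b (p s)) = F fun s => c (k s) := by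
  simp only [hc, hF]
  rw [f.map_sum]
  exact Finset.sum_congr rfl fun p _ => (f.map_smul_univ _ _).symm

theorem prod_sum_mul {n κ : Type*} [Fintype n] [Fintype κ] [DecidableEq n]
    (N : κ → κ → ℝ) (p q : n → κ) : ∏ s, ∑ k, N (p s) k * N (q s) k =
      ∑ k : n → κ, (∏ s, N (p s) (k s)) * ∏ s, N (q s) (k s) := by
  rw [Finset.prod_univ_sum, Fintype.piFinset_univ]
  simp only [Finset.prod_mul_distrib]

/-- The determinant of seven vectors of `ℝ⁷`, the last four of which form a second group. -/
def detSplit : MultilinearMap ℝ (fun _ : Fin 3 => V7) (MultilinearMap ℝ (fun _ : Fin 4 => V7) ℝ) :=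
  ((detVec (Fin 7)).domDomCongr splitEquiv.symm).currySum

/-- The determinant of seven vectors of `ℝ⁷`, given in groups of three and four. -/
def det34 (a : Fin 3 → V7) (w : Fin 4 → V7) : ℝ :=
  Matrix.det (Matrix.of fun i j : Fin 7 => appendVec a w i j)

theorem detSplit_apply (a : Fin 3 → V7) (w : Fin 4 → V7) : detSplit a w = det34 a w := by
  unfold det34
  rw [detSplit, MultilinearMap.currySum_apply', MultilinearMap.domDomCongr_apply, ← detVec_apply]
  exact congrArg (detVec (Fin 7)) (funext fun i => elim_splitEquiv_symm a w i)

/-- `detSplit` with the second group of vectors fixed. -/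
def detFirst (w : Fin 4 → V7) : MultilinearMap ℝ (fun _ : Fin 3 => V7) ℝ :=
  (LinearMap.mk ⟨fun m => m w, fun _ _ => rfl⟩ fun _ _ => rfl :
    MultilinearMap ℝ (fun _ : Fin 4 => V7) ℝ →ₗ[ℝ] ℝ).compMultilinearMap detSplit

theorem detFirst_apply (w : Fin 4 → V7) (a : Fin 3 → V7) : det34 a w = detFirst w a := by
  rw [← detSplit_apply, detFirst, LinearMap.compMultilinearMap_apply, LinearMap.coe_mk, AddHom.coe_mk]

theorem volOf_append (φ : V7 [⋀^Fin 3]→L[ℝ] ℝ) (a : Fin 3 → V7) (w : Fin 4 → V7) :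
    volOf φ (Fin.append a w : Fin (3 + 4) → V7) = volDensity φ * det34 a w := by
  have h : (Fin.append a w : Fin (3 + 4) → V7) = appendVec a w := rfl
  rw [det34, ← volOf, ← h]

/-- The expression defining `hodge3`, with sums over arbitrary finite sets of indices. -/
def hodgePartial (a b : Finset (Fin 3 → Fin 7)) (φ η : V7 [⋀^Fin 3]→L[ℝ] ℝ) (w : Fin 4 → V7) : ℝ :=
  let G : Matrix (Fin 7) (Fin 7) ℝ := Matrix.of fun i j => metricOf φ (bas i) (bas j)
  (1 / 6 : ℝ) * ∑ p ∈ a, ∑ q ∈ b,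
    (∏ s, G⁻¹ (p s) (q s)) * η (fun s => bas (q s)) *
      volOf φ (Fin.append (fun s => bas (p s)) w : Fin (3 + 4) → V7)

theorem hodge3_eq_partial (φ η : V7 [⋀^Fin 3]→L[ℝ] ℝ) (w : Fin 4 → V7) :
    hodge3 φ η w = hodgePartial Finset.univ Finset.univ φ η w := by
  unfold hodge3 hodgePartial
  with_reducible rfl

/-- The components `g^{ij}` of the inverse of the metric of `φ`. -/
def invMetric (φ : V7 [⋀^Fin 3]→L[ℝ] ℝ) (i j : Fin 7) : ℝ :=
  (Matrix.of fun i j : Fin 7 => metricOf φ (bas i) (bas j))⁻¹ i j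

theorem hodgePartial_apply (a b : Finset (Fin 3 → Fin 7)) (φ η : V7 [⋀^Fin 3]→L[ℝ] ℝ)
    (w : Fin 4 → V7) :
    hodgePartial a b φ η w = (1 / 6 : ℝ) * ∑ p ∈ a, ∑ q ∈ b,
      (∏ s, invMetric φ (p s) (q s)) * η (fun s => bas (q s)) *
        (volDensity φ * det34 (fun s => bas (p s)) w) := by
  unfold hodgePartial
  refine congrArg (fun t : ℝ => 1 / 6 * t) ?_
  refine Finset.sum_congr rfl fun p _ => Finset.sum_congr rfl fun q _ => ?_
  rw [volOf_append]
  rfl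

theorem hodge3_eq (φ η : V7 [⋀^Fin 3]→L[ℝ] ℝ) (w : Fin 4 → V7) :
    hodge3 φ η w = (1 / 6 : ℝ) * ∑ p : Fin 3 → Fin 7, ∑ q : Fin 3 → Fin 7,
      (∏ s, invMetric φ (p s) (q s)) * η (fun s => bas (q s)) *
        (volDensity φ * det34 (fun s => bas (p s)) w) := by
  rw [hodge3_eq_partial, hodgePartial_apply]

/-- `hodge3 φ η` as a multilinear map. -/
def hodgeMulti (φ η : V7 [⋀^Fin 3]→L[ℝ] ℝ) : MultilinearMap ℝ (fun _ : Fin 4 => V7) ℝ :=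
  ∑ p : Fin 3 → Fin 7, ∑ q : Fin 3 → Fin 7,
    ((1 / 6 : ℝ) * (∏ s, invMetric φ (p s) (q s)) * η (fun s => bas (q s)) * volDensity φ) •
      detSplit fun s => bas (p s)

theorem hodgeMulti_apply (φ η : V7 [⋀^Fin 3]→L[ℝ] ℝ) (w : Fin 4 → V7) :
    hodgeMulti φ η w = hodge3 φ η w := by
  simp only [hodgeMulti, hodge3_eq, sum_apply, smul_apply, detSplit_apply,
    smul_eq_mul, Finset.mul_sum]
  refine Finset.sum_congr rfl fun p _ => Finset.sum_congr rfl fun q _ => ?_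
  ring

/-- The Hodge dual of `eta0`. -/
def starEta0 (w : Fin 4 → V7) : ℝ :=
  (1 / 6 : ℝ) * ∑ k : Fin 3 → Fin 7, eta0 (bas (k 0)) (bas (k 1)) (bas (k 2)) *
    det34 (fun s => bas (k s)) w

/-- Index contraction with `G = N Nᵀ` is contraction with `N` in each of the two factors separately.
-/
theorem contraction_sum {n κ : Type*} [Fintype n] [Fintype κ] [DecidableEq n]
    (d : ℝ) (G N : κ → κ → ℝ) (hG : ∀ i j, G i j = ∑ k, N i k * N j k)
    (D H D' H' : (n → κ) → ℝ)
    (hD : ∀ k, ∑ p : n → κ, (∏ s, N (p s) (k s)) * D p = D' k)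
    (hH : ∀ k, ∑ p : n → κ, (∏ s, N (p s) (k s)) * H p = H' k) :
    ∑ p : n → κ, ∑ q : n → κ, (∏ s, G (p s) (q s)) * H q * (d * D p) =
      ∑ k, H' k * (d * D' k) := by
  have h1 : ∀ p q : n → κ, (∏ s, G (p s) (q s)) * H q * (d * D p) =
      ∑ k : n → κ, d * (((∏ s, N (p s) (k s)) * D p) * ((∏ s, N (q s) (k s)) * H q)) := by
    intro p q
    simp only [hG]
    rw [prod_sum_mul, Finset.sum_mul, Finset.sum_mul]
    exact Finset.sum_congr rfl fun k _ => by ring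
  have h2 : ∀ k : n → κ, H' k * (d * D' k) = ∑ p : n → κ, ∑ q : n → κ,
      d * (((∏ s, N (p s) (k s)) * D p) * ((∏ s, N (q s) (k s)) * H q)) := by
    intro k
    rw [← hD, ← hH, mul_left_comm, mul_comm (Finset.sum _ _), Finset.sum_mul_sum, Finset.mul_sum]
    exact Finset.sum_congr rfl fun p _ => Finset.mul_sum _ _ _
  simp only [h1, h2]
  calc _ = ∑ p : n → κ, ∑ k : n → κ, ∑ q : n → κ,
        d * (((∏ s, N (p s) (k s)) * D p) * ((∏ s, N (q s) (k s)) * H q)) :=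
        Finset.sum_congr rfl fun p _ => Finset.sum_comm
    _ = _ := Finset.sum_comm

theorem det_of_mulVec {n : Type*} [Fintype n] [DecidableEq n] (M : Matrix n n ℝ)
    (v : n → n → ℝ) :
    Matrix.det (Matrix.of fun i j => ∑ s, M j s * v i s) = M.det * Matrix.det (Matrix.of v) := by
  rw [mul_comm, ← Matrix.det_transpose M, ← Matrix.det_mul]
  congr 1
  ext i j
  simp [Matrix.mul_apply, mul_comm]

theorem detSplit_pullback (e : V7 →L[ℝ] V7) (a : Fin 3 → V7) (w : Fin 4 → V7) :
    (frameMat e).det * det34 a w = det34 (fun s => e (a s)) fun i => e (w i) := by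
  unfold det34
  simp only [map_appendVec, frameMat_mulVec e]
  exact (det_of_mulVec _ _).symm

/-- `G = eᵀ e` for the matrix `G` of `e^*` of the Euclidean metric, so `G⁻¹ = e⁻¹ (e⁻¹)ᵀ`. -/
theorem metricOf_inv {φ : V7 [⋀^Fin 3]→L[ℝ] ℝ} {e : V7 →L[ℝ] V7}
    (h : ∀ u v w : V7, φ ![u, v, w] = phi0 (e u) (e v) (e w)) (he : Function.Bijective e)
    (i j : Fin 7) :
    invMetric φ i j =
      ∑ k, (frameMat e)⁻¹ i k * (frameMat e)⁻¹ j k := by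
  have : (Matrix.of fun i j : Fin 7 => metricOf φ (bas i) (bas j)) =
      (frameMat e).transpose * frameMat e := by
    ext i j
    rw [Matrix.of_apply, metricOf_pullback h he]
    simp [Matrix.mul_apply, frameMat]
  rw [invMetric, this, Matrix.mul_inv_rev, ← Matrix.transpose_nonsing_inv, Matrix.mul_apply]
  rfl

theorem exists_dual_frame {e : V7 →L[ℝ] V7} (he : Function.Bijective e) :
    ∃ f : Fin 7 → V7, (∀ k, f k = ∑ p, (frameMat e)⁻¹ p k • bas p) ∧ ∀ k, e (f k) = bas k := by
  have hdet : IsUnit (frameMat e).det := (frameMat_det_ne_zero he).isUnit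
  have hMN : frameMat e * (frameMat e)⁻¹ = 1 := Matrix.mul_nonsing_inv _ hdet
  obtain ⟨f, hf⟩ : ∃ f : Fin 7 → V7, ∀ k, f k = ∑ p, (frameMat e)⁻¹ p k • bas p :=
    ⟨_, fun _ => rfl⟩
  refine ⟨f, hf, fun k => ?_⟩
  ext i
  have h1 := congrFun (congrFun hMN i) k
  rw [Matrix.mul_apply] at h1
  have hfs : ∀ s, f k s = (frameMat e)⁻¹ s k := by
    intro s
    simp [hf, Pi.single_apply]
  rw [frameMat_mulVec]
  simp only [hfs]
  rw [h1, Matrix.one_apply]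
  simp

/-- The Hodge star is natural: `⋆ e^* η₀ = e^* ⋆ η₀` when `φ = e^* φ₀`. -/
theorem hodge3_pullback {φ η : V7 [⋀^Fin 3]→L[ℝ] ℝ} {e : V7 →L[ℝ] V7}
    (h : ∀ u v w : V7, φ ![u, v, w] = phi0 (e u) (e v) (e w)) (he : Function.Bijective e)
    (hη : ∀ u v w : V7, η ![u, v, w] = eta0 (e u) (e v) (e w)) (w : Fin 4 → V7) :
    hodge3 φ η w = starEta0 fun i => e (w i) := by
  obtain ⟨f, hf, hef⟩ := exists_dual_frame he
  have hη' : ∀ k : Fin 3 → Fin 7, η (fun s => f (k s)) =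
      eta0 (bas (k 0)) (bas (k 1)) (bas (k 2)) := by
    intro k
    rw [← hef, ← hef, ← hef, ← hη]
    exact congrArg η (by ext i; fin_cases i <;> rfl)
  have hD : ∀ k : Fin 3 → Fin 7, (frameMat e).det * det34 (fun s => f (k s)) w =
      det34 (fun s => bas (k s)) fun i => e (w i) := by
    intro k
    rw [detSplit_pullback]
    simp only [hef]
  have hsum := contraction_sum (frameMat e).det (invMetric φ) _
    (metricOf_inv h he) (fun p => det34 (fun s => bas (p s)) w)
    (fun q => η fun s => bas (q s)) (fun k => det34 (fun s => f (k s)) w)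
    (fun k => η fun s => f (k s))
    (sum_prod_mul_map (fun a => det34 a w) (detFirst w) (detFirst_apply w)
      _ bas f hf)
    (sum_prod_mul_map (fun a => η a) η.toMultilinearMap (fun v => rfl) _ bas f hf)
  simp only [hη', hD] at hsum
  rw [starEta0, hodge3_eq, volDensity_pullback h he, hsum]

/-! ### Coefficients of the Hodge dual of the model form -/

theorem sum_fin_three_fun {κ : Type*} [Fintype κ] (F : (Fin 3 → κ) → ℝ) :
    ∑ k, F k = ∑ a, ∑ b, ∑ c, F ![a, b, c] := by
  have h : ∀ (n : ℕ) (G : (Fin (n + 1) → κ) → ℝ),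
      ∑ k, G k = ∑ a, ∑ k : Fin n → κ, G (Fin.cons a k) := by
    intro n G
    rw [← (Fin.consEquiv fun _ : Fin (n + 1) => κ).sum_comp, Fintype.sum_prod_type]
    rfl
  rw [h 2]
  refine Finset.sum_congr rfl fun a _ => ?_
  rw [h 1]
  refine Finset.sum_congr rfl fun b _ => ?_
  rw [h 0]
  refine Finset.sum_congr rfl fun c _ => ?_
  rw [Fintype.sum_unique]
  refine congrArg F ?_
  ext i
  fin_cases i <;> rfl

theorem sum_phi0_bas (F : Fin 7 → Fin 7 → Fin 7 → ℝ) :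
    ∑ a, ∑ b, ∑ c, phi0 (bas a) (bas b) (bas c) * F a b c =
      sum7 fun i => phiCoord i fun a b => F i a b := by
  have h1 : ∀ a b c : Fin 7, phi0 (bas a) (bas b) (bas c) =
      phiCoord a fun b' c' => (if b' = b then (1 : ℝ) else 0) * if c' = c then 1 else 0 := by
    intro a b c
    rw [phi0_eq_sum, Finset.sum_eq_single a]
    · simp
    · intro i _ hi
      simp [hi]
    · simp
  have h2 : ∀ a : Fin 7, ∑ b, ∑ c, phi0 (bas a) (bas b) (bas c) * F a b c =
      phiCoord a fun b c => F a b c := by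
    intro a
    simp only [h1]
    fin_cases a <;>
      simp [phiCoord, add_mul, sub_mul, Finset.sum_add_distrib, Finset.sum_sub_distrib]
  simp only [h2]
  rw [Fin.sum_univ_seven]
  rfl

theorem sum_mono3_bas (F : Fin 7 → Fin 7 → Fin 7 → ℝ) :
    ∑ a, ∑ b, ∑ c, mono3 0 1 2 (bas a) (bas b) (bas c) * F a b c =
      F 0 1 2 - F 0 2 1 - F 1 0 2 + F 1 2 0 + F 2 0 1 - F 2 1 0 := by
  simp [mono3, Matrix.det_fin_three, add_mul, sub_mul, Finset.sum_add_distrib,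
    Finset.sum_sub_distrib]

theorem bas_eq_one (a j : Fin 7) : (bas a) j = (1 : Matrix (Fin 7) (Fin 7) ℝ) a j := by
  by_cases h : a = j
  · rw [h, Matrix.one_apply_eq]
    simp
  · rw [Matrix.one_apply_ne h]
    simp [Ne.symm h]

theorem map_cons_eq_sum {F : (Fin 4 → V7) → ℝ} (f : MultilinearMap ℝ (fun _ : Fin 4 => V7) ℝ)
    (hf : ∀ w, f w = F w) (v b c d : V7) :
    F ![v, b, c, d] = ∑ m, v m * F ![bas m, b, c, d] := by
  have h3 : ∀ u : V7, F ![u, b, c, d] = f (Function.update ![0, b, c, d] 0 u) := by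
    intro u
    rw [hf]
    refine congrArg F ?_
    funext i
    fin_cases i <;> rfl
  rw [h3 v, Finset.sum_congr rfl fun m _ => by rw [h3 (bas m)]]
  conv_lhs => rw [← sum_smul_bas v]
  rw [MultilinearMap.map_update_sum]
  simp only [MultilinearMap.map_update_smul, smul_eq_mul]

theorem det34_bas_bas (a b c m p q r : Fin 7) :
    det34 ![bas a, bas b, bas c] ![bas m, bas p, bas q, bas r] =
      ((1 : Matrix (Fin 7) (Fin 7) ℝ).submatrix ![a, b, c, m, p, q, r] id).det := by
  rw [det34]
  refine congrArg Matrix.det ?_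
  ext i j
  fin_cases i <;> exact bas_eq_one _ _

/-- The determinant of standard basis vectors is the Levi-Civita symbol of their indices. -/
theorem vdm7_eq_det34 (a b c m p q r : Fin 7) :
    vdm7 (a.1 : ℝ) (b.1 : ℝ) (c.1 : ℝ) (m.1 : ℝ) (p.1 : ℝ) (q.1 : ℝ) (r.1 : ℝ) =
      24883200 * det34 ![bas a, bas b, bas c] ![bas m, bas p, bas q, bas r] := by
  have h := det_submatrix_eq 1 ![a, b, c, m, p, q, r]
  rw [Matrix.det_one, one_mul] at h
  simp only [Matrix.cons_val] at h
  rw [← h, det34_bas_bas]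

theorem det34_bas (a b c p q r : Fin 7) (v : V7) :
    24883200 * det34 ![bas a, bas b, bas c] ![v, bas p, bas q, bas r] =
      ∑ m, v m * vdm7 (a.1 : ℝ) (b.1 : ℝ) (c.1 : ℝ) (m.1 : ℝ) (p.1 : ℝ) (q.1 : ℝ) (r.1 : ℝ) := by
  simp only [vdm7_eq_det34]
  rw [map_cons_eq_sum (detSplit ![bas a, bas b, bas c]) (fun w => detSplit_apply _ w),
    Finset.mul_sum]
  refine Finset.sum_congr rfl fun m _ => ?_
  ring

/-- The contraction of `4 e¹²³ - φ₀` with an array in three indices, over any ring. -/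
def starCoeff {R : Type*} [Add R] [Sub R] (F : Fin 7 → Fin 7 → Fin 7 → R) : R :=
  let E := F 0 1 2 - F 0 2 1 - F 1 0 2 + F 1 2 0 + F 2 0 1 - F 2 1 0
  E + E + E + E - sum7 fun i => phiCoord i fun a b => F i a b

theorem starCoeff_cast (F : Fin 7 → Fin 7 → Fin 7 → ℤ) :
    ((starCoeff F : ℤ) : ℝ) = starCoeff fun a b c => (F a b c : ℝ) := by
  simp [starCoeff, sum7, phiCoord_cast]

theorem vdm7_cast (a b c d e f g : ℕ) :
    ((vdm7 (a : ℤ) b c d e f g : ℤ) : ℝ) = vdm7 (a : ℝ) b c d e f g := by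
  simp [vdm7]

theorem starEta0_bas (p q r : Fin 7) (v : V7) :
    starEta0 ![v, bas p, bas q, bas r] = ∑ m, v m * ((1 / (6 * 24883200) : ℝ) *
      ((starCoeff fun a b c => vdm7 (a.1 : ℤ) (b.1 : ℤ) (c.1 : ℤ) (m.1 : ℤ) (p.1 : ℤ) (q.1 : ℤ)
        (r.1 : ℤ) : ℤ) : ℝ)) := by
  have hcast : ∀ m, ((starCoeff fun a b c => vdm7 (a.1 : ℤ) (b.1 : ℤ) (c.1 : ℤ) (m.1 : ℤ) (p.1 : ℤ)
      (q.1 : ℤ) (r.1 : ℤ) : ℤ) : ℝ) =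
      starCoeff fun a b c : Fin 7 => vdm7 (a.1 : ℝ) (b.1 : ℝ) (c.1 : ℝ) (((m : Fin 7).1 : ℕ) : ℝ) (p.1 : ℝ) (q.1 : ℝ)
        (r.1 : ℝ) := by
    intro m
    rw [starCoeff_cast]
    refine congrArg starCoeff ?_
    funext a b c
    exact vdm7_cast ..
  have hlin : ∀ F : Fin 7 → Fin 7 → Fin 7 → Fin 7 → ℝ,
      (starCoeff fun a b c => ∑ m, v m * F m a b c) = ∑ m, v m * starCoeff (F m) := by
    intro F
    simp only [starCoeff, sum7, phiCoord_sum, mul_add, mul_sub, Finset.sum_add_distrib,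
      Finset.sum_sub_distrib]
  have hmul : ∀ (t : ℝ) (F : Fin 7 → Fin 7 → Fin 7 → ℝ),
      (starCoeff fun a b c => t * F a b c) = t * starCoeff F := by
    intro t F
    simp only [starCoeff, sum7, phiCoord_mul]
    ring
  have hstar : ∀ F : Fin 7 → Fin 7 → Fin 7 → ℝ,
      ∑ a, ∑ b, ∑ c, eta0 (bas a) (bas b) (bas c) * F a b c = starCoeff F := by
    intro F
    simp only [eta0, sub_mul, mul_assoc, Finset.sum_sub_distrib, ← Finset.mul_sum, sum_phi0_bas,
      sum_mono3_bas, starCoeff]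
    ring
  simp only [hcast]
  have h1 : ∀ a b c : Fin 7, det34 ![bas a, bas b, bas c] ![v, bas p, bas q, bas r] =
      (1 / 24883200 : ℝ) * ∑ m, v m * vdm7 (a.1 : ℝ) (b.1 : ℝ) (c.1 : ℝ) (m.1 : ℝ) (p.1 : ℝ) (q.1 : ℝ)
        (r.1 : ℝ) := by
    intro a b c
    rw [← det34_bas]
    ring
  have h2 : ∀ a b c : Fin 7, (fun s => bas ((![a, b, c] : Fin 3 → Fin 7) s)) =
      ![bas a, bas b, bas c] := by
    intro a b c
    funext s
    fin_cases s <;> rfl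
  rw [starEta0, sum_fin_three_fun]
  simp only [h2]
  simp only [Matrix.cons_val, h1]
  rw [hstar, hmul, hlin, Finset.mul_sum, Finset.mul_sum]
  refine Finset.sum_congr rfl fun m _ => ?_
  ring

/-! ### Linear relations on a skew matrix acting on the model form -/

/-- The coefficients `(⋆ η₀)(∂ₘ, ∂ₚ, ∂_q, ∂ᵣ)`, scaled by `6 · 24883200` to be integers with the
Levi-Civita symbol given by `vdm7`. -/
def starTable (p q r m : Fin 7) : ℤ :=
  starCoeff fun a b c : Fin 7 =>
    vdm7 (a.1 : ℤ) (b.1 : ℤ) (c.1 : ℤ) (m.1 : ℤ) (p.1 : ℤ) (q.1 : ℤ) (r.1 : ℤ)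

/-- Here `149299200 = 6 · 24883200` is the scaling factor of `starTable`. -/
theorem starEta0_of_table {p q r k : Fin 7} {c : ℤ}
    (h : ∀ m : Fin 7, starTable p q r m = if m = k then c * 149299200 else 0) (v : V7) :
    starEta0 ![v, bas p, bas q, bas r] = c * v k := by
  have h' : ∀ m : Fin 7, ((starTable p q r m : ℤ) : ℝ) = if m = k then (c : ℝ) * 149299200 else 0 := by
    intro m
    rw [h m]
    split_ifs
    · push_cast; rfl
    · norm_num
  have h2 := starEta0_bas p q r v
  rw [h2, Finset.sum_eq_single k]
  · change v k * (_ * ((starTable p q r k : ℤ) : ℝ)) = _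
    rw [h', if_pos rfl]
    ring
  · intro m _ hm
    change v m * (_ * ((starTable p q r m : ℤ) : ℝ)) = _
    rw [h', if_neg hm]
    ring
  · simp

/-- For these fifteen triples, `⋆ η₀` contracted with `∂ₚ, ∂_q, ∂ᵣ` is plus or minus one coordinate.
They are the triples that determine the fifteen entries in `FrameRelations`. -/
theorem starTable_values :
    (∀ m, starTable 0 1 3 m = if m = 6 then -1 * 149299200 else 0) ∧
    (∀ m, starTable 1 2 5 m = if m = 6 then 1 * 149299200 else 0) ∧
    (∀ m, starTable 0 2 4 m = if m = 6 then 1 * 149299200 else 0) ∧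
    (∀ m, starTable 0 1 4 m = if m = 5 then -1 * 149299200 else 0) ∧
    (∀ m, starTable 0 2 3 m = if m = 5 then -1 * 149299200 else 0) ∧
    (∀ m, starTable 1 2 6 m = if m = 5 then -1 * 149299200 else 0) ∧
    (∀ m, starTable 0 1 5 m = if m = 4 then 1 * 149299200 else 0) ∧
    (∀ m, starTable 0 2 6 m = if m = 4 then -1 * 149299200 else 0) ∧
    (∀ m, starTable 1 2 3 m = if m = 4 then 1 * 149299200 else 0) ∧
    (∀ m, starTable 0 1 6 m = if m = 3 then 1 * 149299200 else 0) ∧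
    (∀ m, starTable 0 2 5 m = if m = 3 then 1 * 149299200 else 0) ∧
    (∀ m, starTable 1 2 4 m = if m = 3 then -1 * 149299200 else 0) ∧
    (∀ m, starTable 0 3 5 m = if m = 2 then -1 * 149299200 else 0) ∧
    (∀ m, starTable 0 3 6 m = if m = 1 then -1 * 149299200 else 0) ∧
    (∀ m, starTable 1 3 6 m = if m = 0 then 1 * 149299200 else 0) := by
  decide +kernel

/-- The `p`-th column of a matrix. -/
def matCol (Ψ : Fin 7 → Fin 7 → ℝ) (p : Fin 7) : V7 := WithLp.toLp 2 fun i => Ψ i p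

/-- The derivation action of the matrix `Ψ` on the model form `η₀`, evaluated on basis vectors: the
sum of `η₀` with each of the three arguments replaced by its image under `Ψ`. -/
def etaVar (Ψ : Fin 7 → Fin 7 → ℝ) (p q r : Fin 7) : ℝ :=
  eta0 (matCol Ψ p) (bas q) (bas r) + eta0 (bas p) (matCol Ψ q) (bas r) +
    eta0 (bas p) (bas q) (matCol Ψ r)

/-- The linear equations that `- Ψ · η₀ = x ⌟ ⋆ η₀` imposes on a skew matrix `Ψ`. For `Ψ` the value
of the connection form on a tangent vector to the bundle of `SO(4)`-coframes and `x` that of the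
tautological form, they express all entries outside the lower right `4 × 4` block. For `x = 0` they
cut out the stabilizer `so(4)` of `η₀` in `so(7)`. -/
structure FrameRelations (Ψ : Fin 7 → Fin 7 → ℝ) (x : V7) : Prop where
  h01 : Ψ 0 1 = x 2 + Ψ 3 6 + Ψ 4 5
  h02 : Ψ 0 2 = Ψ 3 5 - Ψ 4 6 - x 1
  h12 : Ψ 1 2 = x 0 - Ψ 3 4 - Ψ 5 6
  h03 : Ψ 0 3 = -x 4
  h04 : Ψ 0 4 = x 3
  h05 : Ψ 0 5 = -x 6
  h06 : Ψ 0 6 = x 5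
  h13 : Ψ 1 3 = -x 5
  h14 : Ψ 1 4 = x 6
  h15 : Ψ 1 5 = x 3
  h16 : Ψ 1 6 = -x 4
  h23 : Ψ 2 3 = x 6
  h24 : Ψ 2 4 = x 5
  h25 : Ψ 2 5 = -x 4
  h26 : Ψ 2 6 = -x 3

/-- The fifteen equations for the triples in `starTable_values` can be solved for the entries `Ψᵢⱼ`
with `i < 3` and `i < j`. -/
theorem frameRelations_of_etaVar (Ψ : Fin 7 → Fin 7 → ℝ) (hskew : ∀ i j, Ψ i j = -Ψ j i) (x : V7)
    (h : ∀ p q r, -etaVar Ψ p q r = starEta0 ![x, bas p, bas q, bas r]) :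
    FrameRelations Ψ x := by
  obtain ⟨t1, t2, t3, t4, t5, t6, t7, t8, t9, t10, t11, t12, t13, t14, t15⟩ := starTable_values
  -- The left hand sides involve only entries of `Ψ` once `η₀` is expanded; the right hand sides
  -- are single coordinates of `x`.
  have e1 := h 0 1 3
  have e2 := h 1 2 5
  have e3 := h 0 2 4
  have e4 := h 0 1 4
  have e5 := h 0 2 3
  have e6 := h 1 2 6
  have e7 := h 0 1 5
  have e8 := h 0 2 6
  have e9 := h 1 2 3
  have e10 := h 0 1 6
  have e11 := h 0 2 5
  have e12 := h 1 2 4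
  have e13 := h 0 3 5
  have e14 := h 0 3 6
  have e15 := h 1 3 6
  rw [starEta0_of_table t1] at e1
  rw [starEta0_of_table t2] at e2
  rw [starEta0_of_table t3] at e3
  rw [starEta0_of_table t4] at e4
  rw [starEta0_of_table t5] at e5
  rw [starEta0_of_table t6] at e6
  rw [starEta0_of_table t7] at e7
  rw [starEta0_of_table t8] at e8
  rw [starEta0_of_table t9] at e9
  rw [starEta0_of_table t10] at e10
  rw [starEta0_of_table t11] at e11
  rw [starEta0_of_table t12] at e12
  rw [starEta0_of_table t13] at e13
  rw [starEta0_of_table t14] at e14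
  rw [starEta0_of_table t15] at e15
  clear t1 t2 t3 t4 t5 t6 t7 t8 t9 t10 t11 t12 t13 t14 t15 h
  simp [etaVar, eta0, phi0, mono3, Matrix.det_fin_three,
    matCol] at e1 e2 e3 e4 e5 e6 e7 e8 e9 e10 e11 e12 e13 e14 e15
  simp only [hskew 1 0, hskew 2 0, hskew 2 1, hskew 3 0, hskew 3 1, hskew 3 2, hskew 4 0, hskew 4 1,
    hskew 4 2, hskew 4 3, hskew 5 0, hskew 5 1, hskew 5 2, hskew 5 3, hskew 6 0,
    hskew 6 1, hskew 6 2, hskew 6 3] at e1 e2 e3 e4 e5 e6 e7 e8 e9 e10 e11 e12 e13 e14 e15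
  constructor <;> linarith

/-! ### The Levi-Civita connection of a local metric -/

section LeviCivita

variable {E : Type*} [NormedAddCommGroup E] [NormedSpace ℝ E]

/-- The right hand side of the Koszul formula in coordinates, where `D` is the derivative of the
metric. -/
def koszul (D : E →L[ℝ] E →L[ℝ] E →L[ℝ] ℝ) : E →L[ℝ] E →L[ℝ] E →L[ℝ] ℝ :=
  (1 / 2 : ℝ) • (D + D.flip -
    (ContinuousLinearMap.flipₗᵢ ℝ E E ℝ : (E →L[ℝ] E →L[ℝ] ℝ) →L[ℝ] E →L[ℝ] E →L[ℝ] ℝ).comp D.flip)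

theorem koszul_apply (D : E →L[ℝ] E →L[ℝ] E →L[ℝ] ℝ) (v w u : E) :
    koszul D v w u = 1 / 2 * (D v w u + D w v u - D u v w) := rfl

/-- The Christoffel symbols of a metric `G` on (an open subset of) `E`. They are defined at every
point, whereas `christoffel` gives them only at the center of a chart. -/
def localChr (G : E → E →L[ℝ] E →L[ℝ] ℝ) (y : E) : E →L[ℝ] E →L[ℝ] E :=
  ((ContinuousLinearMap.compL ℝ E (E →L[ℝ] ℝ) E) (G y).inverse).comp (koszul (fderiv ℝ G y))

variable {G : E → E →L[ℝ] E →L[ℝ] ℝ} {y : E}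

theorem localChr_spec (hG : (G y).IsInvertible) (v w u : E) :
    G y (localChr G y v w) u = koszul (fderiv ℝ G y) v w u := by
  have h : localChr G y v w = (G y).inverse (koszul (fderiv ℝ G y) v w) := rfl
  obtain ⟨L, hL⟩ := hG
  rw [h, ← hL, ContinuousLinearMap.inverse_equiv]
  simp

theorem fderiv_symm (hd : DifferentiableAt ℝ G y)
    (hs : ∀ᶠ y' in 𝓝 y, ∀ v w, G y' v w = G y' w v) (u v w : E) :
    fderiv ℝ G y u v w = fderiv ℝ G y u w v := by
  have h1 : HasFDerivAt (fun y' => G y' v w) _ y :=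
    (hd.hasFDerivAt.clm_apply (hasFDerivAt_const v y)).clm_apply (hasFDerivAt_const w y)
  have h2 : HasFDerivAt (fun y' => G y' w v) _ y :=
    (hd.hasFDerivAt.clm_apply (hasFDerivAt_const w y)).clm_apply (hasFDerivAt_const v y)
  have h3 := h1.unique (h2.congr_of_eventuallyEq (hs.mono fun y' h => h v w))
  simpa using DFunLike.congr_fun h3 u

theorem localChr_symm (hG : (G y).IsInvertible) (hd : DifferentiableAt ℝ G y)
    (hs : ∀ᶠ y' in 𝓝 y, ∀ v w, G y' v w = G y' w v) (v w : E) :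
    localChr G y v w = localChr G y w v := by
  obtain ⟨L, hL⟩ := id hG
  apply L.injective
  ext u
  rw [← ContinuousLinearEquiv.coe_coe, hL, localChr_spec hG, localChr_spec hG, koszul_apply,
    koszul_apply, fderiv_symm hd hs u v w]
  ring

/-- The connection is metric. -/
theorem localChr_compat (hG : (G y).IsInvertible) (hd : DifferentiableAt ℝ G y)
    (hs : ∀ᶠ y' in 𝓝 y, ∀ v w, G y' v w = G y' w v) (v w u : E) :
    fderiv ℝ G y v w u = G y (localChr G y v w) u + G y w (localChr G y v u) := by
  rw [hs.self_of_nhds w, localChr_spec hG, localChr_spec hG, koszul_apply, koszul_apply,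
    fderiv_symm hd hs v u w, fderiv_symm hd hs u v w, fderiv_symm hd hs w v u]
  ring

/-- The Levi-Civita connection is the only metric connection without torsion. -/
theorem eq_localChr (hG : (G y).IsInvertible)
    (hs : ∀ v w, G y v w = G y w v) {B : E → E → E} (hB : ∀ v w, B v w = B w v)
    (hc : ∀ v w u, fderiv ℝ G y v w u = G y (B v w) u + G y w (B v u)) (v w : E) :
    localChr G y v w = B v w := by
  obtain ⟨L, hL⟩ := id hG
  apply L.injective
  ext u
  rw [← ContinuousLinearEquiv.coe_coe, hL, localChr_spec hG, koszul_apply, hc, hc, hc, hs w, hs v,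
    hs v, hB w v, hB u v, hB u w]
  ring

/-- The transformation law of Christoffel symbols under a map `τ` with differential `T` that is an
isometry from `G₀` to `G₁`: the symbol obtained from `G₁` by transport is symmetric and metric for
`G₀`. -/
theorem localChr_transform {G₀ G₁ : E → E →L[ℝ] E →L[ℝ] ℝ} {τ : E → E} {T : E → E →L[ℝ] E}
    {T' : E →L[ℝ] E →L[ℝ] E}
    (h : ∀ᶠ y' in 𝓝 y, ∀ w u, G₀ y' w u = G₁ (τ y') (T y' w) (T y' u))
    (hτ : HasFDerivAt τ (T y) y) (hT : HasFDerivAt T T' y) (hT' : ∀ v w, T' v w = T' w v)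
    (hTi : (T y).IsInvertible) (hG₀ : (G₀ y).IsInvertible) (hG₁ : (G₁ (τ y)).IsInvertible)
    (hd₀ : DifferentiableAt ℝ G₀ y) (hd₁ : DifferentiableAt ℝ G₁ (τ y))
    (hs₁ : ∀ᶠ y' in 𝓝 (τ y), ∀ v w, G₁ y' v w = G₁ y' w v) (v w : E) :
    T y (localChr G₀ y v w) = localChr G₁ (τ y) (T y v) (T y w) + T' v w := by
  obtain ⟨L, hL⟩ := hTi
  have hLa : ∀ x, T y x = L x := fun x => by rw [← hL]; rfl
  have key : localChr G₀ y v w = L.symm (localChr G₁ (τ y) (T y v) (T y w) + T' v w) := by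
    refine eq_localChr (B := fun v w => L.symm (localChr G₁ (τ y) (T y v) (T y w) + T' v w)) hG₀ ?_
      ?_ ?_ v w
    · intro v w
      rw [h.self_of_nhds, h.self_of_nhds, hs₁.self_of_nhds]
    · intro v w
      rw [localChr_symm hG₁ hd₁ hs₁, hT']
    · intro v w u
      have h1 : HasFDerivAt (fun y' => G₀ y' w u) _ y :=
        (hd₀.hasFDerivAt.clm_apply (hasFDerivAt_const w y)).clm_apply (hasFDerivAt_const u y)
      have h2 : HasFDerivAt (fun y' => G₁ (τ y') (T y' w) (T y' u)) _ y :=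
        ((hd₁.hasFDerivAt.comp y hτ).clm_apply (hT.clm_apply (hasFDerivAt_const w y))).clm_apply
          (hT.clm_apply (hasFDerivAt_const u y))
      have h3 := DFunLike.congr_fun
        (h1.unique (h2.congr_of_eventuallyEq (h.mono fun y' h => h w u))) v
      simp at h3
      rw [h3, h.self_of_nhds, h.self_of_nhds, hLa (L.symm _), hLa (L.symm _), L.apply_symm_apply,
        L.apply_symm_apply, localChr_compat hG₁ hd₁ hs₁]
      simp
      ring
  rw [key, hLa (L.symm _), L.apply_symm_apply]

theorem contDiffOn_localChr [CompleteSpace E] {s : Set E} (hs : IsOpen s) (hG : ContDiffOn ℝ ∞ G s)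
    (hi : ∀ y ∈ s, (G y).IsInvertible) : ContDiffOn ℝ ∞ (localChr G) s := by
  have h1 : ContDiffOn ℝ ∞ (fun y => (G y).inverse) s := by
    intro y hy
    obtain ⟨L, hL⟩ := hi y hy
    have := contDiffAt_map_inverse (n := ∞) L
    rw [hL] at this
    exact (this.comp y (hG.contDiffAt (hs.mem_nhds hy))).contDiffWithinAt
  have h2 : ContDiffOn ℝ ∞ (fderiv ℝ G) s := hG.fderiv_of_isOpen hs (by simp)
  have h3 : ContDiffOn ℝ ∞ (fun y => (fderiv ℝ G y).flip) s :=
    (ContinuousLinearMap.flipₗᵢ ℝ E E (E →L[ℝ] ℝ)).contDiff.comp_contDiffOn h2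
  have h4 : ContDiffOn ℝ ∞ (fun y => koszul (fderiv ℝ G y)) s :=
    (((h2.add h3).sub (contDiffOn_const.clm_comp h3 (g := fun _ =>
      (ContinuousLinearMap.flipₗᵢ ℝ E E ℝ : (E →L[ℝ] E →L[ℝ] ℝ) →L[ℝ] E →L[ℝ] E →L[ℝ] ℝ)))).const_smul
      (1 / 2 : ℝ)).congr fun y _ => rfl
  exact ((ContinuousLinearMap.compL ℝ E (E →L[ℝ] ℝ) E).contDiff.comp_contDiffOn h1).clm_comp h4

end LeviCivita

/-! ### Curvature, and connection forms of moving coframes -/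

section Curvature

variable {E : Type*} [NormedAddCommGroup E] [NormedSpace ℝ E]
  {F : Type*} [NormedAddCommGroup F] [NormedSpace ℝ F]
  {Z : Type*} [NormedAddCommGroup Z] [NormedSpace ℝ Z]

/-- The curvature `R(u, v) w` at `y` of a connection with Christoffel symbols `Γ`,
`R(u, v) w = (∂ᵤ Γ)(v, w) - (∂ᵥ Γ)(u, w) + Γ(u, Γ(v, w)) - Γ(v, Γ(u, w))`. -/
def curv (Γ : E → E →L[ℝ] E →L[ℝ] E) (y u v w : E) : E :=
  fderiv ℝ Γ y u v w - fderiv ℝ Γ y v u w + Γ y u (Γ y v w) - Γ y v (Γ y u w)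

theorem curv_swap (Γ : E → E →L[ℝ] E →L[ℝ] E) (y u v w : E) :
    curv Γ y v u w = -curv Γ y u v w := by
  simp only [curv]
  abel

theorem curv_bianchi {Γ : E → E →L[ℝ] E →L[ℝ] E} {y : E} (hd : DifferentiableAt ℝ Γ y)
    (hs : ∀ᶠ y' in 𝓝 y, ∀ v w, Γ y' v w = Γ y' w v) (u v w : E) :
    curv Γ y u v w + curv Γ y v w u + curv Γ y w u v = 0 := by
  have h : ∀ u v w, fderiv ℝ Γ y u v w = fderiv ℝ Γ y u w v := by
    intro u v w
    have h1 : HasFDerivAt (fun y' => Γ y' v w) _ y :=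
      (hd.hasFDerivAt.clm_apply (hasFDerivAt_const v y)).clm_apply (hasFDerivAt_const w y)
    have h2 : HasFDerivAt (fun y' => Γ y' w v) _ y :=
      (hd.hasFDerivAt.clm_apply (hasFDerivAt_const w y)).clm_apply (hasFDerivAt_const v y)
    have h3 := h1.unique (h2.congr_of_eventuallyEq (hs.mono fun y' h => h v w))
    simpa using DFunLike.congr_fun h3 u
  have hs' := hs.self_of_nhds
  simp only [curv]
  rw [h u v w, h v u w, h w u v, hs' v w, hs' w u, hs' v u]
  abel

/-- The curvature of a metric connection is skew: take the second derivative of the metric and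
antisymmetrize. -/
theorem curv_skew {G : E → E →L[ℝ] E →L[ℝ] ℝ} {Γ : E → E →L[ℝ] E →L[ℝ] E} {y : E}
    (hG : ContDiffAt ℝ 2 G y) (hd : DifferentiableAt ℝ Γ y)
    (hc : ∀ᶠ y' in 𝓝 y, ∀ v w u, fderiv ℝ G y' v w u = G y' (Γ y' v w) u + G y' w (Γ y' v u))
    (u v w t : E) : G y (curv Γ y u v w) t + G y w (curv Γ y u v t) = 0 := by
  have hG1 : HasFDerivAt G _ y := (hG.differentiableAt (by simp)).hasFDerivAt
  have hG2 : HasFDerivAt (fderiv ℝ G) _ y :=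
    ((hG.fderiv_right (m := 1) (by norm_num)).differentiableAt (by simp)).hasFDerivAt
  have hsymm : ∀ a b, fderiv ℝ (fderiv ℝ G) y a b = fderiv ℝ (fderiv ℝ G) y b a := by
    intro a b
    exact (hG.isSymmSndFDerivAt (by simp)).eq a b
  have hΓ := hd.hasFDerivAt
  -- Differentiate the equation for a metric connection once more.
  have key : ∀ u v : E, fderiv ℝ (fderiv ℝ G) y u v w t =
      fderiv ℝ G y u (Γ y v w) t + G y (fderiv ℝ Γ y u v w) t + fderiv ℝ G y u w (Γ y v t) +
        G y w (fderiv ℝ Γ y u v t) := by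
    intro u v
    have h1 : HasFDerivAt (fun y' => fderiv ℝ G y' v w t) _ y :=
      ((hG2.clm_apply (hasFDerivAt_const v y)).clm_apply (hasFDerivAt_const w y)).clm_apply
        (hasFDerivAt_const t y)
    have h2 : HasFDerivAt (fun y' => G y' (Γ y' v w) t + G y' w (Γ y' v t)) _ y :=
      ((hG1.clm_apply ((hΓ.clm_apply (hasFDerivAt_const v y)).clm_apply
        (hasFDerivAt_const w y))).clm_apply (hasFDerivAt_const t y)).add
      ((hG1.clm_apply (hasFDerivAt_const w y)).clm_apply
        ((hΓ.clm_apply (hasFDerivAt_const v y)).clm_apply (hasFDerivAt_const t y)))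
    have h3 := DFunLike.congr_fun
      (h1.unique (h2.congr_of_eventuallyEq (hc.mono fun y' h => h v w t))) u
    simp at h3
    rw [h3]
    ring
  have h1 := key u v
  have h2 := key v u
  have hc' := hc.self_of_nhds
  rw [hsymm u v] at h1
  simp only [hc'] at h1 h2
  simp only [curv, map_add, map_sub, add_apply, sub_apply]
  linarith

/-- The covariant derivative `de - e ∘ Γ(dX, ·)` of a field `e` of linear maps `E → F` along a map
`X`. -/
def frameDer (Γ : E → E →L[ℝ] E →L[ℝ] E) (X : Z → E) (e : Z → E →L[ℝ] F) (z : Z) :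
    Z →L[ℝ] E →L[ℝ] F :=
  fderiv ℝ e z - (ContinuousLinearMap.compL ℝ E E F (e z)).comp ((Γ (X z)).comp (fderiv ℝ X z))

/-- The connection form `ψ = - (∇e) ∘ e⁻¹` of a field `e` of coframes along a map `X`. -/
def frameConn (Γ : E → E →L[ℝ] E →L[ℝ] E) (X : Z → E) (e : Z → E →L[ℝ] F) (z : Z) :
    Z →L[ℝ] F →L[ℝ] F :=
  -((ContinuousLinearMap.compL ℝ F E F).flip (e z).inverse).comp (frameDer Γ X e z)

theorem frameDer_apply (Γ : E → E →L[ℝ] E →L[ℝ] E) (X : Z → E) (e : Z → E →L[ℝ] F) (z ξ : Z)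
    (v : E) : frameDer Γ X e z ξ v = fderiv ℝ e z ξ v - e z (Γ (X z) (fderiv ℝ X z ξ) v) := rfl

theorem frameConn_apply (Γ : E → E →L[ℝ] E →L[ℝ] E) (X : Z → E) (e : Z → E →L[ℝ] F) (z ξ : Z)
    (f : F) : frameConn Γ X e z ξ f = -frameDer Γ X e z ξ ((e z).inverse f) := rfl

variable {Γ : E → E →L[ℝ] E →L[ℝ] E} {X : Z → E} {e : Z → E →L[ℝ] F} {z : Z}

theorem inverse_apply_self {L : E →L[ℝ] F} (h : L.IsInvertible) (v : E) : L.inverse (L v) = v := by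
  obtain ⟨L', rfl⟩ := h
  simp

theorem apply_inverse_self {L : E →L[ℝ] F} (h : L.IsInvertible) (v : F) : L (L.inverse v) = v := by
  obtain ⟨L', rfl⟩ := h
  simp

theorem frameConn_frame (he : (e z).IsInvertible) (ξ : Z) (v : E) :
    frameConn Γ X e z ξ (e z v) = -frameDer Γ X e z ξ v := by
  rw [frameConn_apply, inverse_apply_self he]

/-- The equation `dω = - ψ ∧ ω` for `ω = e ∘ dX`. -/
theorem frame_torsion (he : (e z).IsInvertible) (hX : ContDiffAt ℝ 2 X z)
    (hd : DifferentiableAt ℝ e z) (hs : ∀ v w, Γ (X z) v w = Γ (X z) w v) (ξ η : Z) :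
    fderiv ℝ (fun z' => (e z').comp (fderiv ℝ X z')) z ξ η -
        fderiv ℝ (fun z' => (e z').comp (fderiv ℝ X z')) z η ξ =
      -(frameConn Γ X e z ξ (e z (fderiv ℝ X z η)) - frameConn Γ X e z η (e z (fderiv ℝ X z ξ))) := by
  have hX2 : HasFDerivAt (fderiv ℝ X) _ z :=
    ((hX.fderiv_right (m := 1) (by norm_num)).differentiableAt (by simp)).hasFDerivAt
  have hsymm := (hX.isSymmSndFDerivAt (by simp)).eq ξ η
  rw [(hd.hasFDerivAt.clm_comp hX2).fderiv, frameConn_frame he, frameConn_frame he]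
  simp only [frameDer_apply]
  simp [hsymm, hs (fderiv ℝ X z ξ)]

/-- The equation `dψ + ψ ∧ ψ = e R e⁻¹`: differentiate `ψ e = - ∇e` and antisymmetrize, so that the
second derivatives of `e` and of `X` drop out. -/
theorem frame_curvature [CompleteSpace E] (he : (e z).IsInvertible) (hX : ContDiffAt ℝ 2 X z)
    (hd : ContDiffAt ℝ 2 e z) (hΓ : DifferentiableAt ℝ Γ (X z)) (hψ : DifferentiableAt ℝ (frameConn Γ X e) z)
    (ξ η : Z) (v : E) :
    fderiv ℝ (frameConn Γ X e) z ξ η (e z v) - fderiv ℝ (frameConn Γ X e) z η ξ (e z v) +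
      (frameConn Γ X e z ξ (frameConn Γ X e z η (e z v)) -
        frameConn Γ X e z η (frameConn Γ X e z ξ (e z v))) =
      e z (curv Γ (X z) (fderiv ℝ X z ξ) (fderiv ℝ X z η) v) := by
  have hinv : ∀ᶠ z' in 𝓝 z, (e z').IsInvertible := by
    obtain ⟨L, hL⟩ := he
    have h1 := ContinuousLinearEquiv.nhds L
    rw [hL] at h1
    filter_upwards [hd.continuousAt h1] with z' ⟨L', hL'⟩
    exact ⟨L', hL'⟩
  have hX1 : HasFDerivAt X _ z := (hX.differentiableAt (by simp)).hasFDerivAt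
  have he1 : HasFDerivAt e _ z := (hd.differentiableAt (by simp)).hasFDerivAt
  have hX2 : HasFDerivAt (fderiv ℝ X) _ z :=
    ((hX.fderiv_right (m := 1) (by norm_num)).differentiableAt (by simp)).hasFDerivAt
  have he2 : HasFDerivAt (fderiv ℝ e) _ z :=
    ((hd.fderiv_right (m := 1) (by norm_num)).differentiableAt (by simp)).hasFDerivAt
  have hXs := (hX.isSymmSndFDerivAt (by simp)).eq ξ η
  have hes := (hd.isSymmSndFDerivAt (by simp)).eq ξ η
  -- Differentiate `ψ(η) e v = - (∇_η e) v` in the direction `ξ`.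
  have key : ∀ ξ η : Z, fderiv ℝ (frameConn Γ X e) z ξ η (e z v) +
      frameConn Γ X e z η (fderiv ℝ e z ξ v) =
      -(fderiv ℝ (fderiv ℝ e) z ξ η v - (fderiv ℝ e z ξ (Γ (X z) (fderiv ℝ X z η) v) +
        e z (fderiv ℝ Γ (X z) (fderiv ℝ X z ξ) (fderiv ℝ X z η) v +
          Γ (X z) (fderiv ℝ (fderiv ℝ X) z ξ η) v))) := by
    intro ξ η
    have h1 : HasFDerivAt (fun z' => frameConn Γ X e z' η (e z' v)) _ z :=
      (hψ.hasFDerivAt.clm_apply (hasFDerivAt_const η z)).clm_apply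
        (he1.clm_apply (hasFDerivAt_const v z))
    have h2 : HasFDerivAt (fun z' => -(fderiv ℝ e z' η v - e z' (Γ (X z') (fderiv ℝ X z' η) v))) _ z :=
      (((he2.clm_apply (hasFDerivAt_const η z)).clm_apply (hasFDerivAt_const v z)).sub
        (he1.clm_apply (((hΓ.hasFDerivAt.comp z hX1).clm_apply
          (hX2.clm_apply (hasFDerivAt_const η z))).clm_apply (hasFDerivAt_const v z)))).neg
    have h3 := DFunLike.congr_fun (h1.unique (h2.congr_of_eventuallyEq (hinv.mono fun z' h =>
      frameConn_frame h η v))) ξ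
    simp at h3
    rw [add_comm, h3]
    simp
    abel
  have k1 := key ξ η
  have k2 := key η ξ
  have hde : ∀ ξ w, fderiv ℝ e z ξ w = e z (Γ (X z) (fderiv ℝ X z ξ) w) -
      frameConn Γ X e z ξ (e z w) := by
    intro ξ w
    rw [frameConn_frame he, frameDer_apply]
    abel
  rw [hXs, hes] at k1
  simp only [hde, map_sub, map_add, frameConn_frame he] at k1 k2
  have k1' := eq_sub_of_add_eq k1
  have k2' := eq_sub_of_add_eq k2
  rw [k1', k2']
  simp only [curv, frameConn_frame he, map_neg, map_sub, map_add]
  abel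

/-- The connection form of a coframe does not depend on the coordinates. -/
theorem frameConn_transform {Γ₀ Γ₁ : E → E →L[ℝ] E →L[ℝ] E} {τ : E → E} {T : E → E →L[ℝ] E}
    {T' : E →L[ℝ] E →L[ℝ] E} {X₁ : Z → E} {e₁ : Z → E →L[ℝ] F}
    (hX₁ : HasFDerivAt X₁ ((T (X z)).comp (fderiv ℝ X z)) z) (hXz : X₁ z = τ (X z))
    (he : ∀ᶠ z' in 𝓝 z, ∀ v, e z' v = e₁ z' (T (X z') v))
    (hX : DifferentiableAt ℝ X z) (hT : HasFDerivAt T T' (X z)) (hTi : (T (X z)).IsInvertible)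
    (hei : (e₁ z).IsInvertible) (hd : DifferentiableAt ℝ e z) (hd₁ : DifferentiableAt ℝ e₁ z)
    (h : ∀ v w, T (X z) (Γ₀ (X z) v w) = Γ₁ (τ (X z)) (T (X z) v) (T (X z) w) + T' v w) :
    frameConn Γ₀ X e z = frameConn Γ₁ X₁ e₁ z := by
  have hez : ∀ v, e z v = e₁ z (T (X z) v) := he.self_of_nhds
  have hei0 : (e z).IsInvertible := by
    have : e z = (e₁ z).comp (T (X z)) := by ext v; exact hez v
    rw [this]
    exact hei.comp hTi
  ext ξ f
  obtain ⟨v, rfl⟩ : ∃ v, e z v = f := ⟨_, apply_inverse_self hei0 f⟩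
  rw [frameConn_frame hei0, hez, frameConn_frame hei, frameDer_apply, frameDer_apply, hX₁.fderiv,
    hXz]
  have h1 : HasFDerivAt (fun z' => e z' v) _ z :=
    hd.hasFDerivAt.clm_apply (hasFDerivAt_const v z)
  have h2 : HasFDerivAt (fun z' => e₁ z' (T (X z') v)) _ z :=
    hd₁.hasFDerivAt.clm_apply ((hT.comp z hX.hasFDerivAt).clm_apply (hasFDerivAt_const v z))
  have h3 := DFunLike.congr_fun (h1.unique (h2.congr_of_eventuallyEq (he.mono fun z' h => h v))) ξ
  simp at h3
  rw [h3, hez, h, map_add]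
  abel

/-- The curvature is a tensor. The hypothesis says that the connection form of the coframe field
`dτ` for `Γ₀` is `Γ₁(dτ, ·)`, so this is a case of `frame_curvature`. -/
theorem curv_transform [CompleteSpace E] {Γ₀ Γ₁ : E → E →L[ℝ] E →L[ℝ] E} {τ : E → E} {y : E}
    (hτ : ContDiffAt ℝ 3 τ y) (hTi : (fderiv ℝ τ y).IsInvertible)
    (hΓ₀ : DifferentiableAt ℝ Γ₀ y) (hΓ₁ : DifferentiableAt ℝ Γ₁ (τ y))
    (h : ∀ᶠ y' in 𝓝 y, ∀ v w, fderiv ℝ τ y' (Γ₀ y' v w) =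
      Γ₁ (τ y') (fderiv ℝ τ y' v) (fderiv ℝ τ y' w) + fderiv ℝ (fderiv ℝ τ) y' v w) (u v w : E) :
    fderiv ℝ τ y (curv Γ₀ y u v w) =
      curv Γ₁ (τ y) (fderiv ℝ τ y u) (fderiv ℝ τ y v) (fderiv ℝ τ y w) := by
  have hT : ContDiffAt ℝ 2 (fderiv ℝ τ) y := hτ.fderiv_right (by norm_num)
  have hinv : ∀ᶠ z' in 𝓝 y, (fderiv ℝ τ z').IsInvertible := by
    obtain ⟨L, hL⟩ := hTi
    have h1 := ContinuousLinearEquiv.nhds L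
    rw [hL] at h1
    filter_upwards [hT.continuousAt h1] with z' ⟨L', hL'⟩
    exact ⟨L', hL'⟩
  have hT1 : HasFDerivAt (fderiv ℝ τ) _ y := (hT.differentiableAt (by simp)).hasFDerivAt
  have hτ1 : HasFDerivAt τ _ y := (hτ.differentiableAt (by simp)).hasFDerivAt
  -- The connection form of the coframe field `dτ` along the identity.
  have heq : frameConn Γ₀ id (fderiv ℝ τ) =ᶠ[𝓝 y] fun y' => (Γ₁ (τ y')).comp (fderiv ℝ τ y') := by
    filter_upwards [hinv, h] with y' hi h'
    ext ξ f
    obtain ⟨v, rfl⟩ : ∃ v, fderiv ℝ τ y' v = f := ⟨_, apply_inverse_self hi f⟩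
    rw [frameConn_frame hi, frameDer_apply]
    simp [h']
  have hder : HasFDerivAt (fun y' => (Γ₁ (τ y')).comp (fderiv ℝ τ y')) _ y :=
    (hΓ₁.hasFDerivAt.comp y hτ1).clm_comp hT1
  have hder' := hder.congr_of_eventuallyEq heq
  have hsymm := ((hτ.of_le (by norm_num : (2 : WithTop ℕ∞) ≤ 3)).isSymmSndFDerivAt (by simp)).eq u v
  have key := frame_curvature (Γ := Γ₀) (X := id) (e := fderiv ℝ τ) (z := y) hTi contDiffAt_id hT
    hΓ₀ hder'.differentiableAt u v w
  rw [hder'.fderiv, heq.self_of_nhds] at key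
  simp [hsymm] at key
  rw [← key]
  simp only [curv]
  abel

end Curvature

/-! ### Change of charts -/

section ChartTransition

set_option linter.unusedSectionVars false

variable {E : Type*} [NormedAddCommGroup E] [NormedSpace ℝ E]
  {H : Type*} [TopologicalSpace H] (I : ModelWithCorners ℝ E H) [I.Boundaryless]
  {X : Type*} [TopologicalSpace X] [ChartedSpace H X]

/-- The coordinate change from the preferred chart at `x₀` to the one at `x`. -/
def chartTrans (x₀ x : X) : E → E := extChartAt I x ∘ (extChartAt I x₀).symm

variable {I}

theorem symm_chartTrans {x₀ x : X} {y : E} (hx : (extChartAt I x₀).symm y ∈ (extChartAt I x).source) :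
    (extChartAt I x).symm (chartTrans I x₀ x y) = (extChartAt I x₀).symm y :=
  (extChartAt I x).left_inv hx

theorem chartTrans_mem_target {x₀ x : X} {y : E}
    (hx : (extChartAt I x₀).symm y ∈ (extChartAt I x).source) :
    chartTrans I x₀ x y ∈ (extChartAt I x).target :=
  (extChartAt I x).map_source hx

theorem eventually_mem_target {x₀ : X} {y : E} (hy : y ∈ (extChartAt I x₀).target) :
    ∀ᶠ y' in 𝓝 y, y' ∈ (extChartAt I x₀).target :=
  (isOpen_extChartAt_target x₀).mem_nhds hy

theorem eventually_symm_mem_source {x₀ x : X} {y : E} (hy : y ∈ (extChartAt I x₀).target)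
    (hx : (extChartAt I x₀).symm y ∈ (extChartAt I x).source) :
    ∀ᶠ y' in 𝓝 y, (extChartAt I x₀).symm y' ∈ (extChartAt I x).source :=
  (continuousAt_extChartAt_symm'' hy).eventually
    ((isOpen_extChartAt_source x).mem_nhds hx)

theorem chartTrans_chartTrans {x₀ x x₁ : X} {y : E}
    (hx : (extChartAt I x₀).symm y ∈ (extChartAt I x).source) :
    chartTrans I x x₁ (chartTrans I x₀ x y) = chartTrans I x₀ x₁ y := by
  change extChartAt I x₁ ((extChartAt I x).symm (chartTrans I x₀ x y)) = _
  rw [symm_chartTrans hx]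
  rfl

theorem chartTrans_self {x₀ : X} {y : E} (hy : y ∈ (extChartAt I x₀).target) :
    chartTrans I x₀ x₀ y = y :=
  (extChartAt I x₀).right_inv hy

variable [IsManifold I ∞ X]

theorem contDiffAt_chartTrans {x₀ x : X} {y : E} (hy : y ∈ (extChartAt I x₀).target)
    (hx : (extChartAt I x₀).symm y ∈ (extChartAt I x).source) :
    ContDiffAt ℝ ∞ (chartTrans I x₀ x) y := by
  have h := contDiffWithinAt_ext_coord_change (I := I) (n := ∞) x x₀ (y := y) (by
    rw [PartialEquiv.trans_source]
    exact ⟨hy, hx⟩)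
  rw [I.range_eq_univ] at h
  exact h.contDiffAt Filter.univ_mem

theorem differentiableAt_chartTrans {x₀ x : X} {y : E} (hy : y ∈ (extChartAt I x₀).target)
    (hx : (extChartAt I x₀).symm y ∈ (extChartAt I x).source) :
    DifferentiableAt ℝ (chartTrans I x₀ x) y :=
  (contDiffAt_chartTrans hy hx).differentiableAt (by simp)

theorem fderiv_chartTrans_comp {x₀ x x₁ : X} {y : E} (hy : y ∈ (extChartAt I x₀).target)
    (hx : (extChartAt I x₀).symm y ∈ (extChartAt I x).source)
    (hx₁ : (extChartAt I x₀).symm y ∈ (extChartAt I x₁).source) :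
    fderiv ℝ (chartTrans I x₀ x₁) y =
      (fderiv ℝ (chartTrans I x x₁) (chartTrans I x₀ x y)).comp (fderiv ℝ (chartTrans I x₀ x) y) := by
  rw [← fderiv_comp y (differentiableAt_chartTrans (chartTrans_mem_target hx)
    (by rwa [symm_chartTrans hx])) (differentiableAt_chartTrans hy hx)]
  refine Filter.EventuallyEq.fderiv_eq ?_
  filter_upwards [eventually_symm_mem_source hy hx] with y' h'
  exact (chartTrans_chartTrans h').symm

theorem fderiv_chartTrans_self {x₀ : X} {y : E} (hy : y ∈ (extChartAt I x₀).target) :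
    fderiv ℝ (chartTrans I x₀ x₀) y = ContinuousLinearMap.id ℝ E := by
  rw [← fderiv_id]
  refine Filter.EventuallyEq.fderiv_eq ?_
  filter_upwards [eventually_mem_target hy] with y' h'
  exact chartTrans_self h'

theorem fderiv_chartTrans_isInvertible {x₀ x : X} {y : E} (hy : y ∈ (extChartAt I x₀).target)
    (hx : (extChartAt I x₀).symm y ∈ (extChartAt I x).source) :
    (fderiv ℝ (chartTrans I x₀ x) y).IsInvertible := by
  have hs : (extChartAt I x₀).symm y ∈ (extChartAt I x₀).source := (extChartAt I x₀).map_target hy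
  have h1 := fderiv_chartTrans_comp hy hx hs
  have h2 := fderiv_chartTrans_comp (x₀ := x) (x := x₀) (x₁ := x) (y := chartTrans I x₀ x y)
    (chartTrans_mem_target hx) (by rwa [symm_chartTrans hx]) (by rwa [symm_chartTrans hx])
  rw [fderiv_chartTrans_self hy] at h1
  rw [fderiv_chartTrans_self (chartTrans_mem_target hx), chartTrans_chartTrans hx,
    chartTrans_self hy] at h2
  exact ContinuousLinearMap.IsInvertible.of_inverse h2.symm h1.symm

/-- As a linear map `E → E`, the tangent space being identified with `E` by the preferred chart at
the point, the differential of the inverse chart is that of the coordinate change to the chart at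
the point. -/
theorem chartFrame_eq {x₀ : X} {y : E} (hy : y ∈ (extChartAt I x₀).target) :
    chartFrame I x₀ y = fderiv ℝ (chartTrans I x₀ ((extChartAt I x₀).symm y)) y := by
  have h : MDifferentiableAt 𝓘(ℝ, E) I (extChartAt I x₀).symm y :=
    ((contMDiffOn_extChartAt_symm (n := ∞) x₀).contMDiffAt
      ((isOpen_extChartAt_target x₀).mem_nhds hy)).mdifferentiableAt (by simp)
  rw [chartFrame, h.mfderiv]
  simp only [writtenInExtChartAt, mfld_simps, fderivWithin_univ]
  rfl

variable (I) in
/-- `chartFrame` as an endomorphism of the model space `E`. -/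
def frameMap (x₀ : X) (y : E) : E →L[ℝ] E := chartFrame I x₀ y

theorem frameMap_eq {x₀ : X} {y : E} (hy : y ∈ (extChartAt I x₀).target) :
    frameMap I x₀ y = fderiv ℝ (chartTrans I x₀ ((extChartAt I x₀).symm y)) y :=
  chartFrame_eq hy

theorem frameMap_comp {x₀ x : X} {y : E} (hy : y ∈ (extChartAt I x₀).target)
    (hx : (extChartAt I x₀).symm y ∈ (extChartAt I x).source) :
    frameMap I x₀ y =
      (frameMap I x (chartTrans I x₀ x y)).comp (fderiv ℝ (chartTrans I x₀ x) y) := by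
  rw [frameMap_eq hy, frameMap_eq (chartTrans_mem_target hx), symm_chartTrans hx,
    fderiv_chartTrans_comp hy hx (mem_extChartAt_source _)]

theorem frameMap_center (x : X) :
    frameMap I x (extChartAt I x x) = ContinuousLinearMap.id ℝ E := by
  rw [frameMap_eq (mem_extChartAt_target x), extChartAt_to_inv,
    fderiv_chartTrans_self (mem_extChartAt_target x)]

theorem frameMap_isInvertible {x₀ : X} {y : E} (hy : y ∈ (extChartAt I x₀).target) :
    (frameMap I x₀ y).IsInvertible := by
  rw [frameMap_eq hy]
  exact fderiv_chartTrans_isInvertible hy (mem_extChartAt_source _)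

/-- The metric at `x` as a bilinear form on the model space `E`. -/
def metricAt (g : Π x : X, TangentSpace I x →L[ℝ] TangentSpace I x →L[ℝ] ℝ) (x : X) :
    E →L[ℝ] E →L[ℝ] ℝ := g x

theorem metricInChart_apply (g : Π x : X, TangentSpace I x →L[ℝ] TangentSpace I x →L[ℝ] ℝ) (x₀ : X)
    (y v w : E) : metricInChart I g x₀ y v w =
      metricAt g ((extChartAt I x₀).symm y) (frameMap I x₀ y v) (frameMap I x₀ y w) := rfl

theorem metricInChart_center (g : Π x : X, TangentSpace I x →L[ℝ] TangentSpace I x →L[ℝ] ℝ) (x : X)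
    (v w : E) : metricInChart I g x (extChartAt I x x) v w = metricAt g x v w := by
  rw [metricInChart_apply, frameMap_center, extChartAt_to_inv]
  rfl

theorem metricInChart_chartTrans (g : Π x : X, TangentSpace I x →L[ℝ] TangentSpace I x →L[ℝ] ℝ)
    {x₀ x : X} {y : E} (hy : y ∈ (extChartAt I x₀).target)
    (hx : (extChartAt I x₀).symm y ∈ (extChartAt I x).source) (v w : E) :
    metricInChart I g x₀ y v w = metricInChart I g x (chartTrans I x₀ x y)
      (fderiv ℝ (chartTrans I x₀ x) y v) (fderiv ℝ (chartTrans I x₀ x) y w) := by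
  rw [metricInChart_apply, metricInChart_apply, symm_chartTrans hx, frameMap_comp hy hx]
  rfl

end ChartTransition

/-! ### Smooth metrics on a manifold -/

section SmoothMetric

set_option linter.unusedSectionVars false

variable {E : Type*} [NormedAddCommGroup E] [NormedSpace ℝ E]
  {H : Type*} [TopologicalSpace H] (I : ModelWithCorners ℝ E H) [I.Boundaryless]
  {X : Type*} [TopologicalSpace X] [ChartedSpace H X] [IsManifold I ∞ X]

/-- A smooth field of symmetric nondegenerate bilinear forms. Definiteness plays no role for the
Levi-Civita connection. -/
structure SmoothMetric (g : Π x : X, TangentSpace I x →L[ℝ] TangentSpace I x →L[ℝ] ℝ) : Prop where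
  smooth : ∀ x₀ : X, ContDiffOn ℝ ∞ (metricInChart I g x₀) (extChartAt I x₀).target
  isInvertible : ∀ x, (metricAt g x).IsInvertible
  symm : ∀ x v w, metricAt g x v w = metricAt g x w v

/-- The Christoffel symbols in the preferred chart at `x₀`, at all points of the chart. -/
def chartChr (g : Π x : X, TangentSpace I x →L[ℝ] TangentSpace I x →L[ℝ] ℝ) (x₀ : X) :
    E → E →L[ℝ] E →L[ℝ] E := localChr (metricInChart I g x₀)

variable {I} {g : Π x : X, TangentSpace I x →L[ℝ] TangentSpace I x →L[ℝ] ℝ} (hg : SmoothMetric I g)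

include hg

namespace SmoothMetric

theorem contDiffAt {x₀ : X} {y : E} (hy : y ∈ (extChartAt I x₀).target) :
    ContDiffAt ℝ ∞ (metricInChart I g x₀) y :=
  (hg.smooth x₀).contDiffAt ((isOpen_extChartAt_target x₀).mem_nhds hy)

theorem differentiableAt {x₀ : X} {y : E} (hy : y ∈ (extChartAt I x₀).target) :
    DifferentiableAt ℝ (metricInChart I g x₀) y := (hg.contDiffAt hy).differentiableAt (by simp)

theorem chart_symm (x₀ : X) (y v w : E) :
    metricInChart I g x₀ y v w = metricInChart I g x₀ y w v := by
  rw [metricInChart_apply, hg.symm, ← metricInChart_apply]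

theorem chart_isInvertible {x₀ : X} {y : E} (hy : y ∈ (extChartAt I x₀).target) :
    (metricInChart I g x₀ y).IsInvertible := by
  obtain ⟨L, hL⟩ := frameMap_isInvertible (I := I) hy
  obtain ⟨B, hB⟩ := hg.isInvertible ((extChartAt I x₀).symm y)
  refine ⟨(L.trans B).trans (L.symm.arrowCongr (ContinuousLinearEquiv.refl ℝ ℝ)), ?_⟩
  ext v w
  rw [metricInChart_apply, ← hL, ← hB]
  simp

theorem chr_transform {x₀ x : X} {y : E} (hy : y ∈ (extChartAt I x₀).target)
    (hx : (extChartAt I x₀).symm y ∈ (extChartAt I x).source) (v w : E) :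
    fderiv ℝ (chartTrans I x₀ x) y (chartChr I g x₀ y v w) =
      chartChr I g x (chartTrans I x₀ x y) (fderiv ℝ (chartTrans I x₀ x) y v)
        (fderiv ℝ (chartTrans I x₀ x) y w) + fderiv ℝ (fderiv ℝ (chartTrans I x₀ x)) y v w := by
  have hτ := contDiffAt_chartTrans hy hx
  refine localChr_transform (T := fderiv ℝ (chartTrans I x₀ x)) ?_
    (hτ.differentiableAt (by simp)).hasFDerivAt
    ((hτ.fderiv_right (m := 1) (by norm_cast)).differentiableAt (by simp)).hasFDerivAt
    (fun v w => ((hτ.of_le (by norm_cast : (2 : WithTop ℕ∞) ≤ ∞)).isSymmSndFDerivAt (by simp)).eq v w)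
    (fderiv_chartTrans_isInvertible hy hx) (hg.chart_isInvertible hy)
    (hg.chart_isInvertible (chartTrans_mem_target hx)) (hg.differentiableAt hy)
    (hg.differentiableAt (chartTrans_mem_target hx))
    (Filter.Eventually.of_forall fun y' v w => hg.chart_symm x y' v w) v w
  filter_upwards [eventually_mem_target hy, eventually_symm_mem_source hy hx] with y' h1 h2 w u
  exact metricInChart_chartTrans g h1 h2 w u

theorem contDiffOn_chr [CompleteSpace E] (x₀ : X) :
    ContDiffOn ℝ ∞ (chartChr I g x₀) (extChartAt I x₀).target :=
  contDiffOn_localChr (isOpen_extChartAt_target x₀) (hg.smooth x₀) fun _ hy => hg.chart_isInvertible hy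

theorem differentiableAt_chr [CompleteSpace E] {x₀ : X} {y : E} (hy : y ∈ (extChartAt I x₀).target) :
    DifferentiableAt ℝ (chartChr I g x₀) y :=
  ((hg.contDiffOn_chr x₀).contDiffAt ((isOpen_extChartAt_target x₀).mem_nhds hy)).differentiableAt
    (by simp)

theorem chr_symm {x₀ : X} {y : E} (hy : y ∈ (extChartAt I x₀).target) (v w : E) :
    chartChr I g x₀ y v w = chartChr I g x₀ y w v :=
  localChr_symm (hg.chart_isInvertible hy) (hg.differentiableAt hy)
    (Filter.Eventually.of_forall fun y' v w => hg.chart_symm x₀ y' v w) v w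

theorem chr_compat {x₀ : X} {y : E} (hy : y ∈ (extChartAt I x₀).target) (v w u : E) :
    fderiv ℝ (metricInChart I g x₀) y v w u = metricInChart I g x₀ y (chartChr I g x₀ y v w) u +
      metricInChart I g x₀ y w (chartChr I g x₀ y v u) :=
  localChr_compat (hg.chart_isInvertible hy) (hg.differentiableAt hy)
    (Filter.Eventually.of_forall fun y' v w => hg.chart_symm x₀ y' v w) v w u

theorem curv_chartTrans [CompleteSpace E] {x₀ x : X} {y : E} (hy : y ∈ (extChartAt I x₀).target)
    (hx : (extChartAt I x₀).symm y ∈ (extChartAt I x).source) (u v w : E) :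
    fderiv ℝ (chartTrans I x₀ x) y (curv (chartChr I g x₀) y u v w) =
      curv (chartChr I g x) (chartTrans I x₀ x y) (fderiv ℝ (chartTrans I x₀ x) y u)
        (fderiv ℝ (chartTrans I x₀ x) y v) (fderiv ℝ (chartTrans I x₀ x) y w) := by
  refine curv_transform ((contDiffAt_chartTrans hy hx).of_le (by norm_cast))
    (fderiv_chartTrans_isInvertible hy hx) (hg.differentiableAt_chr hy)
    (hg.differentiableAt_chr (chartTrans_mem_target hx)) ?_ u v w
  filter_upwards [eventually_mem_target hy, eventually_symm_mem_source hy hx] with y' h1 h2 v w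
  exact hg.chr_transform h1 h2 v w

theorem chart_curv_bianchi [CompleteSpace E] {x₀ : X} {y : E} (hy : y ∈ (extChartAt I x₀).target)
    (u v w : E) : curv (chartChr I g x₀) y u v w + curv (chartChr I g x₀) y v w u +
      curv (chartChr I g x₀) y w u v = 0 :=
  curv_bianchi (hg.differentiableAt_chr hy)
    ((eventually_mem_target hy).mono fun _ h v w => hg.chr_symm h v w) u v w

theorem chart_curv_skew [CompleteSpace E] {x₀ : X} {y : E} (hy : y ∈ (extChartAt I x₀).target)
    (u v w t : E) : metricInChart I g x₀ y (curv (chartChr I g x₀) y u v w) t +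
      metricInChart I g x₀ y w (curv (chartChr I g x₀) y u v t) = 0 :=
  curv_skew ((hg.contDiffAt hy).of_le (by norm_cast)) (hg.differentiableAt_chr hy)
    ((eventually_mem_target hy).mono fun _ h v w u => hg.chr_compat h v w u) u v w t

end SmoothMetric

end SmoothMetric

/-! ### Coordinates on the bundle `Hom(TM, ℝ⁷)` -/

section HomBundle

set_option linter.unusedSectionVars false

variable {M : Type*} [TopologicalSpace M] [ChartedSpace V7 M] [IsManifold (𝓡 7) ∞ M]
  {Z : Type*} [NormedAddCommGroup Z] [NormedSpace ℝ Z]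

/-- The base point of a family `u` of points of `Hom(TM, ℝ⁷)`, in the chart at `x₀`. -/
def baseCoord (x₀ : M) (u : Z → HomTotal M) (z : Z) : V7 := extChartAt (𝓡 7) x₀ (u z).1

/-- The linear map of a family `u` of points of `Hom(TM, ℝ⁷)`, expressed in the coordinate frame of
the chart at `x₀`. -/
def frameCoord (x₀ : M) (u : Z → HomTotal M) (z : Z) : V7 →L[ℝ] V7 :=
  (coframe (u z)).comp (frameMap (𝓡 7) x₀ (baseCoord x₀ u z))

/-- The trivialization of `Hom(TM, ℝ⁷)` at `x₀` is composition with the coordinate frame. -/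
theorem inCoordinates_eq (x₀ : M) (b : HomTotal M) (hb : b.1 ∈ (extChartAt (𝓡 7) x₀).source) :
    ContinuousLinearMap.inCoordinates V7 (TangentSpace (𝓡 7)) V7 (Bundle.Trivial M V7) x₀ b.1 x₀ b.1
      b.2 = (coframe b).comp (frameMap (𝓡 7) x₀ (extChartAt (𝓡 7) x₀ b.1)) := by
  have hb' : b.1 ∈ (chartAt V7 x₀).source := by rwa [extChartAt_source] at hb
  have h1 : (trivializationAt V7 (TangentSpace (𝓡 7)) x₀).symmL ℝ b.1 =
      frameMap (𝓡 7) x₀ (extChartAt (𝓡 7) x₀ b.1) := by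
    rw [TangentBundle.symmL_trivializationAt hb', ModelWithCorners.range_eq_univ, mfderivWithin_univ]
    rfl
  have h2 : ∀ w : V7, (trivializationAt V7 (Bundle.Trivial M V7) x₀).continuousLinearMapAt ℝ b.1 w =
      w := by
    intro w
    exact DFunLike.congr_fun (Bundle.Trivial.continuousLinearMapAt_trivialization ℝ M V7 b.1) w
  exact ContinuousLinearMap.ext fun v =>
    (h2 _).trans (congrArg (coframe b) (DFunLike.congr_fun h1 v))

/-- The preferred chart of `Hom(TM, ℝ⁷)` consists of the base coordinates and the linear map in the
coordinate frame. -/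
theorem extChartAt_homTotal (b b' : HomTotal M) (hb : b'.1 ∈ (extChartAt (𝓡 7) b.1).source) :
    extChartAt homModel b b' = (extChartAt (𝓡 7) b.1 b'.1,
      (coframe b').comp (frameMap (𝓡 7) b.1 (extChartAt (𝓡 7) b.1 b'.1))) := by
  rw [FiberBundle.extChartAt, ← inCoordinates_eq b.1 b' hb]
  rfl

variable {U : Set Z} {u : Z → HomTotal M}

theorem contMDiffAt_proj {z : Z} (hu : ContMDiffAt 𝓘(ℝ, Z) homModel ∞ u z) :
    ContMDiffAt 𝓘(ℝ, Z) (𝓡 7) ∞ (fun z => (u z).1) z :=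
  ((contMDiffAt_hom_bundle u).1 hu).1

theorem contDiffAt_baseCoord {x₀ : M} {z : Z} (hu : ContMDiffAt 𝓘(ℝ, Z) homModel ∞ u z)
    (hz : (u z).1 ∈ (extChartAt (𝓡 7) x₀).source) : ContDiffAt ℝ ∞ (baseCoord x₀ u) z := by
  rw [← contMDiffAt_iff_contDiffAt]
  exact ContMDiffAt.comp z (contMDiffAt_extChartAt' (by rwa [extChartAt_source] at hz))
    (contMDiffAt_proj hu)

theorem eventually_mem_source {x₀ : M} {z : Z} (hu : ContMDiffAt 𝓘(ℝ, Z) homModel ∞ u z)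
    (hz : (u z).1 ∈ (extChartAt (𝓡 7) x₀).source) :
    ∀ᶠ z' in 𝓝 z, (u z').1 ∈ (extChartAt (𝓡 7) x₀).source :=
  (contMDiffAt_proj hu).continuousAt.eventually ((isOpen_extChartAt_source x₀).mem_nhds hz)

theorem baseCoord_mem_target {x₀ : M} {z : Z} (hz : (u z).1 ∈ (extChartAt (𝓡 7) x₀).source) :
    baseCoord x₀ u z ∈ (extChartAt (𝓡 7) x₀).target := (extChartAt (𝓡 7) x₀).map_source hz

theorem symm_baseCoord {x₀ : M} {z : Z} (hz : (u z).1 ∈ (extChartAt (𝓡 7) x₀).source) :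
    (extChartAt (𝓡 7) x₀).symm (baseCoord x₀ u z) = (u z).1 := (extChartAt (𝓡 7) x₀).left_inv hz

theorem chartTrans_baseCoord {x₀ x : M} {z : Z} (hz : (u z).1 ∈ (extChartAt (𝓡 7) x₀).source) :
    chartTrans (𝓡 7) x₀ x (baseCoord x₀ u z) = baseCoord x u z := by
  change extChartAt (𝓡 7) x ((extChartAt (𝓡 7) x₀).symm (baseCoord x₀ u z)) = _
  rw [symm_baseCoord hz]
  rfl

theorem frameCoord_chartTrans {x₀ x : M} {z : Z} (hz : (u z).1 ∈ (extChartAt (𝓡 7) x₀).source)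
    (hx : (u z).1 ∈ (extChartAt (𝓡 7) x).source) :
    frameCoord x₀ u z =
      (frameCoord x u z).comp (fderiv ℝ (chartTrans (𝓡 7) x₀ x) (baseCoord x₀ u z)) := by
  rw [frameCoord, frameMap_comp (baseCoord_mem_target hz) (x := x) (by rwa [symm_baseCoord hz]),
    chartTrans_baseCoord hz]
  rfl

theorem frameCoord_center (z : Z) : frameCoord (u z).1 u z = coframe (u z) := by
  rw [frameCoord, baseCoord, frameMap_center]
  rfl

theorem contDiffAt_frameCoord_center {z : Z} (hu : ContMDiffAt 𝓘(ℝ, Z) homModel ∞ u z) :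
    ContDiffAt ℝ ∞ (frameCoord (u z).1 u) z := by
  rw [← contMDiffAt_iff_contDiffAt]
  refine ((contMDiffAt_hom_bundle u).1 hu).2.congr_of_eventuallyEq ?_
  filter_upwards [eventually_mem_source hu (mem_extChartAt_source _)] with z' h
  exact (inCoordinates_eq _ _ h).symm

theorem contDiffAt_frameCoord {x₀ : M} {z : Z} (hu : ContMDiffAt 𝓘(ℝ, Z) homModel ∞ u z)
    (hz : (u z).1 ∈ (extChartAt (𝓡 7) x₀).source) : ContDiffAt ℝ ∞ (frameCoord x₀ u) z := by
  have h1 : ContDiffAt ℝ ∞ (fderiv ℝ (chartTrans (𝓡 7) x₀ (u z).1)) (baseCoord x₀ u z) :=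
    (contDiffAt_chartTrans (baseCoord_mem_target hz)
      (by rw [symm_baseCoord hz]; exact mem_extChartAt_source _)).fderiv_right (by simp)
  refine ((contDiffAt_frameCoord_center hu).clm_comp
    (h1.comp z (contDiffAt_baseCoord hu hz))).congr_of_eventuallyEq ?_
  filter_upwards [eventually_mem_source hu hz,
    eventually_mem_source hu (mem_extChartAt_source _)] with z' h h'
  exact frameCoord_chartTrans h h'

theorem mfderiv_proj {z : Z} (hu : ContMDiffAt 𝓘(ℝ, Z) homModel ∞ u z) (ξ : Z) :
    (show V7 from mfderiv 𝓘(ℝ, Z) (𝓡 7) (fun z => (u z).1) z ξ) =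
      fderiv ℝ (baseCoord (u z).1 u) z ξ := by
  rw [((contMDiffAt_proj hu).mdifferentiableAt (by simp)).mfderiv]
  simp only [writtenInExtChartAt, mfld_simps, fderivWithin_univ]
  rfl

theorem mfderiv_homTotal {z : Z} (hu : ContMDiffAt 𝓘(ℝ, Z) homModel ∞ u z) (ξ : Z) :
    (show V7 × (V7 →L[ℝ] V7) from mfderiv 𝓘(ℝ, Z) homModel u z ξ) =
      (fderiv ℝ (baseCoord (u z).1 u) z ξ, fderiv ℝ (frameCoord (u z).1 u) z ξ) := by
  have h1 : writtenInExtChartAt 𝓘(ℝ, Z) homModel z u =ᶠ[𝓝 z]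
      fun z' => (baseCoord (u z).1 u z', frameCoord (u z).1 u z') := by
    filter_upwards [eventually_mem_source hu (mem_extChartAt_source _)] with z' h
    simp only [writtenInExtChartAt, mfld_simps]
    exact extChartAt_homTotal _ _ h
  have h2 := ((contDiffAt_baseCoord hu (mem_extChartAt_source _)).differentiableAt
    (by simp)).hasFDerivAt.prodMk ((contDiffAt_frameCoord_center hu).differentiableAt
    (by simp)).hasFDerivAt
  rw [(hu.mdifferentiableAt (by simp)).mfderiv]
  have h3 := (h2.congr_of_eventuallyEq h1).fderiv
  have h4 : fderivWithin ℝ (writtenInExtChartAt 𝓘(ℝ, Z) homModel z u) (range 𝓘(ℝ, Z))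
      (extChartAt 𝓘(ℝ, Z) z z) = fderiv ℝ (writtenInExtChartAt 𝓘(ℝ, Z) homModel z u) z := by
    simp only [mfld_simps, fderivWithin_univ]
    rfl
  rw [h4, h3]
  rfl

end HomBundle

/-! ### Pullbacks of the tautological form and of the connection form -/

section Pullback

set_option linter.unusedSectionVars false

variable {M : Type*} [TopologicalSpace M] [ChartedSpace V7 M] [IsManifold (𝓡 7) ∞ M]
  {k : ℕ} {u : EuclideanSpace ℝ (Fin k) → HomTotal M} {z : EuclideanSpace ℝ (Fin k)}

theorem isInvertible_of_bijective {L : V7 →L[ℝ] V7} (h : Function.Bijective L) : L.IsInvertible :=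
  ⟨(LinearEquiv.ofBijective (L : V7 →ₗ[ℝ] V7) h).toContinuousLinearEquiv, by ext v; rfl⟩

theorem frameCoord_isInvertible {x₀ : M} (hz : (u z).1 ∈ (extChartAt (𝓡 7) x₀).source)
    (he : (coframe (u z)).IsInvertible) : (frameCoord x₀ u z).IsInvertible :=
  he.comp (frameMap_isInvertible (baseCoord_mem_target hz))

theorem hasFDerivAt_baseCoord_chartTrans {x₀ x : M}
    (hu : ContMDiffAt 𝓘(ℝ, EuclideanSpace ℝ (Fin k)) homModel ∞ u z)
    (hz : (u z).1 ∈ (extChartAt (𝓡 7) x₀).source) (hx : (u z).1 ∈ (extChartAt (𝓡 7) x).source) :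
    HasFDerivAt (baseCoord x u) ((fderiv ℝ (chartTrans (𝓡 7) x₀ x) (baseCoord x₀ u z)).comp
      (fderiv ℝ (baseCoord x₀ u) z)) z := by
  have h1 := (differentiableAt_chartTrans (baseCoord_mem_target hz) (x := x)
    (by rwa [symm_baseCoord hz])).hasFDerivAt.comp z
    ((contDiffAt_baseCoord hu hz).differentiableAt (by simp)).hasFDerivAt
  refine h1.congr_of_eventuallyEq ?_
  filter_upwards [eventually_mem_source hu hz] with z' h
  exact (chartTrans_baseCoord h).symm

/-- The pullback of the tautological form along `u`, computed in the chart at `x₀`. -/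
def localTaut (x₀ : M) (u : EuclideanSpace ℝ (Fin k) → HomTotal M) (z : EuclideanSpace ℝ (Fin k)) :
    EuclideanSpace ℝ (Fin k) →L[ℝ] V7 :=
  (frameCoord x₀ u z).comp (fderiv ℝ (baseCoord x₀ u) z)

theorem localTaut_eq {x₀ x : M} (hu : ContMDiffAt 𝓘(ℝ, EuclideanSpace ℝ (Fin k)) homModel ∞ u z)
    (hz : (u z).1 ∈ (extChartAt (𝓡 7) x₀).source) (hx : (u z).1 ∈ (extChartAt (𝓡 7) x).source) :
    localTaut x₀ u z = localTaut x u z := by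
  rw [localTaut, localTaut, (hasFDerivAt_baseCoord_chartTrans hu hz hx).fderiv,
    frameCoord_chartTrans hz hx]
  rfl

theorem pullback_tautForm {x₀ : M} (hu : ContMDiffAt 𝓘(ℝ, EuclideanSpace ℝ (Fin k)) homModel ∞ u z)
    (hz : (u z).1 ∈ (extChartAt (𝓡 7) x₀).source) (i : Fin 7) :
    pullback u (tautForm i) z = (EuclideanSpace.proj i : V7 →L[ℝ] ℝ).comp (localTaut x₀ u z) := by
  rw [localTaut_eq hu hz (mem_extChartAt_source (u z).1)]
  ext1 ξ
  have h1 : mfderiv 𝓘(ℝ, EuclideanSpace ℝ (Fin k)) (𝓡 7) (fun z => (u z).1) z =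
      (mfderiv homModel (𝓡 7) (fun b' : HomTotal M => b'.1) (u z)).comp
        (mfderiv 𝓘(ℝ, EuclideanSpace ℝ (Fin k)) homModel u z) :=
    mfderiv_comp z ((contMDiff_proj (n := ∞) _).mdifferentiableAt (by simp))
      (hu.mdifferentiableAt (by simp))
  have h2 := mfderiv_proj hu ξ
  have h3 : (show V7 from mfderiv homModel (𝓡 7) (fun b' : HomTotal M => b'.1) (u z)
      (mfderiv 𝓘(ℝ, EuclideanSpace ℝ (Fin k)) homModel u z ξ)) =
      fderiv ℝ (baseCoord (u z).1 u) z ξ := by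
    rw [← h2, h1]
    rfl
  have h4 : localTaut (u z).1 u z ξ = coframe (u z) (fderiv ℝ (baseCoord (u z).1 u) z ξ) := by
    rw [localTaut, frameCoord_center]
    rfl
  exact congrArg (fun v : V7 => v i) ((congrArg (coframe (u z)) h3).trans h4.symm)

/-- The pullback of the connection form along `u`, computed in the chart at `x₀`. -/
def localConn (g : Π x : M, TangentSpace (𝓡 7) x →L[ℝ] TangentSpace (𝓡 7) x →L[ℝ] ℝ) (x₀ : M)
    (u : EuclideanSpace ℝ (Fin k) → HomTotal M) (z : EuclideanSpace ℝ (Fin k)) :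
    EuclideanSpace ℝ (Fin k) →L[ℝ] V7 →L[ℝ] V7 :=
  frameConn (chartChr (𝓡 7) g x₀) (baseCoord x₀ u) (frameCoord x₀ u) z

variable {g : Π x : M, TangentSpace (𝓡 7) x →L[ℝ] TangentSpace (𝓡 7) x →L[ℝ] ℝ}

theorem localConn_eq (hg : SmoothMetric (𝓡 7) g) {x₀ x : M}
    (hu : ContMDiffAt 𝓘(ℝ, EuclideanSpace ℝ (Fin k)) homModel ∞ u z)
    (he : (coframe (u z)).IsInvertible)
    (hz : (u z).1 ∈ (extChartAt (𝓡 7) x₀).source) (hx : (u z).1 ∈ (extChartAt (𝓡 7) x).source) :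
    localConn g x₀ u z = localConn g x u z := by
  have hy := baseCoord_mem_target hz
  have hyx : (extChartAt (𝓡 7) x₀).symm (baseCoord x₀ u z) ∈ (extChartAt (𝓡 7) x).source := by
    rwa [symm_baseCoord hz]
  have hτ := contDiffAt_chartTrans hy hyx
  refine frameConn_transform (τ := chartTrans (𝓡 7) x₀ x) (T := fderiv ℝ (chartTrans (𝓡 7) x₀ x))
    (hasFDerivAt_baseCoord_chartTrans hu hz hx) (chartTrans_baseCoord hz).symm ?_
    ((contDiffAt_baseCoord hu hz).differentiableAt (by simp))
    ((hτ.fderiv_right (m := 1) (by norm_cast)).differentiableAt (by simp)).hasFDerivAt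
    (fderiv_chartTrans_isInvertible hy hyx) (frameCoord_isInvertible hx he)
    ((contDiffAt_frameCoord hu hz).differentiableAt (by simp))
    ((contDiffAt_frameCoord hu hx).differentiableAt (by simp))
    (fun v w => hg.chr_transform hy hyx v w)
  filter_upwards [eventually_mem_source hu hz, eventually_mem_source hu hx] with z' h h' v
  rw [frameCoord_chartTrans h h']
  rfl

/-- The definition of `connForm` uses at each point the chart centered there; by the invariance of
`frameConn`, one chart computes the pullback at all nearby points. -/
theorem pullback_connForm (hg : SmoothMetric (𝓡 7) g) {x₀ : M}
    (hu : ContMDiffAt 𝓘(ℝ, EuclideanSpace ℝ (Fin k)) homModel ∞ u z)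
    (he : (coframe (u z)).IsInvertible)
    (hz : (u z).1 ∈ (extChartAt (𝓡 7) x₀).source) (i j : Fin 7) :
    pullback u (connForm g i j) z =
      (EuclideanSpace.proj i : V7 →L[ℝ] ℝ).comp ((localConn g x₀ u z).flip (bas j)) := by
  rw [localConn_eq hg hu he hz (mem_extChartAt_source (u z).1)]
  ext1 ξ
  have h := mfderiv_homTotal hu ξ
  have h1 : ∀ p q : V7 × (V7 →L[ℝ] V7), p = q →
      (-((EuclideanSpace.proj i : V7 →L[ℝ] ℝ).comp
      ((ContinuousLinearMap.apply ℝ V7 ((coframe (u z)).inverse (bas j))).comp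
        (ContinuousLinearMap.snd ℝ V7 (V7 →L[ℝ] V7)) -
        (coframe (u z)).comp (((christoffel (𝓡 7) g (u z).1).flip ((coframe (u z)).inverse (bas j))).comp
          (ContinuousLinearMap.fst ℝ V7 (V7 →L[ℝ] V7)))))) p =
      -(q.2 ((coframe (u z)).inverse (bas j)) - coframe (u z)
        (christoffel (𝓡 7) g (u z).1 q.1 ((coframe (u z)).inverse (bas j)))) i := by
    rintro p q rfl
    rfl
  refine (h1 _ _ h).trans ?_
  rw [ContinuousLinearMap.comp_apply, ContinuousLinearMap.flip_apply, localConn, frameConn_apply,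
    frameDer_apply, frameCoord_center]
  rfl

end Pullback

/-! ### Structure equations of the Levi-Civita connection on coframes -/

section StructureEquations

set_option linter.unusedSectionVars false

variable {M : Type*} [TopologicalSpace M] [ChartedSpace V7 M] [IsManifold (𝓡 7) ∞ M]
  {k : ℕ} {u : EuclideanSpace ℝ (Fin k) → HomTotal M} {z : EuclideanSpace ℝ (Fin k)}
  {g : Π x : M, TangentSpace (𝓡 7) x →L[ℝ] TangentSpace (𝓡 7) x →L[ℝ] ℝ}

theorem curv_sum {E : Type*} [NormedAddCommGroup E] [NormedSpace ℝ E] {ι : Type*} [Fintype ι]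
    (Γ : E → E →L[ℝ] E →L[ℝ] E) (y : E) (a b : ι → ℝ) (f : ι → E) (w : E) :
    curv Γ y (∑ k, a k • f k) (∑ l, b l • f l) w =
      ∑ k, ∑ l, (a k * b l) • curv Γ y (f k) (f l) w := by
  let B : E →ₗ[ℝ] E →ₗ[ℝ] E := LinearMap.mk₂ ℝ (fun u v => curv Γ y u v w)
    (by intro m m' n; simp [curv]; abel)
    (by intro c m n; simp [curv, smul_sub, smul_add])
    (by intro m n n'; simp [curv]; abel)
    (by intro c m n; simp [curv, smul_sub, smul_add])
  have h : B (∑ k, a k • f k) (∑ l, b l • f l) = ∑ k, ∑ l, (a k * b l) • B (f k) (f l) := by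
    simp only [map_sum, map_smul, LinearMap.sum_apply, LinearMap.smul_apply, Finset.smul_sum,
      smul_smul]
    rw [Finset.sum_comm]
    simp only [mul_comm]
  exact h

/-- The curvature `e R(e⁻¹ a, e⁻¹ b) e⁻¹ c` in the coframes `u z`, computed in the chart at `x₀`. -/
def localCurv (g : Π x : M, TangentSpace (𝓡 7) x →L[ℝ] TangentSpace (𝓡 7) x →L[ℝ] ℝ) (x₀ : M)
    (u : EuclideanSpace ℝ (Fin k) → HomTotal M) (z : EuclideanSpace ℝ (Fin k)) (a b c : V7) : V7 :=
  frameCoord x₀ u z (curv (chartChr (𝓡 7) g x₀) (baseCoord x₀ u z) ((frameCoord x₀ u z).inverse a)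
    ((frameCoord x₀ u z).inverse b) ((frameCoord x₀ u z).inverse c))

/-- The curvature `e R(e⁻¹ a, e⁻¹ b) e⁻¹ c` in the coframe `e` of the point `p`. -/
def frameCurv (g : Π x : M, TangentSpace (𝓡 7) x →L[ℝ] TangentSpace (𝓡 7) x →L[ℝ] ℝ)
    (p : HomTotal M) (a b c : V7) : V7 :=
  coframe p (curv (chartChr (𝓡 7) g p.1) (extChartAt (𝓡 7) p.1 p.1) ((coframe p).inverse a)
    ((coframe p).inverse b) ((coframe p).inverse c))

theorem localCurv_center (a b c : V7) : localCurv g (u z).1 u z a b c = frameCurv g (u z) a b c := by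
  rw [localCurv, frameCoord_center]
  rfl

theorem localCurv_eq (hg : SmoothMetric (𝓡 7) g) {x₀ : M} (he : (coframe (u z)).IsInvertible)
    (hz : (u z).1 ∈ (extChartAt (𝓡 7) x₀).source) (a b c : V7) :
    localCurv g x₀ u z a b c = frameCurv g (u z) a b c := by
  rw [← localCurv_center]
  have hx := mem_extChartAt_source (I := 𝓡 7) (u z).1
  have hy := baseCoord_mem_target hz
  have hyx : (extChartAt (𝓡 7) x₀).symm (baseCoord x₀ u z) ∈ (extChartAt (𝓡 7) (u z).1).source := by
    rwa [symm_baseCoord hz]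
  have h0 := frameCoord_isInvertible hz he
  have h1 := frameCoord_isInvertible hx he
  have h2 : ∀ v, frameCoord x₀ u z v = frameCoord (u z).1 u z
      (fderiv ℝ (chartTrans (𝓡 7) x₀ (u z).1) (baseCoord x₀ u z) v) :=
    fun v => DFunLike.congr_fun (frameCoord_chartTrans hz hx) v
  have h3 : ∀ a, fderiv ℝ (chartTrans (𝓡 7) x₀ (u z).1) (baseCoord x₀ u z)
      ((frameCoord x₀ u z).inverse a) = (frameCoord (u z).1 u z).inverse a := by
    intro a
    rw [← inverse_apply_self h1 (fderiv ℝ _ _ _), ← h2, apply_inverse_self h0]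
  rw [localCurv, h2, hg.curv_chartTrans hy hyx, h3, h3, h3, chartTrans_baseCoord hz]
  rfl

theorem contDiffAt_localCurv (hg : SmoothMetric (𝓡 7) g) {x₀ : M}
    (hu : ContMDiffAt 𝓘(ℝ, EuclideanSpace ℝ (Fin k)) homModel ∞ u z)
    (he : (coframe (u z)).IsInvertible)
    (hz : (u z).1 ∈ (extChartAt (𝓡 7) x₀).source) (a b c : V7) :
    ContDiffAt ℝ ∞ (fun z => localCurv g x₀ u z a b c) z := by
  have hX := contDiffAt_baseCoord hu hz
  have hE := contDiffAt_frameCoord hu hz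
  have hI : ContDiffAt ℝ ∞ (fun z => (frameCoord x₀ u z).inverse) z := by
    obtain ⟨L, hL⟩ := frameCoord_isInvertible hz he
    have := contDiffAt_map_inverse (n := ∞) L
    rw [hL] at this
    exact this.comp z hE
  have hΓ : ContDiffAt ℝ ∞ (chartChr (𝓡 7) g x₀) (baseCoord x₀ u z) :=
    (hg.contDiffOn_chr x₀).contDiffAt
      ((isOpen_extChartAt_target x₀).mem_nhds (baseCoord_mem_target hz))
  have hΓ1 := hΓ.comp z hX
  have hΓ2 := (hΓ.fderiv_right (m := ∞) (by simp)).comp z hX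
  have ha : ∀ a, ContDiffAt ℝ ∞ (fun z => (frameCoord x₀ u z).inverse a) z :=
    fun a => hI.clm_apply contDiffAt_const
  exact hE.clm_apply ((((((hΓ2.clm_apply (ha a)).clm_apply (ha b)).clm_apply (ha c)).sub
    (((hΓ2.clm_apply (ha b)).clm_apply (ha a)).clm_apply (ha c))).add
    ((hΓ1.clm_apply (ha a)).clm_apply ((hΓ1.clm_apply (ha b)).clm_apply (ha c)))).sub
    ((hΓ1.clm_apply (ha b)).clm_apply ((hΓ1.clm_apply (ha a)).clm_apply (ha c))))

/-- The exterior derivative of a `1`-form on a vector space, evaluated on two vectors. -/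
def dOne {Z : Type*} [NormedAddCommGroup Z] [NormedSpace ℝ Z] (a : Z → Z →L[ℝ] ℝ) (z v w : Z) : ℝ :=
  fderiv ℝ a z v w - fderiv ℝ a z w v

theorem extDeriv_ofSubsingleton {Z : Type*} [NormedAddCommGroup Z] [NormedSpace ℝ Z]
    {a : Z → Z →L[ℝ] ℝ} {z : Z} (ha : DifferentiableAt ℝ a z) (v w : Z) :
    extDeriv (fun z' => ContinuousAlternatingMap.ofSubsingleton ℝ Z ℝ (0 : Fin 1) (a z')) z ![v, w] =
      dOne a z v w := by
  have h : DifferentiableAt ℝ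
      (fun z' => ContinuousAlternatingMap.ofSubsingleton ℝ Z ℝ (0 : Fin 1) (a z')) z :=
    ((ContinuousAlternatingMap.ofSubsingletonLIE (𝕜 := ℝ) (E := Z) (F := ℝ)
      (0 : Fin 1)).toContinuousLinearEquiv.differentiableAt (x := a z)).comp z ha
  have h2 : ∀ w, fderiv ℝ (fun z' => a z' w) z = (fderiv ℝ a z).flip w := by
    intro w
    have h3 : HasFDerivAt (fun z' => a z' w) _ z := ha.hasFDerivAt.clm_apply (hasFDerivAt_const w z)
    rw [h3.fderiv]
    simp
  rw [extDeriv_apply h]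
  simp [Fin.sum_univ_two, dOne, Fin.removeNth, h2, sub_eq_add_neg]

variable {U : Set (EuclideanSpace ℝ (Fin k))}

theorem contDiffAt_localTaut {x₀ : M}
    (hu : ContMDiffAt 𝓘(ℝ, EuclideanSpace ℝ (Fin k)) homModel ∞ u z)
    (hz : (u z).1 ∈ (extChartAt (𝓡 7) x₀).source) : ContDiffAt ℝ ∞ (localTaut x₀ u) z :=
  (contDiffAt_frameCoord hu hz).clm_comp ((contDiffAt_baseCoord hu hz).fderiv_right (by simp))

theorem contDiffAt_localConn (hg : SmoothMetric (𝓡 7) g) {x₀ : M}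
    (hu : ContMDiffAt 𝓘(ℝ, EuclideanSpace ℝ (Fin k)) homModel ∞ u z)
    (he : (coframe (u z)).IsInvertible)
    (hz : (u z).1 ∈ (extChartAt (𝓡 7) x₀).source) : ContDiffAt ℝ ∞ (localConn g x₀ u) z := by
  have hX := contDiffAt_baseCoord hu hz
  have hE := contDiffAt_frameCoord hu hz
  have hI : ContDiffAt ℝ ∞ (fun z => (frameCoord x₀ u z).inverse) z := by
    obtain ⟨L, hL⟩ := frameCoord_isInvertible hz he
    have := contDiffAt_map_inverse (n := ∞) L
    rw [hL] at this
    exact this.comp z hE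
  have hΓ : ContDiffAt ℝ ∞ (chartChr (𝓡 7) g x₀) (baseCoord x₀ u z) :=
    (hg.contDiffOn_chr x₀).contDiffAt
      ((isOpen_extChartAt_target x₀).mem_nhds (baseCoord_mem_target hz))
  have h2 : ContDiffAt ℝ ∞ (frameDer (chartChr (𝓡 7) g x₀) (baseCoord x₀ u) (frameCoord x₀ u)) z :=
    (hE.fderiv_right (by simp)).sub (((ContinuousLinearMap.compL ℝ V7 V7 V7).contDiff.contDiffAt.comp z
      hE).clm_comp ((hΓ.comp z hX).clm_comp (hX.fderiv_right (by simp))))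
  exact ((((ContinuousLinearMap.compL ℝ V7 V7 V7).flip).contDiff.contDiffAt.comp z hI).neg).clm_comp h2

variable (hU : IsOpen U) (hu : ContMDiffOn 𝓘(ℝ, EuclideanSpace ℝ (Fin k)) homModel ∞ u U)

include hU hu

theorem pullback_tautForm_eventuallyEq (hz : z ∈ U) (i : Fin 7) :
    pullback u (tautForm i) =ᶠ[𝓝 z]
      fun z' => (EuclideanSpace.proj i : V7 →L[ℝ] ℝ).comp (localTaut (u z).1 u z') := by
  have hu' : ∀ z ∈ U, ContMDiffAt 𝓘(ℝ, EuclideanSpace ℝ (Fin k)) homModel ∞ u z :=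
    fun z hz => hu.contMDiffAt (hU.mem_nhds hz)
  filter_upwards [hU.mem_nhds hz, eventually_mem_source (hu' z hz) (mem_extChartAt_source _)]
    with z' h h'
  exact pullback_tautForm (hu' z' h) h' i

theorem pullback_connForm_eventuallyEq (hg : SmoothMetric (𝓡 7) g)
    (he : ∀ z ∈ U, (coframe (u z)).IsInvertible) (hz : z ∈ U) (i j : Fin 7) :
    pullback u (connForm g i j) =ᶠ[𝓝 z] fun z' =>
      (EuclideanSpace.proj i : V7 →L[ℝ] ℝ).comp ((localConn g (u z).1 u z').flip (bas j)) := by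
  have hu' : ∀ z ∈ U, ContMDiffAt 𝓘(ℝ, EuclideanSpace ℝ (Fin k)) homModel ∞ u z :=
    fun z hz => hu.contMDiffAt (hU.mem_nhds hz)
  filter_upwards [hU.mem_nhds hz, eventually_mem_source (hu' z hz) (mem_extChartAt_source _)]
    with z' h h'
  exact pullback_connForm hg (hu' z' h) (he z' h) h' i j

theorem contDiffAt_pullback_tautForm (hz : z ∈ U) (i : Fin 7) :
    ContDiffAt ℝ ∞ (pullback u (tautForm i)) z :=
  (contDiffAt_const.clm_comp (contDiffAt_localTaut (hu.contMDiffAt (hU.mem_nhds hz))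
    (mem_extChartAt_source _))).congr_of_eventuallyEq (pullback_tautForm_eventuallyEq hU hu hz i)

theorem contDiffAt_pullback_connForm (hg : SmoothMetric (𝓡 7) g)
    (he : ∀ z ∈ U, (coframe (u z)).IsInvertible) (hz : z ∈ U) (i j : Fin 7) :
    ContDiffAt ℝ ∞ (pullback u (connForm g i j)) z := by
  refine ContDiffAt.congr_of_eventuallyEq ?_ (pullback_connForm_eventuallyEq hU hu hg he hz i j)
  refine contDiffAt_const.clm_comp ?_
  have h1 : ContDiffAt ℝ ∞ (fun z' => (localConn g (u z).1 u z').flip) z :=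
    (ContinuousLinearMap.flipₗᵢ ℝ (EuclideanSpace ℝ (Fin k)) V7 V7).contDiff.contDiffAt.comp z
      (contDiffAt_localConn hg (hu.contMDiffAt (hU.mem_nhds hz)) (he z hz) (mem_extChartAt_source _))
  exact h1.clm_apply contDiffAt_const

theorem contDiffAt_frameCurv (hg : SmoothMetric (𝓡 7) g)
    (he : ∀ z ∈ U, (coframe (u z)).IsInvertible) (hz : z ∈ U) (a b c : V7) :
    ContDiffAt ℝ ∞ (fun z => frameCurv g (u z) a b c) z := by
  refine (contDiffAt_localCurv hg (x₀ := (u z).1) (hu.contMDiffAt (hU.mem_nhds hz)) (he z hz)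
    (mem_extChartAt_source _) a b c).congr_of_eventuallyEq ?_
  filter_upwards [hU.mem_nhds hz, eventually_mem_source (hu.contMDiffAt (hU.mem_nhds hz))
    (mem_extChartAt_source _)] with z' h h'
  exact (localCurv_eq hg (he z' h) h' a b c).symm

/-- The equation `dωᵢ = - ∑ⱼ ψᵢⱼ ∧ ωⱼ`, pulled back along `u`. -/
theorem dOne_pullback_tautForm (hg : SmoothMetric (𝓡 7) g)
    (he : ∀ z ∈ U, (coframe (u z)).IsInvertible) (hz : z ∈ U) (i : Fin 7)
    (v w : EuclideanSpace ℝ (Fin k)) :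
    dOne (pullback u (tautForm i)) z v w =
      -∑ j, (pullback u (connForm g i j) z v * pullback u (tautForm j) z w -
        pullback u (connForm g i j) z w * pullback u (tautForm j) z v) := by
  have huz := hu.contMDiffAt (hU.mem_nhds hz)
  have hs := mem_extChartAt_source (I := 𝓡 7) (u z).1
  have hT := (contDiffAt_localTaut huz hs).differentiableAt (by simp)
  have h1 : ∀ v w, fderiv ℝ (pullback u (tautForm i)) z v w =
      (fderiv ℝ (localTaut (u z).1 u) z v w) i := by
    intro v w
    have h2 := ((hasFDerivAt_const (EuclideanSpace.proj i : V7 →L[ℝ] ℝ) z).clm_comp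
      hT.hasFDerivAt).congr_of_eventuallyEq (pullback_tautForm_eventuallyEq hU hu hz i)
    rw [h2.fderiv]
    simp
  have h3 := frame_torsion (Γ := chartChr (𝓡 7) g (u z).1)
    (frameCoord_isInvertible hs (he z hz))
    ((contDiffAt_baseCoord huz hs).of_le (by norm_cast))
    ((contDiffAt_frameCoord huz hs).differentiableAt (by simp))
    (fun v w => hg.chr_symm (baseCoord_mem_target hs) v w) v w
  have h4 : ∀ v, localTaut (u z).1 u z v = ∑ j, pullback u (tautForm j) z v • bas j := by
    intro v
    rw [← sum_smul_bas (localTaut (u z).1 u z v)]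
    refine Finset.sum_congr rfl fun j _ => ?_
    rw [pullback_tautForm huz hs]
    rfl
  have h5 : ∀ v j, (localConn g (u z).1 u z v (bas j)) i = pullback u (connForm g i j) z v := by
    intro v j
    rw [pullback_connForm hg huz (he z hz) hs]
    rfl
  have h6 : ∀ v w, (localConn g (u z).1 u z v (localTaut (u z).1 u z w)) i =
      ∑ j, pullback u (connForm g i j) z v * pullback u (tautForm j) z w := by
    intro v w
    rw [h4, map_sum, WithLp.ofLp_sum, Finset.sum_apply]
    refine Finset.sum_congr rfl fun j _ => ?_
    rw [map_smul, PiLp.smul_apply, h5, smul_eq_mul, mul_comm]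
  rw [dOne, h1, h1, ← PiLp.sub_apply]
  refine (congrArg (fun v : V7 => v i) h3).trans ?_
  rw [Finset.sum_sub_distrib, ← h6, ← h6]
  rfl

/-- The equation `dψᵢⱼ = - ∑ₗ ψᵢₗ ∧ ψₗⱼ + Rᵢⱼ`, pulled back along `u`, with `Rᵢⱼ` the curvature in
the coframes. -/
theorem dOne_pullback_connForm (hg : SmoothMetric (𝓡 7) g)
    (he : ∀ z ∈ U, (coframe (u z)).IsInvertible) (hz : z ∈ U) (i j : Fin 7)
    (v w : EuclideanSpace ℝ (Fin k)) :
    dOne (pullback u (connForm g i j)) z v w =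
      -∑ l, (pullback u (connForm g i l) z v * pullback u (connForm g l j) z w -
        pullback u (connForm g i l) z w * pullback u (connForm g l j) z v) +
      ∑ l, ∑ m, pullback u (tautForm l) z v * pullback u (tautForm m) z w *
        frameCurv g (u z) (bas l) (bas m) (bas j) i := by
  have huz := hu.contMDiffAt (hU.mem_nhds hz)
  have hs := mem_extChartAt_source (I := 𝓡 7) (u z).1
  have hi := frameCoord_isInvertible hs (he z hz)
  have hT := (contDiffAt_localConn hg huz (he z hz) hs).differentiableAt (by simp)
  have h1 : ∀ v w, fderiv ℝ (pullback u (connForm g i j)) z v w =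
      (fderiv ℝ (localConn g (u z).1 u) z v w (bas j)) i := by
    intro v w
    have h2 := (contDiffAt_pullback_connForm hU hu hg he hz i j).differentiableAt (by simp)
    have h3 : HasFDerivAt (fun z' => pullback u (connForm g i j) z' w) _ z :=
      h2.hasFDerivAt.clm_apply (hasFDerivAt_const w z)
    have h4 : HasFDerivAt (fun z' => (EuclideanSpace.proj i : V7 →L[ℝ] ℝ)
      (localConn g (u z).1 u z' w (bas j))) _ z :=
      (EuclideanSpace.proj i : V7 →L[ℝ] ℝ).hasFDerivAt.comp z
        ((hT.hasFDerivAt.clm_apply (hasFDerivAt_const w z)).clm_apply (hasFDerivAt_const (bas j) z))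
    have h5 := DFunLike.congr_fun (h3.unique (h4.congr_of_eventuallyEq
      ((pullback_connForm_eventuallyEq hU hu hg he hz i j).mono fun z' h =>
        DFunLike.congr_fun h w))) v
    simpa using h5
  have h3 := frame_curvature (Γ := chartChr (𝓡 7) g (u z).1) hi
    ((contDiffAt_baseCoord huz hs).of_le (by norm_cast))
    ((contDiffAt_frameCoord huz hs).of_le (by norm_cast))
    (hg.differentiableAt_chr (baseCoord_mem_target hs)) hT v w
    ((frameCoord (u z).1 u z).inverse (bas j))
  rw [apply_inverse_self hi] at h3
  have h5 : ∀ v l j, (localConn g (u z).1 u z v (bas j)) l = pullback u (connForm g l j) z v := by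
    intro v l j
    rw [pullback_connForm hg huz (he z hz) hs]
    rfl
  have h6 : ∀ v w, (localConn g (u z).1 u z v (localConn g (u z).1 u z w (bas j))) i =
      ∑ l, pullback u (connForm g i l) z v * pullback u (connForm g l j) z w := by
    intro v w
    rw [← sum_smul_bas (localConn g (u z).1 u z w (bas j)), map_sum, WithLp.ofLp_sum,
      Finset.sum_apply]
    refine Finset.sum_congr rfl fun l _ => ?_
    rw [map_smul, PiLp.smul_apply, h5, h5, smul_eq_mul, mul_comm]
  have h7 : ∀ v, fderiv ℝ (baseCoord (u z).1 u) z v =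
      ∑ l, pullback u (tautForm l) z v • (frameCoord (u z).1 u z).inverse (bas l) := by
    intro v
    rw [← inverse_apply_self hi (fderiv ℝ (baseCoord (u z).1 u) z v),
      ← sum_smul_bas (frameCoord (u z).1 u z (fderiv ℝ (baseCoord (u z).1 u) z v)), map_sum]
    refine Finset.sum_congr rfl fun l _ => ?_
    rw [map_smul, pullback_tautForm huz hs]
    rfl
  rw [h7 v, h7 w, curv_sum, map_sum] at h3
  simp only [map_sum, map_smul] at h3
  have h8 : ∀ l m, frameCoord (u z).1 u z (curv (chartChr (𝓡 7) g (u z).1) (baseCoord (u z).1 u z)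
      ((frameCoord (u z).1 u z).inverse (bas l)) ((frameCoord (u z).1 u z).inverse (bas m))
      ((frameCoord (u z).1 u z).inverse (bas j))) =
      frameCurv g (u z) (bas l) (bas m) (bas j) :=
    fun l m => localCurv_center (bas l) (bas m) (bas j)
  simp only [h8] at h3
  have h9 := congrArg (fun v : V7 => v i) h3
  have h10 : (∑ l, ∑ m, (pullback u (tautForm l) z v * pullback u (tautForm m) z w) •
      frameCurv g (u z) (bas l) (bas m) (bas j)) i =
      ∑ l, ∑ m, pullback u (tautForm l) z v * pullback u (tautForm m) z w *
        frameCurv g (u z) (bas l) (bas m) (bas j) i := by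
    simp
  rw [dOne, h1, h1, ← h10, Finset.sum_sub_distrib, ← h6, ← h6]
  refine Eq.trans ?_ (congrArg (fun t : ℝ => -((localConn g (u z).1 u z v (localConn g (u z).1 u z w (bas j))) i -
    (localConn g (u z).1 u z w (localConn g (u z).1 u z v (bas j))) i) + t) h9)
  change _ = _ + (((fderiv ℝ (localConn g (u z).1 u) z v w (bas j)) i -
    (fderiv ℝ (localConn g (u z).1 u) z w v (bas j)) i) + ((localConn g (u z).1 u z v (localConn g (u z).1 u z w (bas j))) i -
    (localConn g (u z).1 u z w (localConn g (u z).1 u z v (bas j))) i))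
  ring

end StructureEquations

/-! ### Covariant derivatives of tensor fields in charts -/

section Multilinear

variable {n : ℕ}

/-- The monomial `w ↦ ∏ i, w i (k i)`, as a continuous multilinear map. -/
def cmmBasis (k : Fin n → Fin 7) : ContinuousMultilinearMap ℝ (fun _ : Fin n => V7) ℝ :=
  (ContinuousMultilinearMap.mkPiAlgebra ℝ (Fin n) ℝ).compContinuousLinearMap
    fun i => EuclideanSpace.proj (k i)

theorem cmmBasis_apply (k : Fin n → Fin 7) (w : Fin n → V7) : cmmBasis k w = ∏ i, w i (k i) := rfl

theorem multilinear_eq_sum (f : MultilinearMap ℝ (fun _ : Fin n => V7) ℝ) (w : Fin n → V7) :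
    f w = ∑ k : Fin n → Fin 7, (∏ i, w i (k i)) * f fun i => bas (k i) := by
  conv_lhs => rw [show w = fun i => ∑ m, w i m • bas m from funext fun i => (sum_smul_bas (w i)).symm]
  rw [MultilinearMap.map_sum]
  refine Finset.sum_congr rfl fun k _ => ?_
  rw [MultilinearMap.map_smul_univ, smul_eq_mul]

/-- A multilinear map on `ℝ⁷`, as a continuous multilinear map. -/
def toCMM (f : MultilinearMap ℝ (fun _ : Fin n => V7) ℝ) :
    ContinuousMultilinearMap ℝ (fun _ : Fin n => V7) ℝ :=
  ∑ k : Fin n → Fin 7, (f fun i => bas (k i)) • cmmBasis k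

theorem toCMM_apply (f : MultilinearMap ℝ (fun _ : Fin n => V7) ℝ) (w : Fin n → V7) :
    toCMM f w = f w := by
  rw [multilinear_eq_sum f w, toCMM, sum_apply]
  refine Finset.sum_congr rfl fun k _ => ?_
  rw [smul_apply, cmmBasis_apply, smul_eq_mul, mul_comm]

/-- In finite dimension a family of multilinear maps is differentiable if its values are. -/
theorem differentiableAt_cmm {E : Type*} [NormedAddCommGroup E] [NormedSpace ℝ E]
    {T : E → ContinuousMultilinearMap ℝ (fun _ : Fin n => V7) ℝ} {y : E}
    (h : ∀ w, DifferentiableAt ℝ (fun y => T y w) y) : DifferentiableAt ℝ T y := by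
  have : T = fun y => ∑ k : Fin n → Fin 7, (T y fun i => bas (k i)) • cmmBasis k := by
    funext y
    ext w
    rw [sum_apply]
    refine (multilinear_eq_sum (T y).toMultilinearMap w).trans ?_
    refine Finset.sum_congr rfl fun k _ => ?_
    rw [smul_apply, cmmBasis_apply, smul_eq_mul, mul_comm]
    rfl
  rw [this]
  exact DifferentiableAt.fun_sum fun k _ => (h _).smul_const _

/-- The Leibniz rule for the evaluation of a family of multilinear maps on moving vectors. -/
theorem hasFDerivAt_cmm_apply {E : Type*} [NormedAddCommGroup E] [NormedSpace ℝ E]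
    {T : E → ContinuousMultilinearMap ℝ (fun _ : Fin n => V7) ℝ} {y : E}
    (h : DifferentiableAt ℝ T y) {W : Fin n → E → V7} {W' : Fin n → E →L[ℝ] V7}
    (hW : ∀ i, HasFDerivAt (W i) (W' i) y) :
    DifferentiableAt ℝ (fun y => T y fun i => W i y) y ∧ ∀ v,
      fderiv ℝ (fun y => T y fun i => W i y) y v = fderiv ℝ (fun y' => T y' fun i => W i y) y v +
        ∑ i, T y (Function.update (fun i => W i y) i (W' i v)) := by
  have h1 := h.hasFDerivAt.continuousMultilinearMap_apply hW
  have h2 := h.hasFDerivAt.continuousMultilinearMap_apply (g := fun i _ => W i y)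
    (g' := fun i => 0) fun i => hasFDerivAt_const (W i y) y
  refine ⟨h1.differentiableAt, fun v => ?_⟩
  rw [h1.fderiv, h2.fderiv]
  simp

end Multilinear

section Transfer

set_option linter.unusedSectionVars false

variable {M : Type*} [TopologicalSpace M] [ChartedSpace V7 M] [IsManifold (𝓡 7) ∞ M] {n : ℕ}
  {g : Π x : M, TangentSpace (𝓡 7) x →L[ℝ] TangentSpace (𝓡 7) x →L[ℝ] ℝ}

/-- A covariant tensor field in the chart at `x₀`. -/
def tensorChart (T : M → ContinuousMultilinearMap ℝ (fun _ : Fin n => V7) ℝ) (x₀ : M) (y : V7) :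
    ContinuousMultilinearMap ℝ (fun _ : Fin n => V7) ℝ :=
  (T ((extChartAt (𝓡 7) x₀).symm y)).compContinuousLinearMap fun _ => frameMap (𝓡 7) x₀ y

theorem tensorChart_apply (T : M → ContinuousMultilinearMap ℝ (fun _ : Fin n => V7) ℝ) (x₀ : M)
    (y : V7) (w : Fin n → V7) : tensorChart T x₀ y w =
      T ((extChartAt (𝓡 7) x₀).symm y) fun i => frameMap (𝓡 7) x₀ y (w i) := rfl

theorem tensorChart_center (T : M → ContinuousMultilinearMap ℝ (fun _ : Fin n => V7) ℝ) (x : M)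
    (w : Fin n → V7) : tensorChart T x (extChartAt (𝓡 7) x x) w = T x w := by
  rw [tensorChart_apply, frameMap_center, extChartAt_to_inv]
  rfl

theorem tensorChart_chartTrans (T : M → ContinuousMultilinearMap ℝ (fun _ : Fin n => V7) ℝ)
    {x₀ x : M} {y : V7} (hy : y ∈ (extChartAt (𝓡 7) x₀).target)
    (hx : (extChartAt (𝓡 7) x₀).symm y ∈ (extChartAt (𝓡 7) x).source) (w : Fin n → V7) :
    tensorChart T x₀ y w = tensorChart T x (chartTrans (𝓡 7) x₀ x y)
      fun i => fderiv ℝ (chartTrans (𝓡 7) x₀ x) y (w i) := by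
  rw [tensorChart_apply, tensorChart_apply, symm_chartTrans hx, frameMap_comp hy hx]
  rfl

/-- In the chart at `x₀`, the tensor field `T` is differentiable at `y` with covariant derivative
`(∇ᵥ T)(w) = Q x v w`, where `x` is the point with coordinates `y`. -/
def HasCovDeriv (g : Π x : M, TangentSpace (𝓡 7) x →L[ℝ] TangentSpace (𝓡 7) x →L[ℝ] ℝ)
    (T : M → ContinuousMultilinearMap ℝ (fun _ : Fin n => V7) ℝ)
    (Q : M → V7 → (Fin n → V7) → ℝ) (x₀ : M) (y : V7) : Prop :=
  ∀ w : Fin n → V7, DifferentiableAt ℝ (fun y => tensorChart T x₀ y w) y ∧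
    ∀ v, fderiv ℝ (fun y => tensorChart T x₀ y w) y v =
      ∑ i, tensorChart T x₀ y (Function.update w i (chartChr (𝓡 7) g x₀ y v (w i))) +
        Q ((extChartAt (𝓡 7) x₀).symm y) (frameMap (𝓡 7) x₀ y v) fun i => frameMap (𝓡 7) x₀ y (w i)

/-- The covariant derivative is independent of the chart. It is thus enough to compute it at the
center of each chart, which is what `IsParallelOn` refers to, and this gives an equation on entire
charts, which can be differentiated again. -/
theorem HasCovDeriv.of_center (hg : SmoothMetric (𝓡 7) g)
    {T : M → ContinuousMultilinearMap ℝ (fun _ : Fin n => V7) ℝ} {Q : M → V7 → (Fin n → V7) → ℝ}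
    (h : ∀ x, HasCovDeriv g T Q x (extChartAt (𝓡 7) x x)) {x₀ : M} {y : V7}
    (hy : y ∈ (extChartAt (𝓡 7) x₀).target) : HasCovDeriv g T Q x₀ y := by
  intro w
  -- Compare with the chart at the point `x` with coordinates `y`, in which the derivative is
  -- known at the center.
  obtain ⟨x, hxy⟩ : ∃ x, x = (extChartAt (𝓡 7) x₀).symm y := ⟨_, rfl⟩
  have hx : (extChartAt (𝓡 7) x₀).symm y ∈ (extChartAt (𝓡 7) x).source := by
    rw [hxy]; exact mem_extChartAt_source _
  have hτy : chartTrans (𝓡 7) x₀ x y = extChartAt (𝓡 7) x x := by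
    rw [chartTrans, Function.comp_apply, ← hxy]
  have hτ := contDiffAt_chartTrans hy hx
  have hτ1 := (hτ.differentiableAt (by simp)).hasFDerivAt
  have hτ2 := ((hτ.fderiv_right (m := 1) (by norm_cast)).differentiableAt (by simp)).hasFDerivAt
  have hT : DifferentiableAt ℝ (tensorChart T x) (chartTrans (𝓡 7) x₀ x y) := by
    rw [hτy]
    exact differentiableAt_cmm fun w => (h x w).1
  have heq : (fun y => tensorChart T x₀ y w) =ᶠ[𝓝 y] fun y' =>
      tensorChart T x (chartTrans (𝓡 7) x₀ x y') fun i => fderiv ℝ (chartTrans (𝓡 7) x₀ x) y' (w i) := by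
    filter_upwards [eventually_mem_target hy, eventually_symm_mem_source hy hx] with y' h1 h2
    exact tensorChart_chartTrans T h1 h2 w
  have hD := hasFDerivAt_cmm_apply (T := fun y' => tensorChart T x (chartTrans (𝓡 7) x₀ x y'))
    (hT.comp y hτ1.differentiableAt) (fun i => hτ2.clm_apply (hasFDerivAt_const (w i) y))
  refine ⟨hD.1.congr_of_eventuallyEq heq, fun v => ?_⟩
  rw [heq.fderiv_eq, hD.2]
  have h1 : fderiv ℝ (fun y' => tensorChart T x (chartTrans (𝓡 7) x₀ x y')
      fun i => fderiv ℝ (chartTrans (𝓡 7) x₀ x) y (w i)) y v =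
      fderiv ℝ (fun y' => tensorChart T x y' fun i => fderiv ℝ (chartTrans (𝓡 7) x₀ x) y (w i))
        (extChartAt (𝓡 7) x x) (fderiv ℝ (chartTrans (𝓡 7) x₀ x) y v) := by
    have h2 := (h x fun i => fderiv ℝ (chartTrans (𝓡 7) x₀ x) y (w i)).1.hasFDerivAt
    rw [← hτy] at h2 ⊢
    have h3 := h2.comp y hτ1
    exact DFunLike.congr_fun h3.fderiv v
  rw [h1, (h x _).2]
  have hL : ∀ v, frameMap (𝓡 7) x₀ y v = fderiv ℝ (chartTrans (𝓡 7) x₀ x) y v := by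
    intro v
    rw [frameMap_comp hy hx, hτy, frameMap_center]
    rfl
  simp only [hL, ← hxy, extChartAt_to_inv, frameMap_center, ContinuousLinearMap.id_apply]
  rw [add_right_comm, ← Finset.sum_add_distrib]
  refine congrArg (· + _) (Finset.sum_congr rfl fun i _ => ?_)
  rw [tensorChart_chartTrans T hy hx]
  have h4 : (fun j => fderiv ℝ (chartTrans (𝓡 7) x₀ x) y
      (Function.update w i (chartChr (𝓡 7) g x₀ y v (w i)) j)) =
      Function.update (fun j => fderiv ℝ (chartTrans (𝓡 7) x₀ x) y (w j)) i
        (fderiv ℝ (chartTrans (𝓡 7) x₀ x) y (chartChr (𝓡 7) g x₀ y v (w i))) := by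
    funext j
    by_cases hj : j = i
    · subst hj; simp
    · simp [hj]
  rw [h4, hg.chr_transform hy hx, ContinuousMultilinearMap.map_update_add, hτy]
  simp

end Transfer

/-! ### The Ricci identity for a pair of forms coupled by the cone -/

section Explicit

theorem cmm3_linear (N : ContinuousMultilinearMap ℝ (fun _ : Fin 3 => V7) ℝ) (a b c : V7) :
    (∃ l : V7 →L[ℝ] ℝ, ∀ x, l x = N ![x, b, c]) ∧ (∃ l : V7 →L[ℝ] ℝ, ∀ x, l x = N ![a, x, c]) ∧
      ∃ l : V7 →L[ℝ] ℝ, ∀ x, l x = N ![a, b, x] := by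
  refine ⟨⟨N.toContinuousLinearMap ![a, b, c] 0, fun x => ?_⟩,
    ⟨N.toContinuousLinearMap ![a, b, c] 1, fun x => ?_⟩,
    ⟨N.toContinuousLinearMap ![a, b, c] 2, fun x => ?_⟩⟩ <;>
  · refine congrArg N ?_
    funext i
    fin_cases i <;> rfl

theorem fderiv_cmm3 {N : V7 → ContinuousMultilinearMap ℝ (fun _ : Fin 3 => V7) ℝ} {y : V7}
    (hN : DifferentiableAt ℝ N y) {A B C : V7 → V7} {A' B' C' : V7 →L[ℝ] V7}
    (hA : HasFDerivAt A A' y) (hB : HasFDerivAt B B' y) (hC : HasFDerivAt C C' y) :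
    DifferentiableAt ℝ (fun y => N y ![A y, B y, C y]) y ∧ ∀ u,
      fderiv ℝ (fun y => N y ![A y, B y, C y]) y u =
        fderiv ℝ (fun y' => N y' ![A y, B y, C y]) y u + (N y ![A' u, B y, C y] +
          N y ![A y, B' u, C y] + N y ![A y, B y, C' u]) := by
  have hv : ∀ y, (fun i => (![A, B, C] : Fin 3 → V7 → V7) i y) = ![A y, B y, C y] := by
    intro y
    funext i
    fin_cases i <;> rfl
  have h := hasFDerivAt_cmm_apply hN (W := ![A, B, C]) (W' := ![A', B', C']) (by
    intro i
    fin_cases i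
    · exact hA
    · exact hB
    · exact hC)
  simp only [hv, Fin.sum_univ_three] at h
  refine ⟨h.1, fun u => (h.2 u).trans ?_⟩
  refine congrArg₂ (· + ·) rfl (congrArg₂ (· + ·) (congrArg₂ (· + ·) ?_ ?_) ?_) <;>
  · refine congrArg (N y) ?_
    funext i
    fin_cases i <;> rfl

theorem fderiv_cmm4 {P : V7 → ContinuousMultilinearMap ℝ (fun _ : Fin 4 => V7) ℝ} {y : V7}
    (hP : DifferentiableAt ℝ P y) (a b c d : V7) :
    DifferentiableAt ℝ (fun y => P y ![a, b, c, d]) y := by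
  exact (hasFDerivAt_cmm_apply hP (W := fun i _ => ![a, b, c, d] i) (W' := fun _ => 0)
    fun i => hasFDerivAt_const _ y).1

theorem differentiableAt_dual {F : V7 → V7 →L[ℝ] ℝ} {y : V7}
    (h : ∀ v, DifferentiableAt ℝ (fun y => F y v) y) : DifferentiableAt ℝ F y := by
  have : F = fun y => ∑ m, F y (bas m) • (EuclideanSpace.proj m : V7 →L[ℝ] ℝ) := by
    funext y
    ext v
    conv_lhs => rw [← sum_smul_bas v]
    simp [mul_comm]
  rw [this]
  exact DifferentiableAt.fun_sum fun m _ => (h _).smul_const _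

/-- If a three-form `N` and a four-form `P` satisfy `∇ᵤ N = u ⌟ P` and `∇ᵤ P = - u♭ ∧ N`, then
`R(u, v) - (u ⊗ v♭ - v ⊗ u♭)` annihilates `N`: in the Ricci identity `[∇ᵤ, ∇ᵥ] N = - R(u, v) · N`,
the second covariant derivative of `N` is `- v ⌟ (u♭ ∧ N) = u♭ ∧ (v ⌟ N) - g(u, v) N`. -/
theorem curv_annihilates {s : Set V7} (hs : IsOpen s) {G : V7 → V7 →L[ℝ] V7 →L[ℝ] ℝ}
    {Γ : V7 → V7 →L[ℝ] V7 →L[ℝ] V7}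
    {N : V7 → ContinuousMultilinearMap ℝ (fun _ : Fin 3 => V7) ℝ}
    {P : V7 → ContinuousMultilinearMap ℝ (fun _ : Fin 4 => V7) ℝ}
    (hΓ : ∀ y ∈ s, DifferentiableAt ℝ Γ y)
    (hsymm : ∀ y ∈ s, ∀ v w, Γ y v w = Γ y w v) (hGs : ∀ y v w, G y v w = G y w v)
    (hN : ∀ y ∈ s, DifferentiableAt ℝ N y) (hP : ∀ y ∈ s, DifferentiableAt ℝ P y)
    (hN' : ∀ y ∈ s, ∀ a b c v, fderiv ℝ (fun y => N y ![a, b, c]) y v =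
      N y ![Γ y v a, b, c] + N y ![a, Γ y v b, c] + N y ![a, b, Γ y v c] + P y ![v, a, b, c])
    (hP' : ∀ y ∈ s, ∀ a b c d v, fderiv ℝ (fun y => P y ![a, b, c, d]) y v =
      P y ![Γ y v a, b, c, d] + P y ![a, Γ y v b, c, d] + P y ![a, b, Γ y v c, d] +
        P y ![a, b, c, Γ y v d] - (G y v a * N y ![b, c, d] - G y v b * N y ![a, c, d] +
          G y v c * N y ![a, b, d] - G y v d * N y ![a, b, c]))
    (halt : ∀ y ∈ s, ∀ a b c, N y ![a, b, c] = -N y ![b, a, c] ∧ N y ![a, b, c] = -N y ![a, c, b])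
    {y : V7} (hy : y ∈ s) (u v a b c : V7) :
    let R : V7 → V7 := fun w => curv Γ y u v w - (G y v w • u - G y u w • v)
    N y ![R a, b, c] + N y ![a, R b, c] + N y ![a, b, R c] = 0 := by
  intro R
  -- The second derivative of a component of `N`, by differentiating the equation for `∇ N`.
  have hder : ∀ u v : V7,
      DifferentiableAt ℝ (fun y' => fderiv ℝ (fun y => N y ![a, b, c]) y' v) y ∧
      fderiv ℝ (fun y' => fderiv ℝ (fun y => N y ![a, b, c]) y' v) y u =
        fderiv ℝ (fun y' => N y' ![Γ y v a, b, c]) y u + N y ![fderiv ℝ Γ y u v a, b, c] +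
        (fderiv ℝ (fun y' => N y' ![a, Γ y v b, c]) y u + N y ![a, fderiv ℝ Γ y u v b, c]) +
        (fderiv ℝ (fun y' => N y' ![a, b, Γ y v c]) y u + N y ![a, b, fderiv ℝ Γ y u v c]) +
        fderiv ℝ (fun y' => P y' ![v, a, b, c]) y u := by
    intro u v
    have heq : (fun y' => fderiv ℝ (fun y => N y ![a, b, c]) y' v) =ᶠ[𝓝 y] fun y' =>
        N y' ![Γ y' v a, b, c] + N y' ![a, Γ y' v b, c] + N y' ![a, b, Γ y' v c] +
          P y' ![v, a, b, c] := by
      filter_upwards [hs.mem_nhds hy] with y' hy'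
      exact hN' y' hy' a b c v
    have hg : ∀ w : V7, HasFDerivAt (fun y' => Γ y' v w) _ y := fun w =>
      ((hΓ y hy).hasFDerivAt.clm_apply (hasFDerivAt_const v y)).clm_apply (hasFDerivAt_const w y)
    have h1 := fderiv_cmm3 (hN y hy) (hg a) (hasFDerivAt_const b y) (hasFDerivAt_const c y)
    have h2 := fderiv_cmm3 (hN y hy) (hasFDerivAt_const a y) (hg b) (hasFDerivAt_const c y)
    have h3 := fderiv_cmm3 (hN y hy) (hasFDerivAt_const a y) (hasFDerivAt_const b y) (hg c)
    have h4 := fderiv_cmm4 (hP y hy) v a b c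
    have h5 := ((h1.1.hasFDerivAt.add h2.1.hasFDerivAt).add h3.1.hasFDerivAt).add h4.hasFDerivAt
    have h6 := h5.congr_of_eventuallyEq heq
    have hz1 : ∀ p q, N y ![p, 0, q] = 0 := fun p q => (N y).map_coord_zero 1 rfl
    have hz0 : ∀ p q, N y ![0, p, q] = 0 := fun p q => (N y).map_coord_zero 0 rfl
    have hz2 : ∀ p q, N y ![p, q, 0] = 0 := fun p q => (N y).map_coord_zero 2 rfl
    refine ⟨h6.differentiableAt, ?_⟩
    rw [h6.fderiv, add_apply, add_apply, add_apply, h1.2, h2.2, h3.2]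
    simp [hz0, hz1, hz2]
  have hdd : DifferentiableAt ℝ (fderiv ℝ fun y => N y ![a, b, c]) y :=
    differentiableAt_dual fun v => (hder 0 v).1
  -- Symmetry of the second derivative is the Ricci identity, once `∇ N` and `∇ P` are
  -- substituted.
  have hsnd := second_derivative_symmetric_of_eventually
    (f := fun y => N y ![a, b, c]) (f' := fderiv ℝ fun y => N y ![a, b, c]) (x := y)
    (f'' := fderiv ℝ (fderiv ℝ fun y => N y ![a, b, c]) y)
    (by
      filter_upwards [hs.mem_nhds hy] with y' hy'
      exact (fderiv_cmm3 (hN y' hy') (hasFDerivAt_const a y') (hasFDerivAt_const b y')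
        (hasFDerivAt_const c y')).1.hasFDerivAt) hdd.hasFDerivAt u v
  have hconv : ∀ u v, fderiv ℝ (fderiv ℝ fun y => N y ![a, b, c]) y u v =
      fderiv ℝ (fun y' => fderiv ℝ (fun y => N y ![a, b, c]) y' v) y u := by
    intro u v
    have h : HasFDerivAt (fun y' => fderiv ℝ (fun y => N y ![a, b, c]) y' v) _ y :=
      hdd.hasFDerivAt.clm_apply (hasFDerivAt_const v y)
    rw [h.fderiv]
    simp
  rw [hconv, hconv, (hder u v).2, (hder v u).2] at hsnd
  simp only [hN' y hy, hP' y hy] at hsnd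
  rw [hGs y v u, hsymm y hy v u] at hsnd
  obtain ⟨l0, hl0⟩ := (cmm3_linear (N y) a b c).1
  obtain ⟨l1, hl1⟩ := (cmm3_linear (N y) a b c).2.1
  obtain ⟨l2, hl2⟩ := (cmm3_linear (N y) a b c).2.2
  have k0 : N y ![R a, b, c] = N y ![fderiv ℝ Γ y u v a, b, c] - N y ![fderiv ℝ Γ y v u a, b, c] +
      N y ![Γ y u (Γ y v a), b, c] - N y ![Γ y v (Γ y u a), b, c] -
      (G y v a * N y ![u, b, c] - G y u a * N y ![v, b, c]) := by
    simp only [← hl0, R, curv, map_add, map_sub, map_smul, smul_eq_mul]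
  have k1 : N y ![a, R b, c] = N y ![a, fderiv ℝ Γ y u v b, c] - N y ![a, fderiv ℝ Γ y v u b, c] +
      N y ![a, Γ y u (Γ y v b), c] - N y ![a, Γ y v (Γ y u b), c] -
      (G y v b * N y ![a, u, c] - G y u b * N y ![a, v, c]) := by
    simp only [← hl1, R, curv, map_add, map_sub, map_smul, smul_eq_mul]
  have k2 : N y ![a, b, R c] = N y ![a, b, fderiv ℝ Γ y u v c] - N y ![a, b, fderiv ℝ Γ y v u c] +
      N y ![a, b, Γ y u (Γ y v c)] - N y ![a, b, Γ y v (Γ y u c)] -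
      (G y v c * N y ![a, b, u] - G y u c * N y ![a, b, v]) := by
    simp only [← hl2, R, curv, map_add, map_sub, map_smul, smul_eq_mul]
  -- Alternation moves `u` and `v` to the first argument, as in the terms that come from `∇ P`.
  have m1 : ∀ t, N y ![a, t, c] = -N y ![t, a, c] := fun t => (halt y hy a t c).1
  have m2 : ∀ t, N y ![a, b, t] = N y ![t, a, b] := fun t => by
    rw [(halt y hy a b t).2, (halt y hy a t b).1, neg_neg]
  rw [k0, k1, k2, m1 u, m1 v, m2 u, m2 v]
  linarith

end Explicit

/-! ### Smoothness of the metric of a `G₂`-structure -/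

section MetricSmooth

/-- The space of alternating `3`-forms on `ℝ⁷`. -/
abbrev Form3 : Type := V7 [⋀^Fin 3]→L[ℝ] ℝ

theorem contDiff_eval (w : Fin 3 → V7) : ContDiff ℝ ∞ fun φ : Form3 => φ w :=
  (ContinuousAlternatingMap.apply ℝ V7 ℝ w).contDiff

theorem contDiff_contract (a b : V7) : ContDiff ℝ ∞ fun φ : Form3 => contract φ a b := by
  rw [contDiff_clm_apply_iff]
  intro u
  simp only [contract_apply]
  exact contDiff_eval _

theorem contDiff_bryantForm : ContDiff ℝ ∞ bryantForm := by
  unfold bryantForm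
  exact ContDiff.sum fun σ _ => (contDiff_const.mul (contDiff_eval _)).smul
    ((contDiff_contract _ _).smulRight (contDiff_contract _ _))

/-- The determinant of `bryantForm`; `volDensity` is its ninth root. -/
def bryantDet (φ : Form3) : ℝ := Matrix.det (Matrix.of fun i j : Fin 7 => bryantForm φ (bas i) (bas j))

theorem contDiff_det {E : Type*} [NormedAddCommGroup E] [NormedSpace ℝ E] {n : Type*} [Fintype n]
    [DecidableEq n] {F : E → Matrix n n ℝ} (h : ∀ i j, ContDiff ℝ ∞ fun x => F x i j) :
    ContDiff ℝ ∞ fun x => (F x).det := by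
  simp only [Matrix.det_apply']
  exact ContDiff.sum fun σ _ => contDiff_const.mul (contDiff_prod fun i _ => h _ _)

theorem contDiff_det_bilinear {E : Type*} [NormedAddCommGroup E] [NormedSpace ℝ E]
    {B : E → V7 →L[ℝ] V7 →L[ℝ] ℝ} (hB : ContDiff ℝ ∞ B) :
    ContDiff ℝ ∞ fun x => Matrix.det (Matrix.of fun i j : Fin 7 => B x (bas i) (bas j)) := by
  refine contDiff_det fun i j => ?_
  simp only [Matrix.of_apply]
  exact (hB.clm_apply contDiff_const).clm_apply contDiff_const

theorem contDiff_bryantDet : ContDiff ℝ ∞ bryantDet := by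
  unfold bryantDet
  exact contDiff_det_bilinear contDiff_bryantForm

theorem volDensity_eq (φ : Form3) :
    volDensity φ = Real.sign (bryantDet φ) * |bryantDet φ| ^ ((1 : ℝ) / 9) := rfl

/-- The ninth root is smooth away from `0`. -/
theorem contDiffAt_volDensity {φ : Form3} (h : volDensity φ ≠ 0) : ContDiffAt ℝ ∞ volDensity φ := by
  have hd : bryantDet φ ≠ 0 := by
    intro h0
    apply h
    rw [volDensity_eq, h0]
    simp
  have h1 : ContDiffAt ℝ ∞ (fun d : ℝ => Real.sign (bryantDet φ) * |d| ^ ((1 : ℝ) / 9))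
      (bryantDet φ) :=
    contDiffAt_const.mul ((contDiffAt_abs hd).rpow_const_of_ne (abs_ne_zero.2 hd))
  -- The sign is locally constant.
  have h2 : (fun d : ℝ => Real.sign d * |d| ^ ((1 : ℝ) / 9)) =ᶠ[𝓝 (bryantDet φ)]
      fun d : ℝ => Real.sign (bryantDet φ) * |d| ^ ((1 : ℝ) / 9) := by
    rcases lt_or_gt_of_ne hd with hlt | hgt
    · filter_upwards [eventually_lt_nhds hlt] with d hd'
      rw [Real.sign_of_neg hd', Real.sign_of_neg hlt]
    · filter_upwards [eventually_gt_nhds hgt] with d hd'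
      rw [Real.sign_of_pos hd', Real.sign_of_pos hgt]
  exact (h1.congr_of_eventuallyEq h2).comp φ contDiff_bryantDet.contDiffAt

theorem contDiffAt_metricOf {φ : Form3} (h : volDensity φ ≠ 0) : ContDiffAt ℝ ∞ metricOf φ :=
  ((contDiffAt_volDensity h).inv h).smul contDiff_bryantForm.contDiffAt

theorem isInvertible_of_injective {E : Type*} [NormedAddCommGroup E] [NormedSpace ℝ E]
    [FiniteDimensional ℝ E] {B : E →L[ℝ] E →L[ℝ] ℝ} (h : Function.Injective B) : B.IsInvertible := by
  have hfin : Module.finrank ℝ E = Module.finrank ℝ (E →L[ℝ] ℝ) := by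
    rw [← (LinearMap.toContinuousLinearMap : (E →ₗ[ℝ] ℝ) ≃ₗ[ℝ] (E →L[ℝ] ℝ)).finrank_eq]
    exact (Subspace.dual_finrank_eq (K := ℝ) (V := E)).symm
  exact ⟨(LinearMap.linearEquivOfInjective (B : E →ₗ[ℝ] E →L[ℝ] ℝ) h hfin).toContinuousLinearEquiv,
    by ext v; rfl⟩

variable {M : Type*} [TopologicalSpace M] [ChartedSpace V7 M] [IsManifold (𝓡 7) ∞ M]

namespace SO4Structure

variable (S : SO4Structure M)

/-- The `3`-form of the structure at `x`, as a form on the model space `ℝ⁷`. -/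
def phiAt (x : M) : Form3 := S.φ x

theorem exists_coframe (x : M) : ∃ e : V7 →L[ℝ] V7, Function.Bijective e ∧
    ∀ u v w : V7, S.phiAt x ![u, v, w] = phi0 (e u) (e v) (e w) := by
  obtain ⟨e, he⟩ := S.isG2 x
  exact ⟨(e : TangentSpace (𝓡 7) x →L[ℝ] V7), e.bijective, he⟩

theorem metricAt_metric (x : M) : metricAt (I := 𝓡 7) S.metric x = metricOf (S.phiAt x) := by
  unfold metricAt SO4Structure.metric phiAt
  with_reducible rfl

theorem metricAt_eq {x : M} {e : V7 →L[ℝ] V7} (he : Function.Bijective e)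
    (h : ∀ u v w : V7, S.phiAt x ![u, v, w] = phi0 (e u) (e v) (e w)) (v w : V7) :
    metricAt (I := 𝓡 7) S.metric x v w = ∑ i, e v i * e w i := by
  rw [metricAt_metric]
  exact metricOf_pullback h he v w

theorem formInChart_eq (x₀ : M) (y : V7) :
    formInChart (𝓡 7) S.φ x₀ y = (S.phiAt ((extChartAt (𝓡 7) x₀).symm y)).compContinuousLinearMap
      (frameMap (𝓡 7) x₀ y) := rfl

theorem frameMap_bijective {x₀ : M} {y : V7} (hy : y ∈ (extChartAt (𝓡 7) x₀).target) :
    Function.Bijective (frameMap (𝓡 7) x₀ y) := by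
  obtain ⟨L, hL⟩ := frameMap_isInvertible (I := 𝓡 7) hy
  rw [← hL]
  exact L.bijective

theorem formInChart_pullback {x₀ : M} {y : V7} (hy : y ∈ (extChartAt (𝓡 7) x₀).target) :
    ∃ e : V7 →L[ℝ] V7, Function.Bijective e ∧
      (∀ u v w : V7, formInChart (𝓡 7) S.φ x₀ y ![u, v, w] = phi0 (e u) (e v) (e w)) ∧
      ∀ v w, metricInChart (𝓡 7) S.metric x₀ y v w = ∑ i, e v i * e w i := by
  obtain ⟨e, he, h⟩ := S.exists_coframe ((extChartAt (𝓡 7) x₀).symm y)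
  refine ⟨e.comp (frameMap (𝓡 7) x₀ y), he.comp (frameMap_bijective hy), fun u v w => ?_,
    fun v w => ?_⟩
  · rw [formInChart_eq, ContinuousLinearMap.comp_apply, ContinuousLinearMap.comp_apply,
      ContinuousLinearMap.comp_apply, ← h]
    refine congrArg (S.phiAt _) ?_
    funext i
    fin_cases i <;> rfl
  · rw [metricInChart_apply, S.metricAt_eq he h]
    rfl

theorem smoothMetric : SmoothMetric (𝓡 7) S.metric where
  smooth x₀ := by
    have h1 : ∀ y ∈ (extChartAt (𝓡 7) x₀).target,
        metricInChart (𝓡 7) S.metric x₀ y = metricOf (formInChart (𝓡 7) S.φ x₀ y) := by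
      intro y hy
      obtain ⟨e, he, h, hm⟩ := S.formInChart_pullback hy
      ext v w
      rw [hm, metricOf_pullback h he]
    refine ContDiffOn.congr (fun y hy => ?_) h1
    obtain ⟨e, he, h, -⟩ := S.formInChart_pullback hy
    refine (contDiffAt_metricOf ?_).comp_contDiffWithinAt y (S.smooth_φ x₀ y hy)
    rw [volDensity_pullback h he]
    exact frameMat_det_ne_zero he
  isInvertible x := by
    obtain ⟨e, he, h⟩ := S.exists_coframe x
    refine isInvertible_of_injective ((injective_iff_map_eq_zero _).2 fun v hv => ?_)
    have h1 : metricAt (I := 𝓡 7) S.metric x v v = 0 := by rw [hv]; rfl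
    rw [S.metricAt_eq he h, Finset.sum_eq_zero_iff_of_nonneg fun i _ => mul_self_nonneg _] at h1
    apply he.1
    rw [map_zero]
    ext i
    simpa using h1 i (Finset.mem_univ i)
  symm x v w := by
    obtain ⟨e, he, h⟩ := S.exists_coframe x
    rw [S.metricAt_eq he h, S.metricAt_eq he h]
    simp only [mul_comm]

end SO4Structure

end MetricSmooth

/-! ### Christoffel symbols of the cone -/

section Cone

set_option linter.unusedSectionVars false

variable {M : Type*} [TopologicalSpace M] [ChartedSpace V7 M] [IsManifold (𝓡 7) ∞ M]

theorem cone_target (q : ℝ × M) :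
    (extChartAt coneModel q).target = univ ×ˢ (extChartAt (𝓡 7) q.2).target := by
  rw [extChartAt_prod, PartialEquiv.prod_target, extChartAt_model_space_eq_id]
  rfl

theorem cone_chart_symm (q : ℝ × M) (p : ℝ × V7) :
    (extChartAt coneModel q).symm p = (p.1, (extChartAt (𝓡 7) q.2).symm p.2) := by
  rw [extChartAt_prod, PartialEquiv.prod_symm, extChartAt_model_space_eq_id]
  rfl

theorem cone_chart (q q' : ℝ × M) :
    extChartAt coneModel q q' = (q'.1, extChartAt (𝓡 7) q.2 q'.2) := by
  rw [extChartAt_prod, extChartAt_model_space_eq_id]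
  rfl

theorem cone_chartTrans (q q' : ℝ × M) :
    chartTrans coneModel q q' = fun p => (p.1, chartTrans (𝓡 7) q.2 q'.2 p.2) := by
  funext p
  rw [chartTrans, Function.comp_apply, cone_chart_symm, cone_chart]
  rfl

theorem cone_frameMap {q : ℝ × M} {p : ℝ × V7} (hp : p.2 ∈ (extChartAt (𝓡 7) q.2).target)
    (W : ℝ × V7) : frameMap coneModel q p W = (W.1, frameMap (𝓡 7) q.2 p.2 W.2) := by
  have hp' : p ∈ (extChartAt coneModel q).target := by
    rw [cone_target]
    exact ⟨mem_univ _, hp⟩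
  rw [frameMap_eq hp', frameMap_eq hp, cone_chart_symm, cone_chartTrans]
  have h1 := (differentiableAt_chartTrans hp (x := (extChartAt (𝓡 7) q.2).symm p.2)
    (mem_extChartAt_source _)).hasFDerivAt
  have h2 : HasFDerivAt (fun p' : ℝ × V7 => (p'.1,
      chartTrans (𝓡 7) q.2 ((extChartAt (𝓡 7) q.2).symm p.2) p'.2)) _ p :=
    hasFDerivAt_fst.prodMk (h1.comp p hasFDerivAt_snd)
  rw [h2.fderiv]
  rfl

theorem dr_apply (q : ℝ × M) (W : ℝ × V7) :
    (show (ℝ × V7) →L[ℝ] ℝ from dr q) W = W.1 := by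
  unfold dr
  rw [mfderiv_fst]
  rfl

theorem dproj_apply (q : ℝ × M) (W : ℝ × V7) :
    (show (ℝ × V7) →L[ℝ] V7 from dproj q) W = W.2 := by
  unfold dproj
  rw [mfderiv_snd]
  rfl

/-- The cone metric `dr² + r² g` of a metric `g`. -/
def coneMetricOf (g : Π x : M, TangentSpace (𝓡 7) x →L[ℝ] TangentSpace (𝓡 7) x →L[ℝ] ℝ) (q : ℝ × M) :
    TangentSpace coneModel q →L[ℝ] TangentSpace coneModel q →L[ℝ] ℝ :=
  let g' : V7 →L[ℝ] V7 →L[ℝ] ℝ := g q.2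
  let ρ : (ℝ × V7) →L[ℝ] ℝ := dr q
  let P : (ℝ × V7) →L[ℝ] V7 := dproj q
  let gC : (ℝ × V7) →L[ℝ] (ℝ × V7) →L[ℝ] ℝ := ρ.smulRight ρ + (q.1 ^ 2) • g'.bilinearComp P P
  gC

theorem SO4Structure.coneMetric_eq (S : SO4Structure M) : S.coneMetric = coneMetricOf S.metric := by
  funext q
  unfold SO4Structure.coneMetric coneMetricOf
  with_reducible rfl

variable {g : Π x : M, TangentSpace (𝓡 7) x →L[ℝ] TangentSpace (𝓡 7) x →L[ℝ] ℝ}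

theorem coneMetric_apply (q : ℝ × M) (V W : ℝ × V7) :
    metricAt (I := coneModel) (coneMetricOf g) q V W =
      V.1 * W.1 + q.1 ^ 2 * metricAt (I := 𝓡 7) g q.2 V.2 W.2 := by
  have h : metricAt (I := coneModel) (coneMetricOf g) q V W =
      (show (ℝ × V7) →L[ℝ] ℝ from dr q) V * (show (ℝ × V7) →L[ℝ] ℝ from dr q) W +
        q.1 ^ 2 * metricAt (I := 𝓡 7) g q.2 ((show (ℝ × V7) →L[ℝ] V7 from dproj q) V)
          ((show (ℝ × V7) →L[ℝ] V7 from dproj q) W) := rfl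
  rw [h, dr_apply, dr_apply, dproj_apply, dproj_apply]

theorem coneMetric_chart {q : ℝ × M} {p : ℝ × V7} (hp : p.2 ∈ (extChartAt (𝓡 7) q.2).target)
    (V W : ℝ × V7) : metricInChart coneModel (coneMetricOf g) q p V W =
      V.1 * W.1 + p.1 ^ 2 * metricInChart (𝓡 7) g q.2 p.2 V.2 W.2 := by
  rw [metricInChart_apply, cone_frameMap hp, cone_frameMap hp, coneMetric_apply, cone_chart_symm,
    metricInChart_apply]

theorem contDiffOn_coneMetric (hg : SmoothMetric (𝓡 7) g) (q : ℝ × M) :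
    ContDiffOn ℝ ∞ (metricInChart coneModel (coneMetricOf g) q)
      (univ ×ˢ (extChartAt (𝓡 7) q.2).target) := by
  rw [contDiffOn_clm_apply]
  intro V
  rw [contDiffOn_clm_apply]
  intro W
  refine ContDiffOn.congr ?_ fun p hp => coneMetric_chart (g := g) hp.2 V W
  have h : ContDiffOn ℝ ∞ (fun p : ℝ × V7 => metricInChart (𝓡 7) g q.2 p.2)
      (univ ×ˢ (extChartAt (𝓡 7) q.2).target) :=
    (hg.smooth q.2).comp contDiffOn_snd fun p hp => hp.2
  exact contDiffOn_const.add ((contDiffOn_fst.pow 2).mul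
    ((h.clm_apply contDiffOn_const).clm_apply contDiffOn_const))

/-- The Christoffel symbols of the cone at `r = 1`, with the first vector tangent to `M`:
`∇ᵥ w = ∇ᵥ^M w - g(v, w) ∂ᵣ` and `∇ᵥ ∂ᵣ = v`. -/
theorem localChr_cone (hg : SmoothMetric (𝓡 7) g) {x : M} {y : V7}
    (hy : y ∈ (extChartAt (𝓡 7) x).target) (v w : V7) (b : ℝ) :
    localChr (metricInChart coneModel (coneMetricOf g) (1, x)) (1, y) (0, v) (b, w) =
      (-metricInChart (𝓡 7) g x y v w, chartChr (𝓡 7) g x y v w + b • v) := by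
  have hmem : ((1 : ℝ), y) ∈ (univ : Set ℝ) ×ˢ (extChartAt (𝓡 7) x).target := ⟨mem_univ _, hy⟩
  have hd : DifferentiableAt ℝ (metricInChart coneModel (coneMetricOf g) (1, x))
      (1, y) :=
    ((contDiffOn_coneMetric hg (1, x)).contDiffAt
      ((isOpen_univ.prod (isOpen_extChartAt_target x)).mem_nhds ⟨mem_univ _, hy⟩)).differentiableAt
      (by simp)
  have hG := coneMetric_chart (g := g) (q := (1, x)) (p := (1, y)) hy
  have hinv : (metricInChart coneModel (coneMetricOf g) (1, x) (1, y)).IsInvertible := by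
    refine isInvertible_of_injective ((injective_iff_map_eq_zero _).2 fun V hV => ?_)
    have h1 : ∀ W, metricInChart coneModel (coneMetricOf g) (1, x) (1, y) V W = 0 := by
      intro W; rw [hV]; rfl
    have h2 := h1 (1, 0)
    rw [hG] at h2
    have h3 : metricInChart (𝓡 7) g x y V.2 = 0 := by
      ext w
      have h4 := h1 (0, w)
      rw [hG] at h4
      simpa using h4
    have h5 : V.2 = 0 := by
      obtain ⟨L, hL⟩ := hg.chart_isInvertible hy
      rw [← hL] at h3
      exact L.injective (h3.trans (map_zero L).symm)
    exact Prod.ext (by simpa using h2) h5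
  have hfd : ∀ V W U : ℝ × V7, fderiv ℝ (metricInChart coneModel (coneMetricOf g) (1, x))
      (1, y) V W U =
      2 * V.1 * metricInChart (𝓡 7) g x y W.2 U.2 +
        fderiv ℝ (metricInChart (𝓡 7) g x) y V.2 W.2 U.2 := by
    intro V W U
    have h1 : HasFDerivAt (fun p => metricInChart coneModel (coneMetricOf g) (1, x) p W U) _
        (1, y) :=
      (hd.hasFDerivAt.clm_apply (hasFDerivAt_const W _)).clm_apply (hasFDerivAt_const U _)
    have h2 : HasFDerivAt (fun p : ℝ × V7 => W.1 * U.1 +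
        p.1 ^ 2 * metricInChart (𝓡 7) g x p.2 W.2 U.2) _ (1, y) :=
      (((hasFDerivAt_fst (𝕜 := ℝ) (p := ((1 : ℝ), (y : V7)))).pow 2).mul
        ((((hg.differentiableAt hy).hasFDerivAt.comp (1, y)
          (hasFDerivAt_snd (𝕜 := ℝ) (p := ((1 : ℝ), (y : V7))))).clm_apply
          (hasFDerivAt_const W.2 _)).clm_apply (hasFDerivAt_const U.2 _))).const_add (W.1 * U.1)
    have heq : (fun p => metricInChart coneModel (coneMetricOf g) (1, x) p W U) =ᶠ[𝓝
        (1, y)] fun p : ℝ × V7 => W.1 * U.1 +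
        p.1 ^ 2 * metricInChart (𝓡 7) g x p.2 W.2 U.2 := by
      filter_upwards [(isOpen_univ.prod (isOpen_extChartAt_target x)).mem_nhds
        hmem] with p hp
      exact coneMetric_chart (g := g) hp.2 W U
    have h3 := DFunLike.congr_fun (h1.unique (h2.congr_of_eventuallyEq heq)) V
    simp at h3
    rw [h3]
    ring
  have hsymm := fun v w => hg.chart_symm x y v w
  -- `B` is the expected connection at `r = 1`; it is symmetric and metric, so `eq_localChr`
  -- applies.
  let B : ℝ × V7 → ℝ × V7 → ℝ × V7 := fun V W =>
    (-metricInChart (𝓡 7) g x y V.2 W.2,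
      chartChr (𝓡 7) g x y V.2 W.2 + (V.1 • W.2 + W.1 • V.2))
  have hB := eq_localChr (B := B) hinv (fun V W => ?_) (fun V W => ?_) (fun V W U => ?_) (0, v) (b, w)
  · refine hB.trans ?_
    simp [B]
  · rw [hG, hG, hsymm, mul_comm V.1]
  · simp only [B]
    rw [hsymm V.2, hg.chr_symm hy V.2, add_comm (V.1 • W.2)]
  · rw [hfd, hG, hG, hg.chr_compat hy]
    simp only [B, map_add, map_smul, add_apply, smul_apply, smul_eq_mul, one_pow, one_mul]
    rw [hsymm W.2 V.2]
    ring

end Cone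

/-! ### Parallel forms on the cone -/

section ConeParallel

set_option linter.unusedSectionVars false

/-- Covariant `n`-tensors on `ℝ⁷`. -/
abbrev Cmm (n : ℕ) : Type := ContinuousMultilinearMap ℝ (fun _ : Fin n => V7) ℝ

/-- The form `r³ dr ∧ N + r⁴ P` on `ℝ × ℝ⁷`, at a point with first coordinate `r`. -/
def coneForm (N : Cmm 3) (P : Cmm 4) (r : ℝ) (W : Fin 4 → ℝ × V7) : ℝ :=
  r ^ 3 * ∑ i : Fin 4, (-1 : ℝ) ^ (i : ℕ) * (W i).1 * N (fun j => (W (i.succAbove j)).2) +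
    r ^ 4 * P fun i => (W i).2

theorem coneForm_cons (N : Cmm 3) (P : Cmm 4) (c : Fin 3 → ℝ) (w : Fin 3 → V7) :
    coneForm N P 1 (Fin.cons (1, 0) fun i => (c i, w i)) = N w := by
  have h1 : P (fun i => ((Fin.cons (1, 0) fun i => (c i, w i) : Fin 4 → ℝ × V7) i).2) = 0 :=
    P.map_coord_zero 0 rfl
  have h2 : ∀ i : Fin 3, N (fun j => ((Fin.cons (1, 0) fun i => (c i, w i) : Fin 4 → ℝ × V7)
      (i.succ.succAbove j)).2) = 0 := by
    intro i
    refine N.map_coord_zero 0 ?_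
    rw [Fin.succ_succAbove_zero]
    rfl
  rw [coneForm, h1, Fin.sum_univ_succ]
  simp [h2]

theorem coneForm_horizontal (N : Cmm 3) (P : Cmm 4) (w : Fin 4 → V7) :
    coneForm N P 1 (fun i => (0, w i)) = P w := by
  simp [coneForm]

theorem coneForm_update (N : Cmm 3) (P : Cmm 4) (w : Fin 4 → V7) (i : Fin 4) (c : ℝ) (v : V7) :
    coneForm N P 1 (Function.update (fun i => (0, w i)) i (c, v)) =
      P (Function.update w i v) + (-1 : ℝ) ^ (i : ℕ) * c * N fun j => w (i.succAbove j) := by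
  have h1 : (fun j => ((Function.update (fun i => (0, w i)) i (c, v) : Fin 4 → ℝ × V7) j).2) =
      Function.update w i v := by
    funext j
    by_cases h : j = i
    · subst h; simp
    · simp [h]
  have h2 : (fun j => ((Function.update (fun i => (0, w i)) i (c, v) : Fin 4 → ℝ × V7)
      (i.succAbove j)).2) = fun j => w (i.succAbove j) := by
    funext j
    rw [Function.update_of_ne (Fin.succAbove_ne i j)]
  rw [coneForm, h1, Finset.sum_eq_single i]
  · rw [h2, Function.update_self]
    ring
  · intro j _ hj
    rw [Function.update_of_ne hj]
    simp
  · simp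

variable {M : Type*} [TopologicalSpace M] [ChartedSpace V7 M] [IsManifold (𝓡 7) ∞ M]
  {g : Π x : M, TangentSpace (𝓡 7) x →L[ℝ] TangentSpace (𝓡 7) x →L[ℝ] ℝ}

/-- The form `r³ dr ∧ N + r⁴ P` on the cone over `M`. -/
def thetaOf (N : M → Cmm 3) (P : M → Cmm 4) (q : ℝ × M)
    (w : Fin 4 → TangentSpace coneModel q) : ℝ :=
  coneForm (N q.2) (P q.2) q.1 fun i => (dr q (w i), dproj q (w i))

theorem thetaOf_apply (N : M → Cmm 3) (P : M → Cmm 4) (q : ℝ × M) (w : Fin 4 → ℝ × V7) :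
    thetaOf N P q w = coneForm (N q.2) (P q.2) q.1 w := by
  refine congrArg (coneForm (N q.2) (P q.2) q.1) (funext fun i => ?_)
  exact Prod.ext (dr_apply q (w i)) (dproj_apply q (w i))

theorem thetaOf_chart (N : M → Cmm 3) (P : M → Cmm 4) {x : M} {p : ℝ × V7}
    (hp : p.2 ∈ (extChartAt (𝓡 7) x).target) (W : Fin 4 → ℝ × V7) :
    thetaOf N P ((extChartAt coneModel ((1 : ℝ), x)).symm p)
      (fun i => frameMap coneModel ((1 : ℝ), x) p (W i)) =
      coneForm (tensorChart N x p.2) (tensorChart P x p.2) p.1 W := by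
  rw [thetaOf_apply, cone_chart_symm]
  simp only [cone_frameMap (q := ((1 : ℝ), x)) hp]
  rfl

/-- The condition that `r³ dr ∧ N + r⁴ P` is parallel, at the points with `r = 1`. -/
theorem fderiv_coneForm_of_isParallelOn (N : M → Cmm 3) (P : M → Cmm 4)
    (h : IsParallelOn coneModel (coneMetricOf g) (thetaOf N P) {q : ℝ × M | 0 < q.1}) (x : M)
    (W : Fin 4 → ℝ × V7) :
    DifferentiableAt ℝ (fun p : ℝ × V7 => coneForm (tensorChart N x p.2) (tensorChart P x p.2) p.1 W)
      (1, extChartAt (𝓡 7) x x) ∧ ∀ V : ℝ × V7,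
      fderiv ℝ (fun p : ℝ × V7 => coneForm (tensorChart N x p.2) (tensorChart P x p.2) p.1 W)
        (1, extChartAt (𝓡 7) x x) V =
      ∑ i, coneForm (tensorChart N x (extChartAt (𝓡 7) x x)) (tensorChart P x (extChartAt (𝓡 7) x x)) 1
        (Function.update W i (localChr (metricInChart coneModel (coneMetricOf g) (1, x))
          (1, extChartAt (𝓡 7) x x) V (W i))) := by
  have hy := mem_extChartAt_target (I := 𝓡 7) x
  have hc : extChartAt coneModel ((1 : ℝ), x) (1, x) = (1, extChartAt (𝓡 7) x x) := cone_chart _ _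
  have h1 : DifferentiableAt ℝ (fun p => thetaOf N P ((extChartAt coneModel ((1 : ℝ), x)).symm p)
      (fun i => frameMap coneModel ((1 : ℝ), x) p (W i))) (extChartAt coneModel ((1 : ℝ), x) (1, x)) ∧
      ∀ V : ℝ × V7, fderiv ℝ (fun p => thetaOf N P ((extChartAt coneModel ((1 : ℝ), x)).symm p)
        (fun i => frameMap coneModel ((1 : ℝ), x) p (W i)))
        (extChartAt coneModel ((1 : ℝ), x) (1, x)) V =
      ∑ i, thetaOf N P ((extChartAt coneModel ((1 : ℝ), x)).symm (extChartAt coneModel ((1 : ℝ), x) (1, x)))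
        (fun j => frameMap coneModel ((1 : ℝ), x) (extChartAt coneModel ((1 : ℝ), x) (1, x))
          (Function.update W i (localChr (metricInChart coneModel (coneMetricOf g) (1, x))
            (extChartAt coneModel ((1 : ℝ), x) (1, x)) V (W i)) j)) :=
    h (1, x) (show (0 : ℝ) < 1 from one_pos) W
  rw [hc] at h1
  have heq : (fun p => thetaOf N P ((extChartAt coneModel ((1 : ℝ), x)).symm p)
      (fun i => frameMap coneModel ((1 : ℝ), x) p (W i))) =ᶠ[𝓝 (1, extChartAt (𝓡 7) x x)]
      fun p : ℝ × V7 => coneForm (tensorChart N x p.2) (tensorChart P x p.2) p.1 W := by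
    have hmem : ((1 : ℝ), extChartAt (𝓡 7) x x) ∈ (univ : Set ℝ) ×ˢ (extChartAt (𝓡 7) x).target :=
      ⟨mem_univ _, hy⟩
    filter_upwards [(isOpen_univ.prod (isOpen_extChartAt_target x)).mem_nhds hmem] with p hp
    exact thetaOf_chart N P hp.2 W
  refine ⟨h1.1.congr_of_eventuallyEq heq.symm, fun V => ?_⟩
  rw [← heq.fderiv_eq, h1.2]
  exact Finset.sum_congr rfl fun i _ => thetaOf_chart N P hy _

/-- If `r³ dr ∧ N + r⁴ P` is parallel on the cone, then `∇ᵥ N = v ⌟ P` and `∇ᵥ P = - v♭ ∧ N` on `M`.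
The two equations are the `dr`-part and the part without `dr` of `∇ᵥ (r³ dr ∧ N + r⁴ P) = 0` at
`r = 1`; the derivative in the direction of `∂ᵣ` gives no further condition. -/
theorem hasCovDeriv_of_isParallelOn (hg : SmoothMetric (𝓡 7) g) (N : M → Cmm 3) (P : M → Cmm 4)
    (h : IsParallelOn coneModel (coneMetricOf g) (thetaOf N P) {q : ℝ × M | 0 < q.1}) (x : M) :
    HasCovDeriv g N (fun x v w => P x (Fin.cons v w)) x (extChartAt (𝓡 7) x x) ∧
    HasCovDeriv g P (fun x v w => -∑ i : Fin 4, (-1 : ℝ) ^ (i : ℕ) * metricAt (I := 𝓡 7) g x v (w i) *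
      N x fun j => w (i.succAbove j)) x (extChartAt (𝓡 7) x x) := by
  have hy := mem_extChartAt_target (I := 𝓡 7) x
  -- Restrict to the slice `r = 1`, where the Christoffel symbols are given by `localChr_cone`.
  have hslice : ∀ W : Fin 4 → ℝ × V7,
      DifferentiableAt ℝ (fun y => coneForm (tensorChart N x y) (tensorChart P x y) 1 W)
        (extChartAt (𝓡 7) x x) ∧ ∀ v,
      fderiv ℝ (fun y => coneForm (tensorChart N x y) (tensorChart P x y) 1 W)
        (extChartAt (𝓡 7) x x) v =
      ∑ i, coneForm (tensorChart N x (extChartAt (𝓡 7) x x)) (tensorChart P x (extChartAt (𝓡 7) x x)) 1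
        (Function.update W i (-metricInChart (𝓡 7) g x (extChartAt (𝓡 7) x x) v (W i).2,
          chartChr (𝓡 7) g x (extChartAt (𝓡 7) x x) v (W i).2 + (W i).1 • v)) := by
    intro W
    have h1 := fderiv_coneForm_of_isParallelOn N P h x W
    have h2 : HasFDerivAt (fun y : V7 => ((1 : ℝ), y)) _ (extChartAt (𝓡 7) x x) :=
      (hasFDerivAt_const (1 : ℝ) _).prodMk (hasFDerivAt_id (𝕜 := ℝ) (extChartAt (𝓡 7) x x : V7))
    have h3 := h1.1.hasFDerivAt.comp (extChartAt (𝓡 7) x x) h2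
    have h4 : HasFDerivAt (fun y => coneForm (tensorChart N x y) (tensorChart P x y) 1 W) _
      (extChartAt (𝓡 7) x x) := h3
    refine ⟨h4.differentiableAt, fun v => ?_⟩
    rw [h4.fderiv]
    refine (h1.2 (0, v)).trans (Finset.sum_congr rfl fun i _ => ?_)
    rw [← localChr_cone hg hy]
  constructor
  · intro w
    -- The vectors `∂ᵣ, w₀, w₁, w₂` give the equation for `N`; differentiating `∂ᵣ` produces the
    -- term with `P`.
    have h1 := hslice (Fin.cons (1, 0) fun i => (0, w i))
    simp only [coneForm_cons] at h1
    refine ⟨h1.1, fun v => (h1.2 v).trans ?_⟩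
    rw [Fin.sum_univ_succ, add_comm, frameMap_center]
    refine congrArg₂ (· + ·) (Finset.sum_congr rfl fun i _ => ?_) ?_
    · have h2 : ∀ t : ℝ × V7, Function.update (Fin.cons (1, 0) fun i => (0, w i) : Fin 4 → ℝ × V7)
          i.succ t = Fin.cons (1, 0) fun j => (Function.update (fun _ => (0 : ℝ)) i t.1 j,
            Function.update w i t.2 j) := by
        intro t
        rw [← Fin.cons_update]
        refine congrArg (Fin.cons (α := fun _ : Fin 4 => ℝ × V7) ((1 : ℝ), (0 : V7))) (funext fun j => ?_)
        by_cases hj : j = i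
        · subst hj; simp
        · simp [hj]
      rw [h2, coneForm_cons]
      simp
    · have h2 : ∀ t : ℝ × V7, Function.update (Fin.cons (1, 0) fun i => (0, w i) : Fin 4 → ℝ × V7)
          0 t = Fin.cons t fun j => (0, w j) := fun t => Fin.update_cons_zero _ _ _
      have h3 : (Fin.cons (0, v) fun j => (0, w j) : Fin 4 → ℝ × V7) =
          fun i => (0, (Fin.cons v w : Fin 4 → V7) i) := by
        funext i
        refine Fin.cases ?_ (fun i => ?_) i <;> rfl
      rw [h2]
      simp only [Fin.cons_zero, map_zero, neg_zero, zero_add, one_smul]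
      rw [h3, coneForm_horizontal, tensorChart_center, extChartAt_to_inv]
      rfl
  · intro w
    -- The vectors `w₀, …, w₃` give the equation for `P`; the `∂ᵣ`-parts of `∇ᵥ wᵢ` produce the
    -- terms with `N`.
    have h1 := hslice fun i => (0, w i)
    simp only [coneForm_horizontal, coneForm_update] at h1
    refine ⟨h1.1, fun v => (h1.2 v).trans ?_⟩
    rw [Finset.sum_add_distrib, frameMap_center, extChartAt_to_inv]
    refine congrArg₂ (· + ·) (Finset.sum_congr rfl fun i _ => ?_) ?_
    · simp
    · simp only [ContinuousLinearMap.id_apply]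
      rw [← Finset.sum_neg_distrib]
      refine Finset.sum_congr rfl fun i _ => ?_
      rw [metricInChart_center, tensorChart_center]
      simp

end ConeParallel

/-! ### The fields `4 vol_A - φ` and `⋆(4 vol_A - φ)` -/

section VectorNotation

theorem sum_update_three (N : Cmm 3) (F : V7 → V7) (a b c : V7) :
    ∑ i, N (Function.update ![a, b, c] i (F (![a, b, c] i))) =
      N ![F a, b, c] + N ![a, F b, c] + N ![a, b, F c] := by
  have h0 : Function.update ![a, b, c] 0 (F a) = ![F a, b, c] := by
    ext i; fin_cases i <;> rfl
  have h1 : Function.update ![a, b, c] 1 (F b) = ![a, F b, c] := by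
    ext i; fin_cases i <;> rfl
  have h2 : Function.update ![a, b, c] 2 (F c) = ![a, b, F c] := by
    ext i; fin_cases i <;> rfl
  rw [Fin.sum_univ_three, ← h0, ← h1, ← h2]
  rfl

theorem sum_update_four (P : Cmm 4) (F : V7 → V7) (a b c d : V7) :
    ∑ i, P (Function.update ![a, b, c, d] i (F (![a, b, c, d] i))) =
      P ![F a, b, c, d] + P ![a, F b, c, d] + P ![a, b, F c, d] + P ![a, b, c, F d] := by
  have h0 : Function.update ![a, b, c, d] 0 (F a) = ![F a, b, c, d] := by
    ext i; fin_cases i <;> rfl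
  have h1 : Function.update ![a, b, c, d] 1 (F b) = ![a, F b, c, d] := by
    ext i; fin_cases i <;> rfl
  have h2 : Function.update ![a, b, c, d] 2 (F c) = ![a, b, F c, d] := by
    ext i; fin_cases i <;> rfl
  have h3 : Function.update ![a, b, c, d] 3 (F d) = ![a, b, c, F d] := by
    ext i; fin_cases i <;> rfl
  rw [Fin.sum_univ_four, ← h0, ← h1, ← h2, ← h3]
  rfl

theorem contraction_four (N : Cmm 3) (f : V7 → ℝ) (a b c d : V7) :
    ∑ i : Fin 4, (-1 : ℝ) ^ (i : ℕ) * f (![a, b, c, d] i) *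
      N (fun j => ![a, b, c, d] (i.succAbove j)) =
    f a * N ![b, c, d] - f b * N ![a, c, d] + f c * N ![a, b, d] - f d * N ![a, b, c] := by
  have h0 : (fun j => ![a, b, c, d] ((0 : Fin 4).succAbove j)) = ![b, c, d] := by
    ext i; fin_cases i <;> rfl
  have h1 : (fun j => ![a, b, c, d] ((1 : Fin 4).succAbove j)) = ![a, c, d] := by
    ext i; fin_cases i <;> rfl
  have h2 : (fun j => ![a, b, c, d] ((2 : Fin 4).succAbove j)) = ![a, b, d] := by
    ext i; fin_cases i <;> rfl
  have h3 : (fun j => ![a, b, c, d] ((3 : Fin 4).succAbove j)) = ![a, b, c] := by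
    ext i; fin_cases i <;> rfl
  rw [Fin.sum_univ_four, h0, h1, h2, h3]
  simp only [Fin.val_zero, Fin.val_one, Fin.val_two, Fin.isValue, Matrix.cons_val]
  norm_num
  ring

end VectorNotation

section EtaField

set_option linter.unusedSectionVars false

variable {M : Type*} [TopologicalSpace M] [ChartedSpace V7 M] [IsManifold (𝓡 7) ∞ M]

/-- The form `r³ dr ∧ η + r⁴ ⋆η` on the cone, for fields `φ` and `η` of forms on the model space. -/
def thetaFormOf (φ : M → Form3) (η : M → Form3) (q : ℝ × M)
    (w : Fin 4 → TangentSpace coneModel q) : ℝ :=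
  q.1 ^ 3 * ∑ i : Fin 4, (-1 : ℝ) ^ (i : ℕ) * dr q (w i) *
      η q.2 (fun j : Fin 3 => dproj q (w (i.succAbove j))) +
    q.1 ^ 4 * hodge3 (φ q.2) (η q.2) (fun i => dproj q (w i))

theorem thetaFormOf_eq (φ η : M → Form3) :
    thetaFormOf φ η = thetaOf (fun x => (η x).toContinuousMultilinearMap)
      (fun x => toCMM (hodgeMulti (φ x) (η x))) := by
  funext q w
  rw [thetaOf, coneForm, toCMM_apply, hodgeMulti_apply]
  rfl

theorem comp_vec_three {F : V7 → V7} (N : Cmm 3) (a b c : V7) :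
    N (fun i => F (![a, b, c] i)) = N ![F a, F b, F c] := by
  congr 1
  ext i; fin_cases i <;> rfl

/-- `curv_annihilates`, for tensor fields on a manifold. -/
theorem curv_annihilates_of_hasCovDeriv
    {g : Π x : M, TangentSpace (𝓡 7) x →L[ℝ] TangentSpace (𝓡 7) x →L[ℝ] ℝ}
    (hg : SmoothMetric (𝓡 7) g) {N : M → Cmm 3} {P : M → Cmm 4}
    (hN : ∀ x, ∀ y ∈ (extChartAt (𝓡 7) x).target,
      HasCovDeriv g N (fun x v w => P x (Fin.cons v w)) x y)
    (hP : ∀ x, ∀ y ∈ (extChartAt (𝓡 7) x).target,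
      HasCovDeriv g P (fun x v (w : Fin 4 → V7) => -∑ i : Fin 4, (-1 : ℝ) ^ (i : ℕ) *
        metricAt (I := 𝓡 7) g x v (w i) * N x fun j => w (i.succAbove j)) x y)
    (halt : ∀ x, ∀ a b c, N x ![a, b, c] = -N x ![b, a, c] ∧ N x ![a, b, c] = -N x ![a, c, b])
    (x : M) (u v a b c : V7) :
    let R : V7 → V7 := fun w => curv (chartChr (𝓡 7) g x) (extChartAt (𝓡 7) x x) u v w -
      (metricAt (I := 𝓡 7) g x v w • u - metricAt (I := 𝓡 7) g x u w • v)
    N x ![R a, b, c] + N x ![a, R b, c] + N x ![a, b, R c] = 0 := by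
  have hs := isOpen_extChartAt_target (I := 𝓡 7) x
  have key := curv_annihilates hs (G := metricInChart (𝓡 7) g x)
    (Γ := chartChr (𝓡 7) g x) (N := tensorChart N x) (P := tensorChart P x)
    (fun y hy => hg.differentiableAt_chr hy) (fun y hy => hg.chr_symm hy)
    (fun y v w => hg.chart_symm x y v w)
    (fun y hy => differentiableAt_cmm fun w => (hN x y hy w).1)
    (fun y hy => differentiableAt_cmm fun w => (hP x y hy w).1)
    (fun y hy a b c v => by
      rw [(hN x y hy ![a, b, c]).2 v,
        sum_update_three _ (fun w => chartChr (𝓡 7) g x y v w)]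
      refine congrArg (HAdd.hAdd (α := ℝ) (β := ℝ) (γ := ℝ) _) ?_
      rw [tensorChart_apply]
      refine congrArg (P ((extChartAt (𝓡 7) x).symm y)) (funext fun i => ?_)
      refine Fin.cases ?_ (fun i => ?_) i <;> rfl)
    (fun y hy a b c d v => by
      rw [(hP x y hy ![a, b, c, d]).2 v,
        sum_update_four _ (fun w => chartChr (𝓡 7) g x y v w), sub_eq_add_neg]
      refine congrArg (HAdd.hAdd (α := ℝ) (β := ℝ) (γ := ℝ) _) (congrArg Neg.neg ?_)
      rw [← contraction_four (tensorChart N x y) (metricInChart (𝓡 7) g x y v) a b c d]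
      refine Finset.sum_congr rfl fun i _ => ?_
      rw [metricInChart_apply, tensorChart_apply])
    (fun y hy a b c => by
      simp only [tensorChart_apply, comp_vec_three]
      exact halt _ _ _ _)
    (mem_extChartAt_target (I := 𝓡 7) x) u v a b c
  simp only [tensorChart_center, metricInChart_center] at key
  exact key

namespace SO4Structure

variable (S : SO4Structure M)

/-- The form `4 vol_A - φ` at `x`, as a form on the model space `ℝ⁷`. -/
def etaAt (x : M) : Form3 := S.eta x

theorem etaAt_eq (x : M) : S.etaAt x = (4 : ℝ) • volA (S.phiAt x) (S.A x) - S.phiAt x := by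
  unfold etaAt SO4Structure.eta phiAt
  with_reducible rfl

theorem Theta_eq : S.Theta = thetaFormOf S.phiAt S.etaAt := by
  unfold SO4Structure.Theta thetaFormOf phiAt etaAt
  with_reducible rfl

/-- The form `4 vol_A - φ`, as a covariant `3`-tensor. -/
def etaT (x : M) : Cmm 3 := (S.etaAt x).toContinuousMultilinearMap

/-- The form `⋆(4 vol_A - φ)`, as a covariant `4`-tensor. -/
def starT (x : M) : Cmm 4 := toCMM (hodgeMulti (S.phiAt x) (S.etaAt x))

variable {S} in
theorem IsQuaternionSasakian.parallel (hS : S.IsQuaternionSasakian) :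
    IsParallelOn coneModel (coneMetricOf S.metric) (thetaOf S.etaT S.starT) {q : ℝ × M | 0 < q.1} := by
  have h : IsParallelOn coneModel S.coneMetric S.Theta {q : ℝ × M | 0 < q.1} := hS
  rw [S.Theta_eq, thetaFormOf_eq, S.coneMetric_eq] at h
  exact h

variable {S} in
theorem IsQuaternionSasakian.eta_deriv (hS : S.IsQuaternionSasakian) {x : M} {y : V7}
    (hy : y ∈ (extChartAt (𝓡 7) x).target) :
    HasCovDeriv S.metric S.etaT (fun x v w => S.starT x (Fin.cons v w)) x y :=
  HasCovDeriv.of_center S.smoothMetric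
    (fun x => (hasCovDeriv_of_isParallelOn S.smoothMetric S.etaT S.starT hS.parallel x).1) hy

variable {S} in
theorem IsQuaternionSasakian.star_deriv (hS : S.IsQuaternionSasakian) {x : M} {y : V7}
    (hy : y ∈ (extChartAt (𝓡 7) x).target) :
    HasCovDeriv S.metric S.starT (fun x v w => -∑ i : Fin 4, (-1 : ℝ) ^ (i : ℕ) *
      metricAt (I := 𝓡 7) S.metric x v (w i) * S.etaT x fun j => w (i.succAbove j)) x y :=
  HasCovDeriv.of_center S.smoothMetric
    (fun x => (hasCovDeriv_of_isParallelOn S.smoothMetric S.etaT S.starT hS.parallel x).2) hy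

theorem etaT_alt (x : M) (a b c : V7) :
    S.etaT x ![a, b, c] = -S.etaT x ![b, a, c] ∧ S.etaT x ![a, b, c] = -S.etaT x ![a, c, b] := by
  constructor
  · have h := (S.etaAt x).toAlternatingMap.map_swap ![b, a, c] (i := 0) (j := 1) (by decide)
    refine Eq.trans (congrArg (S.etaAt x) ?_) h
    ext i; fin_cases i <;> rfl
  · have h := (S.etaAt x).toAlternatingMap.map_swap ![a, c, b] (i := 1) (j := 2) (by decide)
    refine Eq.trans (congrArg (S.etaAt x) ?_) h
    ext i; fin_cases i <;> rfl

variable {S} in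
theorem IsQuaternionSasakian.curv_annihilates_eta (hS : S.IsQuaternionSasakian) (x : M)
    (u v a b c : V7) :
    let R : V7 → V7 := fun w => curv (chartChr (𝓡 7) S.metric x) (extChartAt (𝓡 7) x x) u v w -
      (metricAt (I := 𝓡 7) S.metric x v w • u - metricAt (I := 𝓡 7) S.metric x u w • v)
    S.etaT x ![R a, b, c] + S.etaT x ![a, R b, c] + S.etaT x ![a, b, R c] = 0 :=
  curv_annihilates_of_hasCovDeriv S.smoothMetric (fun _ _ hy => hS.eta_deriv hy)
    (fun _ _ hy => hS.star_deriv hy) S.etaT_alt x u v a b c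

end SO4Structure

end EtaField

/-! ### Moving coframes in which a metric or a tensor is constant -/

section AdaptedFrames

variable {Z : Type*} [NormedAddCommGroup Z] [NormedSpace ℝ Z]
  {Γ : V7 → V7 →L[ℝ] V7 →L[ℝ] V7} {X : Z → V7} {e : Z → V7 →L[ℝ] V7} {z : Z}

/-- The connection form of a metric connection in orthonormal coframes is skew. -/
theorem frameConn_skew {G : V7 → V7 →L[ℝ] V7 →L[ℝ] ℝ} (hX : DifferentiableAt ℝ X z)
    (hd : DifferentiableAt ℝ e z) (he : (e z).IsInvertible) (hG : DifferentiableAt ℝ G (X z))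
    (hΓ : ∀ v a b, fderiv ℝ G (X z) v a b = G (X z) (Γ (X z) v a) b + G (X z) a (Γ (X z) v b))
    (h : ∀ᶠ z' in 𝓝 z, ∀ v w, G (X z') v w = ∑ i, e z' v i * e z' w i) (ξ : Z) (i j : Fin 7) :
    frameConn Γ X e z ξ (bas j) i = -frameConn Γ X e z ξ (bas i) j := by
  have hz := h.self_of_nhds
  have key : ∀ v w, ∑ i, (frameDer Γ X e z ξ v i * e z w i + e z v i * frameDer Γ X e z ξ w i) = 0 := by
    intro v w
    have h1 : HasFDerivAt (fun z' => G (X z') v w) _ z :=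
      ((hG.hasFDerivAt.comp z hX.hasFDerivAt).clm_apply (hasFDerivAt_const v z)).clm_apply
        (hasFDerivAt_const w z)
    have he' : ∀ (v : V7) (i : Fin 7), HasFDerivAt (fun z' => e z' v i)
        ((EuclideanSpace.proj i : V7 →L[ℝ] ℝ).comp ((fderiv ℝ e z).flip v)) z := by
      intro v i
      have h2 : HasFDerivAt (fun z' => e z' v) ((fderiv ℝ e z).flip v) z := by
        have := hd.hasFDerivAt.clm_apply (hasFDerivAt_const v z)
        simpa using this
      exact (EuclideanSpace.proj i : V7 →L[ℝ] ℝ).hasFDerivAt.comp z h2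
    have h2 : HasFDerivAt (fun z' => ∑ i, e z' v i * e z' w i) _ z :=
      HasFDerivAt.fun_sum fun i _ => (he' v i).mul (he' w i)
    have h3 := DFunLike.congr_fun (h1.unique
      (h2.congr_of_eventuallyEq (h.mono fun z' hz' => hz' v w))) ξ
    simp at h3
    rw [hΓ, hz, hz, ← Finset.sum_add_distrib] at h3
    simp only [frameDer_apply, PiLp.sub_apply]
    rw [← sub_eq_zero, ← Finset.sum_sub_distrib] at h3
    rw [← neg_eq_zero, ← Finset.sum_neg_distrib, ← h3]
    refine Finset.sum_congr rfl fun i _ => ?_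
    ring
  have h1 := key ((e z).inverse (bas j)) ((e z).inverse (bas i))
  rw [apply_inverse_self he, apply_inverse_self he, Finset.sum_add_distrib] at h1
  simp at h1
  rw [frameConn_apply, frameConn_apply]
  simp only [PiLp.neg_apply]
  linarith

/-- If a tensor `N` has constant components `F` in the coframes `e`, its covariant derivative is
given by the derivation action of the connection form on `F`. -/
theorem frameConn_tensor {n : ℕ} {N : V7 → Cmm n} {F : Cmm n} {q : V7 → (Fin n → V7) → ℝ}
    (hX : DifferentiableAt ℝ X z) (hd : DifferentiableAt ℝ e z) (he : (e z).IsInvertible)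
    (hN : ∀ w, DifferentiableAt ℝ (fun y => N y w) (X z) ∧ ∀ v, fderiv ℝ (fun y => N y w) (X z) v =
      ∑ i, N (X z) (Function.update w i (Γ (X z) v (w i))) + q v w)
    (h : ∀ᶠ z' in 𝓝 z, ∀ w, N (X z') w = F fun i => e z' (w i)) (ξ : Z) (f : Fin n → V7) :
    -∑ i, F (Function.update f i (frameConn Γ X e z ξ (f i))) =
      q (fderiv ℝ X z ξ) fun i => (e z).inverse (f i) := by
  have hz := h.self_of_nhds
  have key : ∀ w : Fin n → V7, ∑ i, F (Function.update (fun i => e z (w i)) i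
      (frameDer Γ X e z ξ (w i))) = q (fderiv ℝ X z ξ) w := by
    intro w
    have h1 : HasFDerivAt (fun z' => N (X z') w) _ z :=
      ((hN w).1.hasFDerivAt.comp z hX.hasFDerivAt)
    have hW : ∀ i, HasFDerivAt (fun z' => e z' (w i)) ((fderiv ℝ e z).flip (w i)) z := by
      intro i
      have := hd.hasFDerivAt.clm_apply (hasFDerivAt_const (w i) z)
      simpa using this
    have h2 := hasFDerivAt_cmm_apply (T := fun _ : Z => F) (differentiableAt_const F) hW
    have h3 := DFunLike.congr_fun (h1.unique
      (h2.1.hasFDerivAt.congr_of_eventuallyEq (h.mono fun z' hz' => hz' w))) ξ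
    rw [h2.2, ContinuousLinearMap.comp_apply, (hN w).2] at h3
    have h4 : ∀ i, F (Function.update (fun i => e z (w i)) i (frameDer Γ X e z ξ (w i))) =
        F (Function.update (fun i => e z (w i)) i ((fderiv ℝ e z).flip (w i) ξ)) -
        N (X z) (Function.update w i (Γ (X z) (fderiv ℝ X z ξ) (w i))) := by
      intro i
      have h5 : (fun j => e z (Function.update w i (Γ (X z) (fderiv ℝ X z ξ) (w i)) j)) =
          Function.update (fun j => e z (w j)) i (e z (Γ (X z) (fderiv ℝ X z ξ) (w i))) := by
        funext j
        by_cases hj : j = i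
        · subst hj; simp
        · simp [hj]
      rw [hz, h5, frameDer_apply, ContinuousMultilinearMap.map_update_sub]
      rfl
    simp only [h4, Finset.sum_sub_distrib]
    simp at h3
    simp
    linarith
  rw [← key, ← Finset.sum_neg_distrib]
  refine Finset.sum_congr rfl fun i _ => ?_
  simp only [apply_inverse_self he, frameConn_apply]
  rw [← neg_one_smul ℝ (frameDer Γ X e z ξ ((e z).inverse (f i))),
    ContinuousMultilinearMap.map_update_smul]
  simp

end AdaptedFrames

/-! ### The connection form on `SO(4)`-coframes -/

section CoframeBundle

set_option linter.unusedSectionVars false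

variable {M : Type*} [TopologicalSpace M] [ChartedSpace V7 M] [IsManifold (𝓡 7) ∞ M]

/-- In the coframe `b`, the tensors `g`, `N`, `P` are the Euclidean metric, `η₀` and `⋆ η₀`. -/
structure IsAdapted (g : Π x : M, TangentSpace (𝓡 7) x →L[ℝ] TangentSpace (𝓡 7) x →L[ℝ] ℝ)
    (N : M → Cmm 3) (P : M → Cmm 4) (b : HomTotal M) : Prop where
  isInvertible : (coframe b).IsInvertible
  metric : ∀ v w, metricAt (I := 𝓡 7) g b.1 v w = ∑ i, coframe b v i * coframe b w i
  eta : ∀ w, N b.1 w = eta0 (coframe b (w 0)) (coframe b (w 1)) (coframe b (w 2))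
  star : ∀ w, P b.1 w = starEta0 fun i => coframe b (w i)

/-- `SO(4)`-coframes are adapted to `g`, `4 vol_A - φ` and its Hodge dual. -/
theorem SO4Structure.isAdapted (S : SO4Structure M) {b : HomTotal M} (hb : b ∈ S.coframeBundle) :
    IsAdapted S.metric S.etaT S.starT b := by
  obtain ⟨he, h, hA⟩ := hb
  have h' : ∀ u v w : V7, S.phiAt b.1 ![u, v, w] = phi0 (coframe b u) (coframe b v) (coframe b w) := h
  have hη : ∀ u v w : V7, S.etaAt b.1 ![u, v, w] =
      eta0 (coframe b u) (coframe b v) (coframe b w) := by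
    intro u v w
    rw [S.etaAt_eq]
    exact eta_pullback h' he hA u v w
  refine ⟨isInvertible_of_bijective he, S.metricAt_eq he h', fun w => ?_, fun w => ?_⟩
  · rw [← hη]
    refine congrArg (S.etaAt b.1) ?_
    ext i; fin_cases i <;> rfl
  · rw [SO4Structure.starT, toCMM_apply, hodgeMulti_apply]
    exact hodge3_pullback h' he hη w

variable {k : ℕ} {U : Set (EuclideanSpace ℝ (Fin k))} {u : EuclideanSpace ℝ (Fin k) → HomTotal M}
  {g : Π x : M, TangentSpace (𝓡 7) x →L[ℝ] TangentSpace (𝓡 7) x →L[ℝ] ℝ}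
  {N : M → Cmm 3} {P : M → Cmm 4} {z : EuclideanSpace ℝ (Fin k)}

section Along

variable (hg : SmoothMetric (𝓡 7) g) (hU : IsOpen U)
  (hu : ContMDiffOn 𝓘(ℝ, EuclideanSpace ℝ (Fin k)) homModel ∞ u U)
  (ha : ∀ z ∈ U, IsAdapted g N P (u z)) (hz : z ∈ U)

include hg hU hu ha hz

theorem connForm_skew (ξ : EuclideanSpace ℝ (Fin k)) (i j : Fin 7) :
    pullback u (connForm g i j) z ξ = -pullback u (connForm g j i) z ξ := by
  have huz := hu.contMDiffAt (hU.mem_nhds hz)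
  have hs := mem_extChartAt_source (I := 𝓡 7) (u z).1
  have he := (ha z hz).isInvertible
  rw [pullback_connForm hg huz he hs, pullback_connForm hg huz he hs]
  refine frameConn_skew (G := metricInChart (𝓡 7) g (u z).1)
    ((contDiffAt_baseCoord huz hs).differentiableAt (by simp))
    ((contDiffAt_frameCoord huz hs).differentiableAt (by simp))
    (frameCoord_isInvertible hs he) (hg.differentiableAt (baseCoord_mem_target hs))
    (hg.chr_compat (baseCoord_mem_target hs)) ?_ ξ i j
  filter_upwards [hU.mem_nhds hz, eventually_mem_source huz hs] with z' h h' v w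
  rw [metricInChart_apply, symm_baseCoord h', (ha z' h).metric]
  rfl

/-- Along adapted coframes, `∇ᵥ N = v ⌟ P` says that the connection form `ψ` and the tautological
form `ω` satisfy `- ψ · η₀ = ω ⌟ ⋆ η₀`. -/
theorem connForm_frameRelations
    (hN : ∀ x, ∀ y ∈ (extChartAt (𝓡 7) x).target,
      HasCovDeriv g N (fun x v w => P x (Fin.cons v w)) x y) (ξ : EuclideanSpace ℝ (Fin k)) :
    FrameRelations (fun i j => pullback u (connForm g i j) z ξ)
      (WithLp.toLp 2 fun i => pullback u (tautForm i) z ξ) := by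
  have huz := hu.contMDiffAt (hU.mem_nhds hz)
  have hs := mem_extChartAt_source (I := 𝓡 7) (u z).1
  have ht := baseCoord_mem_target hs
  have he := (ha z hz).isInvertible
  refine frameRelations_of_etaVar _ (connForm_skew hg hU hu ha hz ξ) _ fun p q r => ?_
  have hF : ∀ w, ((N (u z).1).compContinuousLinearMap fun _ => (coframe (u z)).inverse) w =
      eta0 (w 0) (w 1) (w 2) := by
    intro w
    rw [ContinuousMultilinearMap.compContinuousLinearMap_apply, (ha z hz).eta]
    simp only [apply_inverse_self he]
  have h1 := frameConn_tensor (N := tensorChart N (u z).1)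
    (F := (N (u z).1).compContinuousLinearMap fun _ => (coframe (u z)).inverse)
    ((contDiffAt_baseCoord huz hs).differentiableAt (by simp))
    ((contDiffAt_frameCoord huz hs).differentiableAt (by simp))
    (frameCoord_isInvertible hs he) (hN (u z).1 _ ht) (by
      filter_upwards [hU.mem_nhds hz, eventually_mem_source huz hs] with z' h h' w
      rw [tensorChart_apply, symm_baseCoord h', (ha z' h).eta, hF]
      rfl) ξ ![bas p, bas q, bas r]
  have hcol : ∀ m, matCol (fun i j => pullback u (connForm g i j) z ξ) m =
      localConn g (u z).1 u z ξ (bas m) := by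
    intro m
    ext i
    change pullback u (connForm g i m) z ξ = _
    rw [pullback_connForm hg huz he hs]
    rfl
  have hcol' : (WithLp.toLp 2 fun i => pullback u (tautForm i) z ξ : V7) =
      localTaut (u z).1 u z ξ := by
    ext i
    change pullback u (tautForm i) z ξ = _
    rw [pullback_tautForm huz hs]
    rfl
  simp only [← localConn.eq_1] at h1
  rw [sum_update_three _ (fun w => localConn g (u z).1 u z ξ w)] at h1
  simp only [hF] at h1
  rw [symm_baseCoord hs, (ha z hz).star] at h1
  rw [etaVar, hcol, hcol, hcol, hcol']
  refine h1.trans (congrArg starEta0 (funext fun i => ?_))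
  refine Fin.cases rfl (fun i => ?_) i
  refine (apply_inverse_self (frameCoord_isInvertible hs he) _).trans ?_
  fin_cases i <;> rfl

end Along

end CoframeBundle

/-! ### Algebraic curvature tensors annihilating the model form -/

section CurvatureAlgebra

/-- The symmetries of a curvature tensor `K i j k l = ⟨K(eₖ, eₗ) eⱼ, eᵢ⟩` that takes values in the
stabilizer of `η₀` (`FrameRelations` with `x = 0`). -/
structure CurvatureRelations (K : Fin 7 → Fin 7 → Fin 7 → Fin 7 → ℝ) : Prop where
  skew : ∀ i j k l, K i j k l = -K j i k l
  swap : ∀ i j k l, K i j k l = -K i j l k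
  bianchi : ∀ i j k l, K i j k l + K i k l j + K i l j k = 0
  frame : ∀ k l, FrameRelations (fun i j => K i j k l) 0

namespace CurvatureRelations

variable {K : Fin 7 → Fin 7 → Fin 7 → Fin 7 → ℝ} (hK : CurvatureRelations K)

include hK

/-- The pair symmetry, which follows from the other symmetries of a curvature tensor. -/
theorem pair_symm (i j k l : Fin 7) : K i j k l = K k l i j := by
  have b1 := hK.bianchi i j k l
  have b2 := hK.bianchi j k l i
  have b3 := hK.bianchi k l i j
  have b4 := hK.bianchi l i j k
  linarith [hK.skew j i k l, hK.skew k i j l, hK.skew k j l i, hK.skew l i j k, hK.skew l j k i,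
    hK.skew l k i j, hK.swap i k l j, hK.swap i l j k, hK.swap j k l i, hK.swap j l i k,
    hK.swap k l i j, hK.skew l i k j, hK.skew l j i k, hK.swap l k i j, hK.skew k i l j,
    hK.skew k j i l, hK.swap j k i l, hK.swap k i j l, hK.swap k j l i, hK.swap l i j k,
    hK.swap l j k i, hK.swap i j k l, hK.swap j i k l]

/-- The stabilizer of `η₀` preserves `span(e₀, e₁, e₂)`. -/
theorem mixed_eq_zero {i j : Fin 7} (hi : i < 3) (hj : 3 ≤ j) (k l : Fin 7) : K i j k l = 0 := by
  obtain ⟨-, -, -, h03, h04, h05, h06, h13, h14, h15, h16, h23, h24, h25, h26⟩ := hK.frame k l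
  simp at h03 h04 h05 h06 h13 h14 h15 h16 h23 h24 h25 h26
  fin_cases i <;> simp at hi <;> fin_cases j <;> simp at hj <;> assumption

theorem mixed_right_eq_zero {k l : Fin 7} (hk : k < 3) (hl : 3 ≤ l) (i j : Fin 7) : K i j k l = 0 := by
  rw [hK.pair_symm, hK.mixed_eq_zero hk hl]

/-- In the Bianchi identity, the two other terms vanish by `mixed_eq_zero`. -/
theorem block_eq_zero {i k l : Fin 7} (hi : i < 3) (j : Fin 7) (hk : 3 ≤ k) (hl : 3 ≤ l) :
    K i j k l = 0 := by
  have h := hK.bianchi i j k l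
  rw [hK.mixed_eq_zero hi hk, hK.mixed_eq_zero hi hl] at h
  linarith

/-- If all four indices are below `3`, the pair symmetry and the relations express the component by
those of `block_eq_zero`. -/
theorem left_eq_zero {i : Fin 7} (hi : i < 3) (j k l : Fin 7) : K i j k l = 0 := by
  rcases lt_or_ge k 3 with hk | hk
  · rcases lt_or_ge l 3 with hl | hl
    · rw [hK.pair_symm]
      obtain ⟨h01, h02, h12, -⟩ := hK.frame i j
      have h36 := hK.pair_symm 3 6 i j
      have h45 := hK.pair_symm 4 5 i j
      have h35 := hK.pair_symm 3 5 i j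
      have h46 := hK.pair_symm 4 6 i j
      have h34 := hK.pair_symm 3 4 i j
      have h56 := hK.pair_symm 5 6 i j
      rw [hK.block_eq_zero hi j (by decide) (by decide)] at h36 h45 h35 h46 h34 h56
      simp [h36, h45, h35, h46, h34, h56] at h01 h02 h12
      have hs := fun a b => hK.skew a b i j
      have h00 : ∀ a, K a a i j = 0 := fun a => by linarith [hs a a]
      have h10 := hs 1 0
      have h20 := hs 2 0
      have h21 := hs 2 1
      rw [h01, neg_zero] at h10
      rw [h02, neg_zero] at h20
      rw [h12, neg_zero] at h21
      fin_cases k <;> simp at hk <;> fin_cases l <;> simp at hl <;> first | exact h00 _ | assumption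
    · exact hK.mixed_right_eq_zero hk hl i j
  · rcases lt_or_ge l 3 with hl | hl
    · rw [hK.swap, hK.mixed_right_eq_zero hl hk, neg_zero]
    · exact hK.block_eq_zero hi j hk hl

/-- The upper left block of the stabilizer is the `[ζ]⁺`-part of the lower right block. Since the
former vanishes, the curvature takes values in the `[ν]⁻`-part. -/
theorem selfdual (k l : Fin 7) :
    K 5 6 k l = -K 3 4 k l ∧ K 4 6 k l = K 3 5 k l ∧ K 4 5 k l = -K 3 6 k l := by
  obtain ⟨h01, h02, h12, -⟩ := hK.frame k l
  rw [hK.left_eq_zero (by decide)] at h01 h02 h12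
  simp at h01 h02 h12
  exact ⟨by linarith, by linarith, by linarith⟩

theorem right_eq_zero {k : Fin 7} (hk : k < 3) (i j l : Fin 7) : K i j k l = 0 := by
  rw [hK.pair_symm, hK.left_eq_zero hk]

/-- The curvature is a combination of the components of `betaMinus`, up to sign. -/
theorem sum_mul_mul_eq (i j : Fin 7) (x y : V7) : ∑ k, ∑ l, x k * y l * K i j k l =
    K i j 3 4 * ((x 3 * y 4 - x 4 * y 3) - (x 5 * y 6 - x 6 * y 5)) +
    K i j 3 5 * ((x 3 * y 5 - x 5 * y 3) + (x 4 * y 6 - x 6 * y 4)) +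
    K i j 3 6 * ((x 3 * y 6 - x 6 * y 3) - (x 4 * y 5 - x 5 * y 4)) := by
  have h0 : ∀ l, K i j 0 l = 0 := hK.right_eq_zero (by decide) i j
  have h1 : ∀ l, K i j 1 l = 0 := hK.right_eq_zero (by decide) i j
  have h2 : ∀ l, K i j 2 l = 0 := hK.right_eq_zero (by decide) i j
  have hs := hK.swap i j
  have hd : ∀ k, K i j k k = 0 := fun k => by linarith [hs k k]
  have h0' : ∀ l, K i j l 0 = 0 := fun l => by rw [hs, h0, neg_zero]
  have h1' : ∀ l, K i j l 1 = 0 := fun l => by rw [hs, h1, neg_zero]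
  have h2' : ∀ l, K i j l 2 = 0 := fun l => by rw [hs, h2, neg_zero]
  have h56 : K i j 5 6 = -K i j 3 4 := by
    rw [hK.pair_symm, (hK.selfdual i j).1, hK.pair_symm 3 4]
  have h46 : K i j 4 6 = K i j 3 5 := by
    rw [hK.pair_symm, (hK.selfdual i j).2.1, hK.pair_symm 3 5]
  have h45 : K i j 4 5 = -K i j 3 6 := by
    rw [hK.pair_symm, (hK.selfdual i j).2.2, hK.pair_symm 3 6]
  simp only [Fin.sum_univ_seven, h0, h1, h2, h0', h1', h2', hd, hs 4 3, hs 5 3, hs 5 4, hs 6 3,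
    hs 6 4, hs 6 5, h56, h46, h45]
  ring

/-- The Bianchi identity on the indices `3, 4, 5, 6`. -/
theorem trace_eq_zero : K 3 4 3 4 + K 3 5 3 5 + K 3 6 3 6 = 0 := by
  have h := hK.bianchi 3 4 5 6
  have h1 := (hK.selfdual 3 4).1
  have h2 := (hK.selfdual 3 5).2.1
  have h3 := (hK.selfdual 3 6).2.2
  rw [hK.pair_symm] at h1 h2 h3
  rw [hK.swap 3 5 6 4] at h
  linarith

end CurvatureRelations

/-- The skew matrix satisfying `FrameRelations` for the vector `x` whose lower right block is
`[ζ]⁺ + [ν]⁻`. -/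
def adaptedConn (ζ ν : Fin 3 → ℝ) (x : V7) : Fin 7 → Fin 7 → ℝ :=
  ![![0, x 2 + 2 * ζ 2, -x 1 - 2 * ζ 1, -x 4, x 3, -x 6, x 5],
    ![-x 2 - 2 * ζ 2, 0, x 0 + 2 * ζ 0, -x 5, x 6, x 3, -x 4],
    ![x 1 + 2 * ζ 1, -x 0 - 2 * ζ 0, 0, x 6, x 5, -x 4, -x 3],
    ![x 4, x 5, -x 6, 0, -ζ 0 - ν 0, -ζ 1 + ν 1, ζ 2 + ν 2],
    ![-x 3, -x 6, -x 5, ζ 0 + ν 0, 0, ζ 2 - ν 2, ζ 1 + ν 1],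
    ![x 6, -x 3, x 4, ζ 1 - ν 1, -ζ 2 + ν 2, 0, -ζ 0 + ν 0],
    ![-x 5, x 4, x 3, -ζ 2 - ν 2, -ζ 1 - ν 1, ζ 0 - ν 0, 0]]

/-- The two vectors are `ζ` and `ν`, solved from the lower right block as in `SO4Structure.zeta` and
`SO4Structure.nu`. -/
theorem FrameRelations.eq_adaptedConn {Ψ : Fin 7 → Fin 7 → ℝ} {x : V7} (h : FrameRelations Ψ x)
    (hskew : ∀ i j, Ψ i j = -Ψ j i) :
    Ψ = adaptedConn
      ![1 / 2 * (-Ψ 3 4 - Ψ 5 6), 1 / 2 * (-Ψ 3 5 + Ψ 4 6), 1 / 2 * (Ψ 3 6 + Ψ 4 5)]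
      ![1 / 2 * (-Ψ 3 4 + Ψ 5 6), 1 / 2 * (Ψ 3 5 + Ψ 4 6), 1 / 2 * (Ψ 3 6 - Ψ 4 5)] x := by
  obtain ⟨h01, h02, h12, h03, h04, h05, h06, h13, h14, h15, h16, h23, h24, h25, h26⟩ := h
  have hd : ∀ i, Ψ i i = 0 := fun i => by linarith [hskew i i]
  ext i j
  fin_cases i <;> fin_cases j <;>
    simp only [adaptedConn, Fin.zero_eta, Fin.mk_one, Fin.reduceFinMk, Fin.isValue, Matrix.cons_val, hd] <;>
    first
      | linarith [hskew 1 0, hskew 2 0, hskew 2 1, hskew 3 0, hskew 3 1, hskew 3 2]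
      | linarith [hskew 4 0, hskew 4 1, hskew 4 2, hskew 4 3, hskew 5 0, hskew 5 1]
      | linarith [hskew 5 2, hskew 5 3, hskew 5 4, hskew 6 0, hskew 6 1, hskew 6 2]
      | linarith [hskew 6 3, hskew 6 4, hskew 6 5]

/-- The value of `- ψ ∧ ω` on a pair of vectors, where `ψ` has the values `Ψ`, `Φ` and `ω` the
values `x`, `y`. -/
def tautRhs (Ψ Φ : Fin 7 → Fin 7 → ℝ) (x y : V7) (i : Fin 7) : ℝ :=
  -∑ j, (Ψ i j * y j - Φ i j * x j)

/-- The value of `- ψ ∧ ψ + R` on a pair of vectors, where `ψ` has the values `Ψ`, `Φ` and `ω` the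
values `x`, `y`. The curvature `R` is that of the unit sphere plus `K`. -/
def connRhs (K : Fin 7 → Fin 7 → Fin 7 → Fin 7 → ℝ) (Ψ Φ : Fin 7 → Fin 7 → ℝ) (x y : V7)
    (i j : Fin 7) : ℝ :=
  -∑ l, (Ψ i l * Φ l j - Φ i l * Ψ l j) + (x i * y j - y i * x j) + ∑ k, ∑ l, x k * y l * K i j k l

variable (ζ ν ζ' ν' : Fin 3 → ℝ) (x y : V7) {K : Fin 7 → Fin 7 → Fin 7 → Fin 7 → ℝ}

theorem tautRhs_adaptedConn : tautRhs (adaptedConn ζ ν x) (adaptedConn ζ' ν' y) x y =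
    ![-(2 * (ζ 2 * y 1 - ζ' 2 * x 1) - 2 * (ζ 1 * y 2 - ζ' 1 * x 2)) +
        2 * ((x 1 * y 2 - y 1 * x 2) - (x 3 * y 4 - y 3 * x 4) - (x 5 * y 6 - y 5 * x 6)),
      -(-2 * (ζ 2 * y 0 - ζ' 2 * x 0) + 2 * (ζ 0 * y 2 - ζ' 0 * x 2)) +
        2 * ((x 2 * y 0 - y 2 * x 0) - (x 3 * y 5 - y 3 * x 5) + (x 4 * y 6 - y 4 * x 6)),
      -(2 * (ζ 1 * y 0 - ζ' 1 * x 0) - 2 * (ζ 0 * y 1 - ζ' 0 * x 1)) +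
        2 * ((x 0 * y 1 - y 0 * x 1) + (x 3 * y 6 - y 3 * x 6) + (x 4 * y 5 - y 4 * x 5)),
      -(((-ζ 0 - ν 0) * y 4 - (-ζ' 0 - ν' 0) * x 4) + ((-ζ 1 + ν 1) * y 5 - (-ζ' 1 + ν' 1) * x 5) +
          ((ζ 2 + ν 2) * y 6 - (ζ' 2 + ν' 2) * x 6)) +
        ((x 0 * y 4 - y 0 * x 4) + (x 1 * y 5 - y 1 * x 5) - (x 2 * y 6 - y 2 * x 6)),
      -(((ζ 0 + ν 0) * y 3 - (ζ' 0 + ν' 0) * x 3) + ((ζ 2 - ν 2) * y 5 - (ζ' 2 - ν' 2) * x 5) +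
          ((ζ 1 + ν 1) * y 6 - (ζ' 1 + ν' 1) * x 6)) +
        (-(x 0 * y 3 - y 0 * x 3) - (x 2 * y 5 - y 2 * x 5) - (x 1 * y 6 - y 1 * x 6)),
      -(((ζ 1 - ν 1) * y 3 - (ζ' 1 - ν' 1) * x 3) + ((-ζ 2 + ν 2) * y 4 - (-ζ' 2 + ν' 2) * x 4) +
          ((-ζ 0 + ν 0) * y 6 - (-ζ' 0 + ν' 0) * x 6)) +
        (-(x 1 * y 3 - y 1 * x 3) + (x 2 * y 4 - y 2 * x 4) + (x 0 * y 6 - y 0 * x 6)),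
      -(((-ζ 2 - ν 2) * y 3 - (-ζ' 2 - ν' 2) * x 3) + ((-ζ 1 - ν 1) * y 4 - (-ζ' 1 - ν' 1) * x 4) +
          ((ζ 0 - ν 0) * y 5 - (ζ' 0 - ν' 0) * x 5)) +
        ((x 2 * y 3 - y 2 * x 3) + (x 1 * y 4 - y 1 * x 4) - (x 0 * y 5 - y 0 * x 5))] := by
  funext i
  fin_cases i <;>
    simp only [tautRhs, adaptedConn, Fin.sum_univ_seven, Fin.zero_eta, Fin.mk_one, Fin.reduceFinMk,
      Fin.isValue, Matrix.cons_val] <;>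
    ring

/-- The matrix of the curvature `K` on the forms `betaMinus`. The signs are due to the first of
these forms being `- β₁ ∧ β₂ + β₃ ∧ β₄`. -/
def weylMatrix (K : Fin 7 → Fin 7 → Fin 7 → Fin 7 → ℝ) : Matrix (Fin 3) (Fin 3) ℝ :=
  !![K 3 4 3 4, -K 3 4 3 5, -K 3 4 3 6;
    -K 3 4 3 5, K 3 5 3 5, K 3 5 3 6;
    -K 3 4 3 6, K 3 5 3 6, K 3 6 3 6]

/-- The `[ζ]⁺`-part of `- ψ ∧ ψ + R`. The contribution of the unit sphere cancels against that of
the products of the off-diagonal blocks of `ψ`. -/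
theorem connRhs_zeta (hK : CurvatureRelations K) (i : Fin 3) :
    let D := connRhs K (adaptedConn ζ ν x) (adaptedConn ζ' ν' y) x y
    ![1 / 2 * (-D 3 4 - D 5 6), 1 / 2 * (-D 3 5 + D 4 6), 1 / 2 * (D 3 6 + D 4 5)] i =
      2 * ![ζ 1 * ζ' 2 - ζ' 1 * ζ 2, ζ 2 * ζ' 0 - ζ' 2 * ζ 0, ζ 0 * ζ' 1 - ζ' 0 * ζ 1] i := by
  have t1 := fun k l => (hK.selfdual k l).1
  have t2 := fun k l => (hK.selfdual k l).2.1
  have t3 := fun k l => (hK.selfdual k l).2.2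
  simp only [connRhs, hK.sum_mul_mul_eq]
  fin_cases i <;>
    simp only [t1, t2, t3, adaptedConn, Fin.sum_univ_seven, Fin.zero_eta,
      Fin.mk_one, Fin.reduceFinMk, Fin.isValue, Matrix.cons_val] <;>
    ring

/-- The `[ν]⁻`-part of `- ψ ∧ ψ + R`. The unit sphere and the products of the off-diagonal blocks of
`ψ` together give the summand `2`. -/
theorem connRhs_nu (hK : CurvatureRelations K) (i : Fin 3) :
    let D := connRhs K (adaptedConn ζ ν x) (adaptedConn ζ' ν' y) x y
    ![1 / 2 * (-D 3 4 + D 5 6), 1 / 2 * (D 3 5 + D 4 6), 1 / 2 * (D 3 6 - D 4 5)] i =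
      2 * ![ν 1 * ν' 2 - ν' 1 * ν 2, ν 2 * ν' 0 - ν' 2 * ν 0, ν 0 * ν' 1 - ν' 0 * ν 1] i +
      ∑ j, ((2 : ℝ) • (1 : Matrix (Fin 3) (Fin 3) ℝ) + weylMatrix K) i j *
        ![-(x 3 * y 4 - y 3 * x 4) + (x 5 * y 6 - y 5 * x 6),
          (x 3 * y 5 - y 3 * x 5) + (x 4 * y 6 - y 4 * x 6),
          (x 3 * y 6 - y 3 * x 6) - (x 4 * y 5 - y 4 * x 5)] j := by
  have t1 := fun k l => (hK.selfdual k l).1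
  have t2 := fun k l => (hK.selfdual k l).2.1
  have t3 := fun k l => (hK.selfdual k l).2.2
  have p1 := hK.pair_symm 3 5 3 4
  have p2 := hK.pair_symm 3 6 3 4
  have p3 := hK.pair_symm 3 6 3 5
  simp only [connRhs, hK.sum_mul_mul_eq]
  rw [Fin.sum_univ_three]
  fin_cases i <;>
    simp [t1, t2, t3, p1, p2, p3, adaptedConn, weylMatrix, Fin.sum_univ_seven] <;>
    ring

end CurvatureAlgebra

/-! ### The curvature of a quaternion-Sasakian manifold -/

section CurvatureOfCoframes

set_option linter.unusedSectionVars false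

variable {M : Type*} [TopologicalSpace M] [ChartedSpace V7 M] [IsManifold (𝓡 7) ∞ M]
  {g : Π x : M, TangentSpace (𝓡 7) x →L[ℝ] TangentSpace (𝓡 7) x →L[ℝ] ℝ}
  {N : M → Cmm 3} {P : M → Cmm 4}

/-- The components in the coframe `b` of the curvature minus that of the unit sphere, where the
latter is `(u, v) ↦ u ⊗ v♭ - v ⊗ u♭`. -/
def curvDefect (g : Π x : M, TangentSpace (𝓡 7) x →L[ℝ] TangentSpace (𝓡 7) x →L[ℝ] ℝ)
    (b : HomTotal M) (i j k l : Fin 7) : ℝ :=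
  frameCurv g b (bas k) (bas l) (bas j) i - (bas l j * bas k i - bas k j * bas l i)

theorem bas_comm (i j : Fin 7) : bas i j = bas j i := by
  simp [eq_comm]

theorem starEta0_zero (p q r : Fin 7) : starEta0 ![0, bas p, bas q, bas r] = 0 := by
  rw [starEta0_bas]
  simp

variable {b : HomTotal M} (hg : SmoothMetric (𝓡 7) g) (ha : IsAdapted g N P b)

include ha in
theorem IsAdapted.metric_inverse (v : V7) (i : Fin 7) :
    metricAt (I := 𝓡 7) g b.1 v ((coframe b).inverse (bas i)) = coframe b v i := by
  rw [ha.metric, apply_inverse_self ha.isInvertible]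
  simp

include hg ha in
theorem curvatureRelations
    (hR : ∀ u v a c d : V7,
      let R : V7 → V7 := fun w => curv (chartChr (𝓡 7) g b.1) (extChartAt (𝓡 7) b.1 b.1) u v w -
        (metricAt (I := 𝓡 7) g b.1 v w • u - metricAt (I := 𝓡 7) g b.1 u w • v)
      N b.1 ![R a, c, d] + N b.1 ![a, R c, d] + N b.1 ![a, c, R d] = 0) :
    CurvatureRelations (curvDefect g b) := by
  have ht := mem_extChartAt_target (I := 𝓡 7) b.1
  have hskew : ∀ i j k l, curvDefect g b i j k l = -curvDefect g b j i k l := by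
    intro i j k l
    have h := hg.chart_curv_skew ht ((coframe b).inverse (bas k)) ((coframe b).inverse (bas l))
      ((coframe b).inverse (bas j)) ((coframe b).inverse (bas i))
    rw [metricInChart_center, metricInChart_center, ha.metric_inverse, hg.symm,
      ha.metric_inverse] at h
    simp only [curvDefect, frameCurv, bas_comm l i, bas_comm l j, bas_comm k i, bas_comm k j]
    linarith
  refine ⟨hskew, fun i j k l => ?_, fun i j k l => ?_, fun k l => ?_⟩
  · have h := curv_swap (chartChr (𝓡 7) g b.1) (extChartAt (𝓡 7) b.1 b.1)
      ((coframe b).inverse (bas k)) ((coframe b).inverse (bas l)) ((coframe b).inverse (bas j))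
    simp only [curvDefect, frameCurv, h, map_neg, PiLp.neg_apply]
    ring
  · have h := congrArg (fun v => coframe b v i) (hg.chart_curv_bianchi ht
      ((coframe b).inverse (bas k)) ((coframe b).inverse (bas l)) ((coframe b).inverse (bas j)))
    simp only [map_add, PiLp.add_apply, map_zero, PiLp.zero_apply] at h
    simp only [curvDefect, frameCurv, bas_comm l j, bas_comm k j, bas_comm l k]
    linarith
  · refine frameRelations_of_etaVar _ (fun i j => hskew i j k l) 0 fun p q r => ?_
    rw [starEta0_zero, neg_eq_zero]
    have hcol : ∀ m, matCol (fun i j => curvDefect g b i j k l) m =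
        coframe b (curv (chartChr (𝓡 7) g b.1) (extChartAt (𝓡 7) b.1 b.1)
          ((coframe b).inverse (bas k)) ((coframe b).inverse (bas l)) ((coframe b).inverse (bas m)) -
          (metricAt (I := 𝓡 7) g b.1 ((coframe b).inverse (bas l)) ((coframe b).inverse (bas m)) •
              (coframe b).inverse (bas k) -
            metricAt (I := 𝓡 7) g b.1 ((coframe b).inverse (bas k)) ((coframe b).inverse (bas m)) •
              (coframe b).inverse (bas l))) := by
      intro m
      rw [ha.metric_inverse, ha.metric_inverse]
      simp only [map_sub, map_smul, apply_inverse_self ha.isInvertible]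
      ext i
      rfl
    have h := hR ((coframe b).inverse (bas k)) ((coframe b).inverse (bas l))
      ((coframe b).inverse (bas p)) ((coframe b).inverse (bas q)) ((coframe b).inverse (bas r))
    simp only [ha.eta, Matrix.cons_val, ← hcol, apply_inverse_self ha.isInvertible] at h
    exact h

end CurvatureOfCoframes

/-! ### Exterior derivatives on the bundle of `SO(4)`-coframes -/

section StructureEquations

set_option linter.unusedSectionVars false

variable {M : Type*} [TopologicalSpace M] [ChartedSpace V7 M] [IsManifold (𝓡 7) ∞ M]
  {g : Π x : M, TangentSpace (𝓡 7) x →L[ℝ] TangentSpace (𝓡 7) x →L[ℝ] ℝ}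
  {N : M → Cmm 3} {P : M → Cmm 4}

/-- The forms `ζ` of the Levi-Civita connection of any metric `g`. -/
def zetaOf (g : Π x : M, TangentSpace (𝓡 7) x →L[ℝ] TangentSpace (𝓡 7) x →L[ℝ] ℝ) :
    Fin 3 → OneForm homModel (HomTotal M) :=
  ![(1 / 2 : ℝ) • (-connForm g 3 4 - connForm g 5 6),
    (1 / 2 : ℝ) • (-connForm g 3 5 + connForm g 4 6),
    (1 / 2 : ℝ) • (connForm g 3 6 + connForm g 4 5)]

/-- The forms `ν` of the Levi-Civita connection of any metric `g`. -/
def nuOf (g : Π x : M, TangentSpace (𝓡 7) x →L[ℝ] TangentSpace (𝓡 7) x →L[ℝ] ℝ) :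
    Fin 3 → OneForm homModel (HomTotal M) :=
  ![(1 / 2 : ℝ) • (-connForm g 3 4 + connForm g 5 6),
    (1 / 2 : ℝ) • (connForm g 3 5 + connForm g 4 6),
    (1 / 2 : ℝ) • (connForm g 3 6 - connForm g 4 5)]

/-- The value of the `ℝ⁷`-valued tautological form on a tangent vector. -/
def tautVec (b : HomTotal M) (t : TangentSpace homModel b) : V7 :=
  WithLp.toLp 2 fun i => tautForm i b t

/-- The value of the connection form on a vector tangent to the bundle of adapted coframes,
expressed by those of `ζ`, `ν` and the tautological form. -/
def connTable (g : Π x : M, TangentSpace (𝓡 7) x →L[ℝ] TangentSpace (𝓡 7) x →L[ℝ] ℝ)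
    (b : HomTotal M) (t : TangentSpace homModel b) : Fin 7 → Fin 7 → ℝ :=
  adaptedConn (fun i => zetaOf g i b t) (fun i => nuOf g i b t) (tautVec b t)

variable (hg : SmoothMetric (𝓡 7) g) {B : Set (HomTotal M)} (hB : ∀ b ∈ B, IsAdapted g N P b)
  (hN : ∀ x, ∀ y ∈ (extChartAt (𝓡 7) x).target,
      HasCovDeriv g N (fun x v w => P x (Fin.cons v w)) x y)
  {k : ℕ} {U : Set (EuclideanSpace ℝ (Fin k))} {u : EuclideanSpace ℝ (Fin k) → HomTotal M}
  (hu : IsSmoothMapInto homModel B U u) {z : EuclideanSpace ℝ (Fin k)} (hz : z ∈ U)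

include hg hB hN hu hz

/-- This holds only on vectors tangent to the set `B` of adapted coframes, that is, on pullbacks
along maps into `B`. -/
theorem connForm_eq_connTable (v : EuclideanSpace ℝ (Fin k)) :
    (fun i j => pullback u (connForm g i j) z v) =
      connTable g (u z) (mfderiv 𝓘(ℝ, EuclideanSpace ℝ (Fin k)) homModel u z v) := by
  have ha : ∀ z ∈ U, IsAdapted g N P (u z) := fun z hz => hB _ (hu.2.2 hz)
  rw [(connForm_frameRelations hg hu.1 hu.2.1 ha hz hN v).eq_adaptedConn
    (connForm_skew hg hu.1 hu.2.1 ha hz v), connTable]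
  refine congrArg₂ (fun ζ ν => adaptedConn ζ ν _) ?_ ?_
  · funext i
    fin_cases i <;> rfl
  · funext i
    fin_cases i <;> rfl

theorem dOne_tautForm_eq (v w : EuclideanSpace ℝ (Fin k)) (i : Fin 7) :
    dOne (pullback u (tautForm i)) z v w =
      tautRhs (connTable g (u z) (mfderiv 𝓘(ℝ, EuclideanSpace ℝ (Fin k)) homModel u z v))
        (connTable g (u z) (mfderiv 𝓘(ℝ, EuclideanSpace ℝ (Fin k)) homModel u z w))
        (tautVec (u z) (mfderiv 𝓘(ℝ, EuclideanSpace ℝ (Fin k)) homModel u z v))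
        (tautVec (u z) (mfderiv 𝓘(ℝ, EuclideanSpace ℝ (Fin k)) homModel u z w)) i := by
  rw [dOne_pullback_tautForm hu.1 hu.2.1 hg (fun z hz => (hB _ (hu.2.2 hz)).isInvertible) hz,
    ← connForm_eq_connTable hg hB hN hu hz v, ← connForm_eq_connTable hg hB hN hu hz w]
  rfl

theorem dOne_connForm_eq (v w : EuclideanSpace ℝ (Fin k)) (i j : Fin 7) :
    dOne (pullback u (connForm g i j)) z v w =
      connRhs (curvDefect g (u z))
        (connTable g (u z) (mfderiv 𝓘(ℝ, EuclideanSpace ℝ (Fin k)) homModel u z v))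
        (connTable g (u z) (mfderiv 𝓘(ℝ, EuclideanSpace ℝ (Fin k)) homModel u z w))
        (tautVec (u z) (mfderiv 𝓘(ℝ, EuclideanSpace ℝ (Fin k)) homModel u z v))
        (tautVec (u z) (mfderiv 𝓘(ℝ, EuclideanSpace ℝ (Fin k)) homModel u z w)) i j := by
  rw [dOne_pullback_connForm hu.1 hu.2.1 hg (fun z hz => (hB _ (hu.2.2 hz)).isInvertible) hz,
    ← connForm_eq_connTable hg hB hN hu hz v, ← connForm_eq_connTable hg hB hN hu hz w, connRhs,
    add_assoc]
  have h : ∀ x y : V7, ∑ l, ∑ m, x l * y m * frameCurv g (u z) (bas l) (bas m) (bas j) i =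
      (x i * y j - y i * x j) + ∑ l, ∑ m, x l * y m * curvDefect g (u z) i j l m := by
    intro x y
    have h1 : ∑ l, ∑ m, x l * y m * ((bas m : V7) j * (bas l : V7) i - (bas l : V7) j * (bas m : V7) i) =
        x i * y j - y i * x j := by
      have h2 : ∀ (f : V7) (i : Fin 7), ∑ l, f l * (bas l : V7) i = f i := fun f i => by simp
      have h3 : ∀ i j : Fin 7, ∑ l, ∑ m, x l * y m * ((bas m : V7) j * (bas l : V7) i) =
          x i * y j := by
        intro i j
        rw [← h2 x i, ← h2 y j, Finset.sum_mul_sum]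
        exact Finset.sum_congr rfl fun l _ => Finset.sum_congr rfl fun m _ => by ring
      simp only [mul_sub, Finset.sum_sub_distrib, h3]
      have h4 : ∀ l m : Fin 7, x l * y m * ((bas l : V7) j * (bas m : V7) i) =
          x l * y m * ((bas m : V7) i * (bas l : V7) j) := fun l m => by ring
      simp only [h4, h3]
      ring
    rw [← h1, ← Finset.sum_add_distrib]
    refine Finset.sum_congr rfl fun l _ => ?_
    rw [← Finset.sum_add_distrib]
    refine Finset.sum_congr rfl fun m _ => ?_
    rw [curvDefect]
    ring
  exact congrArg (_ + ·) (h _ _)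

omit hg hB hN hu hz in
theorem dOne_comb {Z : Type*} [NormedAddCommGroup Z] [NormedSpace ℝ Z] {a b : Z → Z →L[ℝ] ℝ} {z : Z}
    (ha : DifferentiableAt ℝ a z) (hb : DifferentiableAt ℝ b z) (r s t : ℝ) (v w : Z) :
    dOne (fun z => r • (s • a z + t • b z)) z v w = r * (s * dOne a z v w + t * dOne b z v w) := by
  have h := ((ha.hasFDerivAt.const_smul s).add (hb.hasFDerivAt.const_smul t)).const_smul r
  have h' : HasFDerivAt (fun z => r • (s • a z + t • b z)) _ z := h
  rw [dOne, h'.fderiv]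
  simp [dOne]
  ring

end StructureEquations

section StructureEquations

set_option linter.unusedSectionVars false

variable {M : Type*} [TopologicalSpace M] [ChartedSpace V7 M] [IsManifold (𝓡 7) ∞ M]
  {g : Π x : M, TangentSpace (𝓡 7) x →L[ℝ] TangentSpace (𝓡 7) x →L[ℝ] ℝ}
  {N : M → Cmm 3} {P : M → Cmm 4}
  (hg : SmoothMetric (𝓡 7) g) {B : Set (HomTotal M)} (hB : ∀ b ∈ B, IsAdapted g N P b)
  (hN : ∀ x, ∀ y ∈ (extChartAt (𝓡 7) x).target,
      HasCovDeriv g N (fun x v w => P x (Fin.cons v w)) x y)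

include hg hB hN

theorem isExtDerivOn_tautForm {θ : OneForm homModel (HomTotal M)} {i : Fin 7}
    (hθ : θ = tautForm i) {Ω : TwoForm homModel (HomTotal M)}
    (hΩ : ∀ b : HomTotal M, ∀ v w : TangentSpace homModel b,
      tautRhs (connTable g b v) (connTable g b w) (tautVec b v) (tautVec b w) i = Ω b v w) :
    IsExtDerivOn B θ Ω := by
  subst hθ
  intro k U u hu
  have h : ∀ z ∈ U, ContDiffAt ℝ ∞ (pullback u (tautForm i)) z := fun z hz =>
    contDiffAt_pullback_tautForm hu.1 hu.2.1 hz i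
  refine ⟨fun z hz => (h z hz).contDiffWithinAt, fun z hz v w => ?_⟩
  rw [extDeriv_ofSubsingleton ((h z hz).differentiableAt (by simp)),
    dOne_tautForm_eq hg hB hN hu hz, hΩ]

/-- The coefficients `r`, `s`, `t` cover the combinations of two entries of `ψ` that define `ζ` and
`ν`. -/
theorem isExtDerivOn_connForm {θ : OneForm homModel (HomTotal M)} {i j p q : Fin 7} {r s t : ℝ}
    (hθ : ∀ b v, θ b v = r * (s * connForm g i j b v + t * connForm g p q b v)) {Ω : TwoForm homModel (HomTotal M)}
    (hΩ : ∀ b ∈ B, ∀ v w : TangentSpace homModel b,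
      r * (s * connRhs (curvDefect g b) (connTable g b v) (connTable g b w) (tautVec b v)
        (tautVec b w) i j + t * connRhs (curvDefect g b) (connTable g b v) (connTable g b w)
        (tautVec b v) (tautVec b w) p q) = Ω b v w) :
    IsExtDerivOn B θ Ω := by
  intro k U u hu
  have he : ∀ z ∈ U, (coframe (u z)).IsInvertible := fun z hz => (hB _ (hu.2.2 hz)).isInvertible
  have h : ∀ i j, ∀ z ∈ U, ContDiffAt ℝ ∞ (pullback u (connForm g i j)) z := fun i j z hz =>
    contDiffAt_pullback_connForm hu.1 hu.2.1 hg he hz i j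
  have hp : pullback u θ = fun z =>
      r • (s • pullback u (connForm g i j) z + t • pullback u (connForm g p q) z) := by
    funext z
    ext v
    exact hθ _ _
  have h' : ∀ z ∈ U, ContDiffAt ℝ ∞ (pullback u θ) z := by
    intro z hz
    rw [hp]
    exact (((h i j z hz).const_smul s).add ((h p q z hz).const_smul t)).const_smul r
  refine ⟨fun z hz => (h' z hz).contDiffWithinAt, fun z hz v w => ?_⟩
  rw [extDeriv_ofSubsingleton ((h' z hz).differentiableAt (by simp)), hp,
    dOne_comb ((h i j z hz).differentiableAt (by simp)) ((h p q z hz).differentiableAt (by simp)),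
    dOne_connForm_eq hg hB hN hu hz, dOne_connForm_eq hg hB hN hu hz, hΩ _ (hu.2.2 hz)]

end StructureEquations

/-! ### The structure equations for `α`, `β`, `ζ`, `ν` -/

section FormEvaluation

variable {E : Type*} [NormedAddCommGroup E] [NormedSpace ℝ E]
  {H : Type*} [TopologicalSpace H] {I : ModelWithCorners ℝ E H}
  {X : Type*} [TopologicalSpace X] [ChartedSpace H X]

theorem wedge_apply (θ η : OneForm I X) (x : X) (v w : TangentSpace I x) :
    wedge θ η x v w = θ x v * η x w - η x v * θ x w := rfl

theorem oneForm_add_apply (θ η : OneForm I X) (x : X) (v : TangentSpace I x) :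
    (θ + η) x v = θ x v + η x v := rfl

theorem oneForm_sub_apply (θ η : OneForm I X) (x : X) (v : TangentSpace I x) :
    (θ - η) x v = θ x v - η x v := rfl

theorem oneForm_neg_apply (θ : OneForm I X) (x : X) (v : TangentSpace I x) :
    (-θ) x v = -θ x v := rfl

theorem oneForm_zero_apply (x : X) (v : TangentSpace I x) : (0 : OneForm I X) x v = 0 := rfl

theorem oneForm_smul_apply (c : ℝ) (θ : OneForm I X) (x : X) (v : TangentSpace I x) :
    (c • θ) x v = c * θ x v := rfl

theorem twoForm_add_apply (θ η : TwoForm I X) (x : X) (v w : TangentSpace I x) :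
    (θ + η) x v w = θ x v w + η x v w := rfl

theorem twoForm_sub_apply (θ η : TwoForm I X) (x : X) (v w : TangentSpace I x) :
    (θ - η) x v w = θ x v w - η x v w := rfl

theorem twoForm_neg_apply (θ : TwoForm I X) (x : X) (v w : TangentSpace I x) :
    (-θ) x v w = -θ x v w := rfl

theorem twoForm_smul_apply (c : ℝ) (θ : TwoForm I X) (x : X) (v w : TangentSpace I x) :
    (c • θ) x v w = c * θ x v w := rfl

theorem matWedge_three_apply (A : Matrix (Fin 3) (Fin 3) (OneForm I X)) (θ : Fin 3 → OneForm I X)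
    (i : Fin 3) (x : X) (v w : TangentSpace I x) :
    (-matWedge A θ i) x v w = -(wedge (A i 0) (θ 0) x v w + wedge (A i 1) (θ 1) x v w +
      wedge (A i 2) (θ 2) x v w) := by
  rw [matWedge, Fin.sum_univ_three]
  rfl

theorem matWedge_four_apply (A : Matrix (Fin 4) (Fin 4) (OneForm I X)) (θ : Fin 4 → OneForm I X)
    (i : Fin 4) (x : X) (v w : TangentSpace I x) :
    (-matWedge A θ i) x v w = -(wedge (A i 0) (θ 0) x v w + wedge (A i 1) (θ 1) x v w +
      wedge (A i 2) (θ 2) x v w + wedge (A i 3) (θ 3) x v w) := by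
  rw [matWedge, Fin.sum_univ_four]
  rfl

theorem alpha_rhs_apply (a z : Fin 3 → OneForm I X) (b : Fin 4 → OneForm I X) (i : Fin 3) (x : X)
    (v w : TangentSpace I x) :
    (-matWedge !![0, (2 : ℝ) • z 2, -((2 : ℝ) • z 1); -((2 : ℝ) • z 2), 0, (2 : ℝ) • z 0;
        (2 : ℝ) • z 1, -((2 : ℝ) • z 0), 0] a i +
      (2 : ℝ) •
        ![wedge (a 1) (a 2) - wedge (b 0) (b 1) - wedge (b 2) (b 3),
          wedge (a 2) (a 0) - wedge (b 0) (b 2) + wedge (b 1) (b 3),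
          wedge (a 0) (a 1) + wedge (b 0) (b 3) + wedge (b 1) (b 2)] i) x v w =
    ![-(2 * (z 2 x v * a 1 x w - z 2 x w * a 1 x v) - 2 * (z 1 x v * a 2 x w - z 1 x w * a 2 x v)) +
        2 * ((a 1 x v * a 2 x w - a 1 x w * a 2 x v) - (b 0 x v * b 1 x w - b 0 x w * b 1 x v) -
          (b 2 x v * b 3 x w - b 2 x w * b 3 x v)),
      -(-2 * (z 2 x v * a 0 x w - z 2 x w * a 0 x v) + 2 * (z 0 x v * a 2 x w - z 0 x w * a 2 x v)) +
        2 * ((a 2 x v * a 0 x w - a 2 x w * a 0 x v) - (b 0 x v * b 2 x w - b 0 x w * b 2 x v) +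
          (b 1 x v * b 3 x w - b 1 x w * b 3 x v)),
      -(2 * (z 1 x v * a 0 x w - z 1 x w * a 0 x v) - 2 * (z 0 x v * a 1 x w - z 0 x w * a 1 x v)) +
        2 * ((a 0 x v * a 1 x w - a 0 x w * a 1 x v) + (b 0 x v * b 3 x w - b 0 x w * b 3 x v) +
          (b 1 x v * b 2 x w - b 1 x w * b 2 x v))] i := by
  rw [twoForm_add_apply, matWedge_three_apply, twoForm_smul_apply]
  fin_cases i <;>
    simp only [Fin.zero_eta, Fin.mk_one, Fin.reduceFinMk, Fin.isValue, Matrix.cons_val,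
      Matrix.of_apply, wedge_apply, twoForm_add_apply, twoForm_sub_apply, oneForm_neg_apply,
      oneForm_zero_apply, oneForm_smul_apply] <;>
    ring

theorem beta_rhs_apply (a z n : Fin 3 → OneForm I X) (b : Fin 4 → OneForm I X) (i : Fin 4) (x : X)
    (v w : TangentSpace I x) :
    (-matWedge !![0, -z 0 - n 0, -z 1 + n 1, z 2 + n 2; z 0 + n 0, 0, z 2 - n 2, z 1 + n 1;
        z 1 - n 1, -z 2 + n 2, 0, -z 0 + n 0; -z 2 - n 2, -z 1 - n 1, z 0 - n 0, 0] b i +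
      ![wedge (a 0) (b 1) + wedge (a 1) (b 2) - wedge (a 2) (b 3),
        -wedge (a 0) (b 0) - wedge (a 2) (b 2) - wedge (a 1) (b 3),
        -wedge (a 1) (b 0) + wedge (a 2) (b 1) + wedge (a 0) (b 3),
        wedge (a 2) (b 0) + wedge (a 1) (b 1) - wedge (a 0) (b 2)] i) x v w =
    ![-(((-z 0 x v - n 0 x v) * b 1 x w - (-z 0 x w - n 0 x w) * b 1 x v) +
          ((-z 1 x v + n 1 x v) * b 2 x w - (-z 1 x w + n 1 x w) * b 2 x v) +
          ((z 2 x v + n 2 x v) * b 3 x w - (z 2 x w + n 2 x w) * b 3 x v)) +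
        ((a 0 x v * b 1 x w - a 0 x w * b 1 x v) + (a 1 x v * b 2 x w - a 1 x w * b 2 x v) -
          (a 2 x v * b 3 x w - a 2 x w * b 3 x v)),
      -(((z 0 x v + n 0 x v) * b 0 x w - (z 0 x w + n 0 x w) * b 0 x v) +
          ((z 2 x v - n 2 x v) * b 2 x w - (z 2 x w - n 2 x w) * b 2 x v) +
          ((z 1 x v + n 1 x v) * b 3 x w - (z 1 x w + n 1 x w) * b 3 x v)) +
        (-(a 0 x v * b 0 x w - a 0 x w * b 0 x v) - (a 2 x v * b 2 x w - a 2 x w * b 2 x v) -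
          (a 1 x v * b 3 x w - a 1 x w * b 3 x v)),
      -(((z 1 x v - n 1 x v) * b 0 x w - (z 1 x w - n 1 x w) * b 0 x v) +
          ((-z 2 x v + n 2 x v) * b 1 x w - (-z 2 x w + n 2 x w) * b 1 x v) +
          ((-z 0 x v + n 0 x v) * b 3 x w - (-z 0 x w + n 0 x w) * b 3 x v)) +
        (-(a 1 x v * b 0 x w - a 1 x w * b 0 x v) + (a 2 x v * b 1 x w - a 2 x w * b 1 x v) +
          (a 0 x v * b 3 x w - a 0 x w * b 3 x v)),
      -(((-z 2 x v - n 2 x v) * b 0 x w - (-z 2 x w - n 2 x w) * b 0 x v) +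
          ((-z 1 x v - n 1 x v) * b 1 x w - (-z 1 x w - n 1 x w) * b 1 x v) +
          ((z 0 x v - n 0 x v) * b 2 x w - (z 0 x w - n 0 x w) * b 2 x v)) +
        ((a 2 x v * b 0 x w - a 2 x w * b 0 x v) + (a 1 x v * b 1 x w - a 1 x w * b 1 x v) -
          (a 0 x v * b 2 x w - a 0 x w * b 2 x v))] i := by
  rw [twoForm_add_apply, matWedge_four_apply]
  fin_cases i <;>
    simp only [Fin.zero_eta, Fin.mk_one, Fin.reduceFinMk, Fin.isValue, Matrix.cons_val,
      Matrix.of_apply, wedge_apply, twoForm_add_apply, twoForm_sub_apply, twoForm_neg_apply,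
      oneForm_add_apply, oneForm_sub_apply, oneForm_neg_apply, oneForm_zero_apply] <;>
    ring

theorem zeta_rhs_apply (z : Fin 3 → OneForm I X) (i : Fin 3) (x : X) (v w : TangentSpace I x) :
    ((2 : ℝ) • ![wedge (z 1) (z 2), wedge (z 2) (z 0), wedge (z 0) (z 1)] i) x v w =
      2 * ![z 1 x v * z 2 x w - z 1 x w * z 2 x v, z 2 x v * z 0 x w - z 2 x w * z 0 x v,
        z 0 x v * z 1 x w - z 0 x w * z 1 x v] i := by
  rw [twoForm_smul_apply]
  fin_cases i <;>
    simp only [Fin.zero_eta, Fin.mk_one, Fin.reduceFinMk, Fin.isValue, Matrix.cons_val,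
      wedge_apply] <;>
    ring

theorem nu_rhs_apply (n : Fin 3 → OneForm I X) (W : X → Matrix (Fin 3) (Fin 3) ℝ)
    (b : Fin 4 → OneForm I X) (i : Fin 3) (x : X) (v w : TangentSpace I x) :
    ((2 : ℝ) • ![wedge (n 1) (n 2), wedge (n 2) (n 0), wedge (n 0) (n 1)] i +
      fun x => ∑ j : Fin 3, ((2 : ℝ) • (1 : Matrix (Fin 3) (Fin 3) ℝ) + W x) i j •
        (![-wedge (b 0) (b 1) + wedge (b 2) (b 3), wedge (b 0) (b 2) + wedge (b 1) (b 3),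
          wedge (b 0) (b 3) - wedge (b 1) (b 2)] : Fin 3 → TwoForm I X) j x) x v w =
      2 * ![n 1 x v * n 2 x w - n 1 x w * n 2 x v, n 2 x v * n 0 x w - n 2 x w * n 0 x v,
        n 0 x v * n 1 x w - n 0 x w * n 1 x v] i +
      ∑ j, ((2 : ℝ) • (1 : Matrix (Fin 3) (Fin 3) ℝ) + W x) i j *
        ![-(b 0 x v * b 1 x w - b 0 x w * b 1 x v) + (b 2 x v * b 3 x w - b 2 x w * b 3 x v),
          (b 0 x v * b 2 x w - b 0 x w * b 2 x v) + (b 1 x v * b 3 x w - b 1 x w * b 3 x v),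
          (b 0 x v * b 3 x w - b 0 x w * b 3 x v) - (b 1 x v * b 2 x w - b 1 x w * b 2 x v)] j := by
  rw [twoForm_add_apply, zeta_rhs_apply, Fin.sum_univ_three, Fin.sum_univ_three]
  have h1 := wedge_apply (b 0) (b 1) x v w
  have h2 := wedge_apply (b 2) (b 3) x v w
  have h3 := wedge_apply (b 0) (b 2) x v w
  have h4 := wedge_apply (b 1) (b 3) x v w
  have h5 := wedge_apply (b 0) (b 3) x v w
  have h6 := wedge_apply (b 1) (b 2) x v w
  rw [mul_comm (b 1 x v)] at h1
  rw [mul_comm (b 3 x v)] at h2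
  rw [mul_comm (b 2 x v)] at h3
  rw [mul_comm (b 3 x v)] at h4
  rw [mul_comm (b 3 x v)] at h5
  rw [mul_comm (b 2 x v)] at h6
  rw [← h1, ← h2, ← h3, ← h4, ← h5, ← h6]
  rfl

end FormEvaluation

section StructureEquations

set_option linter.unusedSectionVars false

variable {M : Type*} [TopologicalSpace M] [ChartedSpace V7 M] [IsManifold (𝓡 7) ∞ M]
  {g : Π x : M, TangentSpace (𝓡 7) x →L[ℝ] TangentSpace (𝓡 7) x →L[ℝ] ℝ}
  {N : M → Cmm 3} {P : M → Cmm 4}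

theorem zetaOf_apply (g : Π x : M, TangentSpace (𝓡 7) x →L[ℝ] TangentSpace (𝓡 7) x →L[ℝ] ℝ)
    (i : Fin 3) (b : HomTotal M) (v : TangentSpace homModel b) :
    zetaOf g i b v = ![1 / 2 * (-connForm g 3 4 b v - connForm g 5 6 b v),
      1 / 2 * (-connForm g 3 5 b v + connForm g 4 6 b v),
      1 / 2 * (connForm g 3 6 b v + connForm g 4 5 b v)] i := by
  fin_cases i <;> rfl

theorem nuOf_apply (g : Π x : M, TangentSpace (𝓡 7) x →L[ℝ] TangentSpace (𝓡 7) x →L[ℝ] ℝ)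
    (i : Fin 3) (b : HomTotal M) (v : TangentSpace homModel b) :
    nuOf g i b v = ![1 / 2 * (-connForm g 3 4 b v + connForm g 5 6 b v),
      1 / 2 * (connForm g 3 5 b v + connForm g 4 6 b v),
      1 / 2 * (connForm g 3 6 b v - connForm g 4 5 b v)] i := by
  fin_cases i <;> rfl

variable (hg : SmoothMetric (𝓡 7) g) {B : Set (HomTotal M)} (hB : ∀ b ∈ B, IsAdapted g N P b)
  (hN : ∀ x, ∀ y ∈ (extChartAt (𝓡 7) x).target,
      HasCovDeriv g N (fun x v w => P x (Fin.cons v w)) x y)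

set_option synthInstance.maxHeartbeats 400000
set_option maxHeartbeats 2000000
include hg hB hN

theorem alpha_structure (i : Fin 3) : IsExtDerivOn B (alpha M i)
    (-matWedge (so3Mat (fun j => (2 : ℝ) • zetaOf g j)) (alpha M) i +
      (2 : ℝ) •
        ![wedge (alpha M 1) (alpha M 2) - wedge (beta M 0) (beta M 1) - wedge (beta M 2) (beta M 3),
          wedge (alpha M 2) (alpha M 0) - wedge (beta M 0) (beta M 2) + wedge (beta M 1) (beta M 3),
          wedge (alpha M 0) (alpha M 1) + wedge (beta M 0) (beta M 3) + wedge (beta M 1) (beta M 2)]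
        i) := by
  refine isExtDerivOn_tautForm hg hB hN (i := Fin.castLE (by decide) i) (by fin_cases i <;> rfl)
    fun b v w => ?_
  refine Eq.trans ?_ (alpha_rhs_apply (alpha M) (zetaOf g) (beta M) i b v w).symm
  refine (congrFun (tautRhs_adaptedConn _ _ _ _ _ _) _).trans ?_
  fin_cases i <;> rfl

theorem beta_structure (i : Fin 4) : IsExtDerivOn B (beta M i)
    (-matWedge (so4Mat (zetaOf g) (nuOf g)) (beta M) i +
      ![wedge (alpha M 0) (beta M 1) + wedge (alpha M 1) (beta M 2) - wedge (alpha M 2) (beta M 3),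
        -wedge (alpha M 0) (beta M 0) - wedge (alpha M 2) (beta M 2) - wedge (alpha M 1) (beta M 3),
        -wedge (alpha M 1) (beta M 0) + wedge (alpha M 2) (beta M 1) + wedge (alpha M 0) (beta M 3),
        wedge (alpha M 2) (beta M 0) + wedge (alpha M 1) (beta M 1) - wedge (alpha M 0) (beta M 2)]
        i) := by
  refine isExtDerivOn_tautForm hg hB hN (i := Fin.natAdd 3 i) (by fin_cases i <;> rfl)
    fun b v w => ?_
  refine Eq.trans ?_ (beta_rhs_apply (alpha M) (zetaOf g) (nuOf g) (beta M) i b v w).symm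
  refine (congrFun (tautRhs_adaptedConn _ _ _ _ _ _) _).trans ?_
  fin_cases i <;> rfl

variable (hK : ∀ b ∈ B, CurvatureRelations (curvDefect g b))

include hK

theorem zeta_structure (i : Fin 3) : IsExtDerivOn B (zetaOf g i)
    ((2 : ℝ) • ![wedge (zetaOf g 1) (zetaOf g 2), wedge (zetaOf g 2) (zetaOf g 0),
      wedge (zetaOf g 0) (zetaOf g 1)] i) := by
  refine isExtDerivOn_connForm hg hB hN (i := 3) (p := ![5, 4, 4] i)
    (j := ![4, 5, 6] i) (q := ![6, 6, 5] i) (r := 1 / 2) (s := ![-1, -1, 1] i) (t := ![-1, 1, 1] i)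
    (fun b v => ?_) fun b hb v w => ?_
  · rw [zetaOf_apply]
    fin_cases i <;>
      simp only [Fin.zero_eta, Fin.mk_one, Fin.reduceFinMk, Fin.isValue, Matrix.cons_val] <;> ring
  · refine Eq.trans ?_ ((connRhs_zeta (fun i => zetaOf g i b v) (fun i => nuOf g i b v)
      (fun i => zetaOf g i b w) (fun i => nuOf g i b w) (tautVec b v) (tautVec b w) (hK b hb) i).trans
      (zeta_rhs_apply (zetaOf g) i b v w).symm)
    fin_cases i <;>
      simp only [Fin.zero_eta, Fin.mk_one, Fin.reduceFinMk, Fin.isValue, Matrix.cons_val,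
        connTable] <;> ring

theorem nu_structure (i : Fin 3) : IsExtDerivOn B (nuOf g i)
    ((2 : ℝ) • ![wedge (nuOf g 1) (nuOf g 2), wedge (nuOf g 2) (nuOf g 0),
        wedge (nuOf g 0) (nuOf g 1)] i +
      fun b => ∑ j : Fin 3, ((2 : ℝ) • (1 : Matrix (Fin 3) (Fin 3) ℝ) +
        weylMatrix (curvDefect g b)) i j • betaMinus M j b) := by
  refine isExtDerivOn_connForm hg hB hN (i := 3) (p := ![5, 4, 4] i)
    (j := ![4, 5, 6] i) (q := ![6, 6, 5] i) (r := 1 / 2) (s := ![-1, 1, 1] i) (t := ![1, 1, -1] i)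
    (fun b v => ?_) fun b hb v w => ?_
  · rw [nuOf_apply]
    fin_cases i <;>
      simp only [Fin.zero_eta, Fin.mk_one, Fin.reduceFinMk, Fin.isValue, Matrix.cons_val] <;> ring
  · refine Eq.trans ?_ ((connRhs_nu (fun i => zetaOf g i b v) (fun i => nuOf g i b v)
      (fun i => zetaOf g i b w) (fun i => nuOf g i b w) (tautVec b v) (tautVec b w) (hK b hb) i).trans
      (nu_rhs_apply (nuOf g) (fun b => weylMatrix (curvDefect g b)) (beta M) i b v w).symm)
    fin_cases i <;>
      simp only [Fin.zero_eta, Fin.mk_one, Fin.reduceFinMk, Fin.isValue, Matrix.cons_val,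
        connTable] <;> ring

end StructureEquations

/-! ### The functions `W` -/

section WeylFunctions

set_option linter.unusedSectionVars false

variable {M : Type*} [TopologicalSpace M] [ChartedSpace V7 M] [IsManifold (𝓡 7) ∞ M]
  {g : Π x : M, TangentSpace (𝓡 7) x →L[ℝ] TangentSpace (𝓡 7) x →L[ℝ] ℝ}
  {N : M → Cmm 3} {P : M → Cmm 4} {B : Set (HomTotal M)}

theorem isSmoothFunOn_curvDefect (hg : SmoothMetric (𝓡 7) g) (hB : ∀ b ∈ B, IsAdapted g N P b)
    (i j k l : Fin 7) : IsSmoothFunOn homModel B fun b => curvDefect g b i j k l := by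
  intro n U u hu z hz
  have h := contDiffAt_frameCurv hu.1 hu.2.1 hg (fun z hz => (hB _ (hu.2.2 hz)).isInvertible) hz
    (bas k) (bas l) (bas j)
  exact (((EuclideanSpace.proj i : V7 →L[ℝ] ℝ).contDiff.contDiffAt.comp z h).sub
    contDiffAt_const).contDiffWithinAt

theorem IsSmoothFunOn.neg {f : HomTotal M → ℝ} (h : IsSmoothFunOn homModel B f) :
    IsSmoothFunOn homModel B fun b => -f b :=
  fun k U u hu => (h k U u hu).neg

theorem isSmoothFunOn_weylMatrix (hg : SmoothMetric (𝓡 7) g) (hB : ∀ b ∈ B, IsAdapted g N P b)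
    (i j : Fin 3) : IsSmoothFunOn homModel B fun b => weylMatrix (curvDefect g b) i j := by
  have h := isSmoothFunOn_curvDefect hg hB
  fin_cases i <;> fin_cases j <;> first | exact h _ _ _ _ | exact (h _ _ _ _).neg

theorem weylMatrix_isSymm (K : Fin 7 → Fin 7 → Fin 7 → Fin 7 → ℝ) : (weylMatrix K).IsSymm := by
  ext i j
  fin_cases i <;> fin_cases j <;> rfl

theorem CurvatureRelations.trace_weylMatrix {K : Fin 7 → Fin 7 → Fin 7 → Fin 7 → ℝ}
    (hK : CurvatureRelations K) : (weylMatrix K).trace = 0 := by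
  rw [Matrix.trace_fin_three]
  exact hK.trace_eq_zero

theorem SO4Structure.zeta_eq (S : SO4Structure M) : S.zeta = zetaOf S.metric := by
  unfold SO4Structure.zeta zetaOf SO4Structure.psi
  with_reducible rfl

theorem SO4Structure.nu_eq (S : SO4Structure M) : S.nu = nuOf S.metric := by
  unfold SO4Structure.nu nuOf SO4Structure.psi
  with_reducible rfl

end WeylFunctions

end QuatSasakian

end

open QuatSasakian

set_option synthInstance.maxHeartbeats 400000 in
set_option maxHeartbeats 2000000 in
theorem proposition3p1 {M : Type*} [TopologicalSpace M] [ChartedSpace V7 M]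
    [IsManifold (𝓡 7) ∞ M] (S : SO4Structure M) (hS : S.IsQuaternionSasakian) :
    -- the first structure equations
    (∀ i : Fin 3, IsExtDerivOn S.coframeBundle (alpha M i)
      (-matWedge (so3Mat (fun j => (2 : ℝ) • S.zeta j)) (alpha M) i +
        (2 : ℝ) •
          ![wedge (alpha M 1) (alpha M 2) - wedge (beta M 0) (beta M 1) - wedge (beta M 2) (beta M 3),
            wedge (alpha M 2) (alpha M 0) - wedge (beta M 0) (beta M 2) + wedge (beta M 1) (beta M 3),
            wedge (alpha M 0) (alpha M 1) + wedge (beta M 0) (beta M 3) + wedge (beta M 1) (beta M 2)] i)) ∧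
    (∀ i : Fin 4, IsExtDerivOn S.coframeBundle (beta M i)
      (-matWedge (so4Mat S.zeta S.nu) (beta M) i +
        ![wedge (alpha M 0) (beta M 1) + wedge (alpha M 1) (beta M 2) - wedge (alpha M 2) (beta M 3),
          -wedge (alpha M 0) (beta M 0) - wedge (alpha M 2) (beta M 2) - wedge (alpha M 1) (beta M 3),
          -wedge (alpha M 1) (beta M 0) + wedge (alpha M 2) (beta M 1) + wedge (alpha M 0) (beta M 3),
          wedge (alpha M 2) (beta M 0) + wedge (alpha M 1) (beta M 1) - wedge (alpha M 0) (beta M 2)] i)) ∧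
    -- the second structure equations
    ∃ W : HomTotal M → Matrix (Fin 3) (Fin 3) ℝ,
      (∀ i j : Fin 3, IsSmoothFunOn homModel S.coframeBundle (fun b => W b i j)) ∧
      (∀ b ∈ S.coframeBundle, (W b).IsSymm ∧ (W b).trace = 0) ∧
      (∀ i : Fin 3, IsExtDerivOn S.coframeBundle (S.zeta i)
        ((2 : ℝ) • ![wedge (S.zeta 1) (S.zeta 2), wedge (S.zeta 2) (S.zeta 0),
          wedge (S.zeta 0) (S.zeta 1)] i)) ∧
      (∀ i : Fin 3, IsExtDerivOn S.coframeBundle (S.nu i)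
        ((2 : ℝ) • ![wedge (S.nu 1) (S.nu 2), wedge (S.nu 2) (S.nu 0),
            wedge (S.nu 0) (S.nu 1)] i +
          fun b => ∑ j : Fin 3, ((2 : ℝ) • (1 : Matrix (Fin 3) (Fin 3) ℝ) + W b) i j •
            betaMinus M j b)) := by
  have hg := S.smoothMetric
  have hB : ∀ b ∈ S.coframeBundle, IsAdapted S.metric S.etaT S.starT b := fun b hb => S.isAdapted hb
  have hN : ∀ x, ∀ y ∈ (extChartAt (𝓡 7) x).target,
      HasCovDeriv S.metric S.etaT (fun x v w => S.starT x (Fin.cons v w)) x y :=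
    fun x y hy => hS.eta_deriv hy
  have hK : ∀ b ∈ S.coframeBundle, CurvatureRelations (curvDefect S.metric b) := fun b hb =>
    curvatureRelations hg (hB b hb) (hS.curv_annihilates_eta b.1)
  rw [S.zeta_eq, S.nu_eq]
  exact ⟨alpha_structure hg hB hN, beta_structure hg hB hN,
    fun b => weylMatrix (curvDefect S.metric b), isSmoothFunOn_weylMatrix hg hB,
    fun b hb => ⟨weylMatrix_isSymm _, (hK b hb).trace_weylMatrix⟩,
    zeta_structure hg hB hN hK, nu_structure hg hB hN hK⟩
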